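/- Let $n\ge 3$ and fix a pole $\bar e\in\mathbb S^{n-1}\subset\mathbb R^n$; $du$ denotes the surface area measure on $\mathbb S^{n-1}$. A signed measure or $L^1$ function on $\mathbb S^{n-1}$ is called zonal if it is invariant under all rotations in $SO(n)$ fixing $\bar e$. For $k\ge 0$ let $P^n_k$ be the Legendre polynomial of dimension $n$ and degree $k$, normalized by $P^n_k(1)=1$, that is, $P^n_0=1$, $P^n_1(t)=t$ and $(k+n-2)P^n_{k+1}(t)=(2k+n-2)\,t\,P^n_k(t)-k\,P^n_{k-1}(t)$ for $k\ge1$. The multipliers of a zonal distribution $\nu$ on $\mathbb S^{n-1}$ are $a^n_k[\nu]=\langle P^n_k(\langle\bar e,\cdot\rangle),\nu\rangle$; for a signed measure, $a^n_k[\nu]=\int_{\mathbb S^{n-1}}P^n_k(\langle\bar e,u\rangle)\,\nu(du)$. (1) Let $\mu$ be a finite zonal signed measure on $\mathbb S^{n-1}$ with total variation $|\mu|$, and suppose that there exist $C>0$ and $\alpha\ge0$ such that $$|\mu|\big(\{u\in\mathbb S^{n-1}:|\langle\bar e,u\rangle|>\cos r\}\big)\le C r^{\alpha}\qquad\text{for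 all } r\ge 0 .$$ Then, as $k\to\infty$, $$a^n_k[\mu]\in\begin{cases}O(k^{-\alpha}),&\alpha<\frac{n-2}{2},\\ O(k^{-\frac{n-2}{2}}\ln k),&\alpha=\frac{n-2}{2},\\ O(k^{-\frac{n-2}{2}}),&\alpha>\frac{n-2}{2}.\end{cases}$$ (2) Let $1<i\le n-1$, and let $\Phi$ be a continuous (in the Hausdorff metric), translation invariant map from the space of convex bodies (non-empty compact convex sets) in $\mathbb R^n$ into itself that satisfies $\Phi K+\Phi L=\Phi(K\cup L)+\Phi(K\cap L)$ whenever $K\cup L$ is convex, intertwines the rotations in $SO(n)$, and is homogeneous of degree $i$, that is, $\Phi(\lambda K)=\lambda^i\Phi K$ for $\lambda\ge0$. Suppose that $\Phi$ is weakly monotone: $\Phi K\subseteq\Phi L$ whenever $K\subseteq L$ and the Steiner points of $K$ and $L$ are at the origin. Let $f\in L^1(\mathbb S^{n-1})$ be the generating function of $\Phi$, that is, $f$ is zonal, orthogonal to all linear functions, and $h(\Phi K,\cdot)=S_i(K,\cdot)\ast f$ for every convex body $K$. Here $h(K,u)=\max_{y\in K}\langle u,y\rangle$ is the support function; the area measures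 $S_0(K,\cdot),\dots,S_{n-1}(K,\cdot)$ are the finite measures on $\mathbb S^{n-1}$ such that for all $t>0$ and all Borel sets $A\subseteq\mathbb S^{n-1}$ the set of points $x$ whose distance $s$ to $K$ satisfies $0<s\le t$ and whose nearest point $p\in K$ satisfies $(x-p)/s\in A$ has volume $\frac1n\sum_{j=0}^{n-1}\binom nj t^{n-j}S_j(K,A)$; and the convolution is the distribution given by $\langle\varphi,S_i(K,\cdot)\ast f\rangle=\int(\varphi\ast f)\,dS_i(K,\cdot)$ for $\varphi\in C^\infty(\mathbb S^{n-1})$, where $(\varphi\ast f)(\vartheta\bar e)=\int_{\mathbb S^{n-1}}\varphi(\vartheta v)f(v)\,dv$ for $\vartheta\in SO(n)$. Let $\square_nf=\frac1{n-1}\Delta_{\mathbb S}f+f$ in the sense of distributions, where $\Delta_{\mathbb S}$ is the spherical Laplacian. Then $$a^n_k[\square_nf]\in O(k^{-1/2})\qquad\text{as } k\to\infty .$$ -/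

import Mathlib

open MeasureTheory Filter Asymptotics
open scoped ContDiff RealInnerProductSpace

noncomputable section

namespace ZonalMultipliers

/-- Euclidean space `ℝⁿ`. -/
abbrev Euc (n : ℕ) : Type := EuclideanSpace ℝ (Fin n)

/-- The unit sphere `𝕊ⁿ⁻¹` in `ℝⁿ`. -/
abbrev Sph (n : ℕ) : Type := Metric.sphere (0 : Euc n) 1

/-- The surface area measure `du` on the unit sphere. -/
def surf (n : ℕ) : Measure (Sph n) := (volume : Measure (Euc n)).toSphere

/-! ### Rotations -/

/-- `ϑ` belongs to `SO(n)`. -/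
def IsRotation {n : ℕ} (θ : Euc n ≃ₗᵢ[ℝ] Euc n) : Prop :=
  LinearMap.det (θ.toLinearEquiv : Euc n →ₗ[ℝ] Euc n) = 1

/-- The action of a linear isometry on the unit sphere. -/
def rotSph {n : ℕ} (θ : Euc n ≃ₗᵢ[ℝ] Euc n) (u : Sph n) : Sph n :=
  ⟨θ u, by rw [mem_sphere_zero_iff_norm, θ.norm_map, norm_eq_of_mem_sphere]⟩

/-! ### Zonal signed measures and functions -/

/-- A signed measure on the sphere is zonal if it is invariant under all rotations fixing `e`. -/
def ZonalMeasure {n : ℕ} (e : Sph n) (μ : SignedMeasure (Sph n)) : Prop :=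
  ∀ θ : Euc n ≃ₗᵢ[ℝ] Euc n, IsRotation θ → rotSph θ e = e →
    ∀ A : Set (Sph n), MeasurableSet A → μ (rotSph θ ⁻¹' A) = μ A

/-- An (almost everywhere defined) function on the sphere is zonal if it is invariant under all
rotations fixing `e`. -/
def ZonalFun {n : ℕ} (e : Sph n) (f : Sph n → ℝ) : Prop :=
  ∀ θ : Euc n ≃ₗᵢ[ℝ] Euc n, IsRotation θ → rotSph θ e = e →
    ∀ᵐ u ∂(surf n), f (rotSph θ u) = f u

/-- A function on the sphere is centered if it is orthogonal to all linear functions. -/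
def Centered {n : ℕ} (f : Sph n → ℝ) : Prop :=
  ∀ x : Euc n, ∫ u, f u * ⟪x, (u : Euc n)⟫ ∂(surf n) = 0

/-! ### Smooth functions, the spherical Laplacian and the box operator -/

/-- The `0`-homogeneous extension `x ↦ φ (x / |x|)` of a function on the sphere. -/
def homExt {n : ℕ} (φ : Sph n → ℝ) (x : Euc n) : ℝ :=
  if hx : x ≠ 0 then
    φ ⟨‖x‖⁻¹ • x, by
      rw [mem_sphere_zero_iff_norm, norm_smul, norm_inv, norm_norm,
        inv_mul_cancel₀ (norm_ne_zero_iff.mpr hx)]⟩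
  else 0

/-- `φ ∈ C^∞(𝕊ⁿ⁻¹)`. -/
def SmoothSph {n : ℕ} (φ : Sph n → ℝ) : Prop :=
  ContDiffOn ℝ ∞ (homExt φ) {0}ᶜ

/-- The spherical Laplacian of a smooth function: the restriction to the sphere of the Euclidean
Laplacian of its `0`-homogeneous extension. -/
def sphLaplacian {n : ℕ} (φ : Sph n → ℝ) (u : Sph n) : ℝ :=
  Laplacian.laplacian (homExt φ) (u : Euc n)

/-- The box operator `□_n = (n-1)⁻¹ Δ_𝕊 + Id` on smooth functions. -/
def boxOp {n : ℕ} (φ : Sph n → ℝ) (u : Sph n) : ℝ :=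
  1 / ((n : ℝ) - 1) * sphLaplacian φ u + φ u

/-! ### Pairings of test functions with signed measures and distributions -/

/-- The distribution `φ ↦ ∫ φ dμ` given by a signed measure `μ`. -/
def measurePairing {n : ℕ} (μ : SignedMeasure (Sph n)) (φ : Sph n → ℝ) : ℝ :=
  ∫ u, φ u ∂μ.toJordanDecomposition.posPart - ∫ u, φ u ∂μ.toJordanDecomposition.negPart

/-- The distribution `□_n f` of an integrable function `f`: `⟨φ, □_n f⟩ = ∫ (□_n φ) f du`. -/
def boxPairing {n : ℕ} (f : Sph n → ℝ) (φ : Sph n → ℝ) : ℝ :=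
  ∫ u, boxOp φ u * f u ∂(surf n)

/-! ### Legendre polynomials and multipliers -/

/-- The Legendre polynomial `P^n_k` of dimension `n` and degree `k`, normalized by `P^n_k(1) = 1`:
`(k + n - 1) P_{k+2} = (2 k + n) t P_{k+1} - (k + 1) P_k`. -/
def legendre (n : ℕ) : ℕ → ℝ → ℝ
  | 0, _ => 1
  | 1, t => t
  | k + 2, t =>
      ((2 * (k : ℝ) + n) * t * legendre n (k + 1) t - ((k : ℝ) + 1) * legendre n k t)
        / ((k : ℝ) + n - 1)

/-- The multiplier `a^n_k[ν] = ⟨P^n_k(⟨e, ·⟩), ν⟩` of a zonal distribution `ν`, given through its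
pairing with test functions. -/
def multiplier {n : ℕ} (e : Sph n) (ν : (Sph n → ℝ) → ℝ) (k : ℕ) : ℝ :=
  ν fun u => legendre n k ⟪(e : Euc n), (u : Euc n)⟫

/-! ### Convex bodies -/

/-- The support function `h(K, x) = max {⟨x, y⟩ : y ∈ K}`. -/
def supp {n : ℕ} (K : ConvexBody (Euc n)) (x : Euc n) : ℝ :=
  sSup ((fun y : Euc n => ⟪x, y⟫) '' (K : Set (Euc n)))

/-- The Steiner point, up to normalization: `s(K) = ∫ h(K, u) u du`. -/
def steinerPoint {n : ℕ} (K : ConvexBody (Euc n)) : Euc n :=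
  ∫ u : Sph n, supp K (u : Euc n) • (u : Euc n) ∂(surf n)

/-- The convex body `{x}`. -/
def pointBody {n : ℕ} (x : Euc n) : ConvexBody (Euc n) :=
  ⟨{x}, convex_singleton x, isCompact_singleton, Set.singleton_nonempty x⟩

/-- The image `ϑ K` of a convex body under a linear isometry. -/
def rotBody {n : ℕ} (θ : Euc n ≃ₗᵢ[ℝ] Euc n) (K : ConvexBody (Euc n)) : ConvexBody (Euc n) :=
  ⟨θ '' K, K.convex.linear_image (θ.toLinearEquiv : Euc n →ₗ[ℝ] Euc n),
    K.isCompact.image θ.continuous, K.nonempty.image θ⟩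

/-- The local parallel set: all points `x` at distance `s ∈ (0, t]` from `K` for which the unit
vector pointing to `x` from its nearest point `p` in `K` belongs to `A`. -/
def localParallelSet {n : ℕ} (K : ConvexBody (Euc n)) (t : ℝ) (A : Set (Sph n)) : Set (Euc n) :=
  {x | ∃ p ∈ K, ∃ u ∈ A, ∃ s : ℝ, 0 < s ∧ s ≤ t ∧ x = p + s • (u : Euc n) ∧
    Metric.infDist x (K : Set (Euc n)) = s}

/-- The finite measures `S_0, …, S_{n-1}` are the area measures of `K`, that is, the coefficients
in the local Steiner formula. -/
structure IsAreaMeasures {n : ℕ} (K : ConvexBody (Euc n)) (S : ℕ → Measure (Sph n)) : Prop where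
  finite : ∀ j, IsFiniteMeasure (S j)
  steiner : ∀ t : ℝ, 0 < t → ∀ A : Set (Sph n), MeasurableSet A →
    (n : ENNReal) * volume (localParallelSet K t A)
      = ∑ j ∈ Finset.range n, (n.choose j : ENNReal) * ENNReal.ofReal (t ^ (n - j)) * S j A

open Classical in
/-- The `i`-th area measure `S_i(K, ·)`, `0 ≤ i ≤ n - 1`. -/
def areaMeasure {n : ℕ} (K : ConvexBody (Euc n)) (i : ℕ) : Measure (Sph n) :=
  if h : ∃ S : ℕ → Measure (Sph n), IsAreaMeasures K S then h.choose i else 0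

/-! ### Convolution -/

open Classical in
/-- The convolution `φ ∗ f` of a smooth function `φ` with a zonal integrable function `f`:
`(φ ∗ f)(ϑ e) = ∫ φ(ϑ v) f(v) dv` for `ϑ ∈ SO(n)`. The right-hand side does not depend on the
choice of `ϑ` as `f` is zonal. -/
def sphConv {n : ℕ} (e : Sph n) (φ f : Sph n → ℝ) (u : Sph n) : ℝ :=
  if h : ∃ θ : Euc n ≃ₗᵢ[ℝ] Euc n, IsRotation θ ∧ rotSph θ e = u then
    ∫ v, φ (rotSph h.choose v) * f v ∂(surf n)
  else 0

/-! ### Minkowski valuations -/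

/-- `Φ` is a continuous, translation invariant Minkowski valuation on `ℝⁿ` that intertwines
rotations and is homogeneous of degree `i`. -/
structure IsMVal {n : ℕ} (i : ℕ) (Φ : ConvexBody (Euc n) → ConvexBody (Euc n)) : Prop where
  continuous : Continuous Φ
  valuation : ∀ K L U I : ConvexBody (Euc n),
    (U : Set (Euc n)) = (K : Set (Euc n)) ∪ L → (I : Set (Euc n)) = (K : Set (Euc n)) ∩ L →
      Φ K + Φ L = Φ U + Φ I
  translation : ∀ (K : ConvexBody (Euc n)) (x : Euc n), Φ (K + pointBody x) = Φ K
  rotation : ∀ (K : ConvexBody (Euc n)) (θ : Euc n ≃ₗᵢ[ℝ] Euc n), IsRotation θ →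
    Φ (rotBody θ K) = rotBody θ (Φ K)
  homogeneous : ∀ (K : ConvexBody (Euc n)) (c : ℝ), 0 ≤ c → Φ (c • K) = c ^ i • Φ K

/-- `Φ K ⊆ Φ L` whenever `K ⊆ L` and the Steiner points of `K` and `L` are at the origin. -/
def WeaklyMonotone {n : ℕ} (Φ : ConvexBody (Euc n) → ConvexBody (Euc n)) : Prop :=
  ∀ K L : ConvexBody (Euc n), (K : Set (Euc n)) ⊆ L → steinerPoint K = 0 → steinerPoint L = 0 →
    (Φ K : Set (Euc n)) ⊆ Φ L

/-- `f ∈ L¹(𝕊ⁿ⁻¹)` is the generating function of `Φ`: it is centered and zonal, and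
`h(Φ K, ·) = S_i(K, ·) ∗ f` for every convex body `K`, as an identity of distributions, where
`⟨φ, S_i(K, ·) ∗ f⟩ = ∫ (φ ∗ f) dS_i(K, ·)`. -/
structure IsGeneratingFunction {n : ℕ} (e : Sph n) (i : ℕ)
    (Φ : ConvexBody (Euc n) → ConvexBody (Euc n)) (f : Sph n → ℝ) : Prop where
  integrable : Integrable f (surf n)
  zonal : ZonalFun e f
  centered : Centered f
  representation : ∀ (K : ConvexBody (Euc n)) (φ : Sph n → ℝ), SmoothSph φ →
    ∫ u, φ u * supp (Φ K) (u : Euc n) ∂(surf n) = ∫ u, sphConv e φ f u ∂(areaMeasure K i)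

end ZonalMultipliers

end

/-!
With `λ = (n - 2) / 2`, the function `u(θ) = (sin θ)^λ P^n_k(cos θ)` solves `u'' + q u = 0` for
`q = (k + λ)² + λ (1 - λ) / sin² θ`. Since `q` is monotone on each side of the equator, so is
`u'² + q u²` or its quotient by `q`, whence `|P^n_k(cos θ)| ≤ A min (1, (k sin θ)^(-λ))`. Cutting
the sphere into the dyadic shells `2^(j-1) ≤ k sin θ < 2^j` turns a mass bound `r^α` on polar caps
into the bound `∑ 2^(-λ j) (2^j / k)^α` on the `k`-th multiplier: a geometric sum of about `log k`
terms, with ratio `2^(α - λ)`.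

For the second part, the area measures of a body of revolution have densities which are elementary
symmetric functions of its radii of curvature. For nested bodies of revolution with Steiner point at
the origin, weak monotonicity compares the integrals of `f` against these densities. Perturbing the
unit ball shows that `□_n f` pairs nonnegatively with the nonnegative zonal functions orthogonal to
the linear ones. Perturbing instead a bounded body whose radii of curvature near the poles are of
order `1 / r`, by a function supported there, the first variation of `S_i` carries the factor
`r^(-(i-1))`, so that `□_n f` gives mass `O(r)` to the cap of radius `r`, as `i > 1`. The argument
of the first part, with `α = 1` and `λ` replaced by `1 / 2 ≤ λ`, then yields `O(k^(-1/2))`.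
-/

namespace ZonalMultipliers

variable {n : ℕ}

/-! ### Legendre polynomials -/

lemma natCast_add_sub_one_pos (hn : 2 ≤ n) (k : ℕ) : 0 < (k : ℝ) + n - 1 := by
  have : (2 : ℝ) ≤ n := by exact_mod_cast hn
  linarith [k.cast_nonneg (α := ℝ)]

lemma legendre_zero : legendre n 0 = fun _ => 1 := by
  funext _
  simp only [legendre]

lemma legendre_one : legendre n 1 = fun t => t := by
  funext t
  simp only [legendre]

lemma legendre_add_two (hn : 2 ≤ n) (k : ℕ) (t : ℝ) :
    ((k : ℝ) + n - 1) * legendre n (k + 2) t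
      = (2 * (k : ℝ) + n) * t * legendre n (k + 1) t - ((k : ℝ) + 1) * legendre n k t := by
  have := (natCast_add_sub_one_pos hn k).ne'
  rw [legendre]
  field_simp

lemma contDiff_legendre (n k : ℕ) : ContDiff ℝ ∞ (legendre n k) := by
  induction k using Nat.twoStepInduction with
  | zero => simpa only [legendre_zero] using contDiff_const
  | one => rw [legendre_one]; exact contDiff_id
  | more k ih₀ ih₁ =>
    rw [show legendre n (k + 2) = _ from funext fun t => by rw [legendre]]
    fun_prop

lemma continuous_legendre (n k : ℕ) : Continuous (legendre n k) :=
  (contDiff_legendre n k).continuous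

lemma hasDerivAt_legendre (n k : ℕ) (t : ℝ) :
    HasDerivAt (legendre n k) (deriv (legendre n k) t) t :=
  ((contDiff_legendre n k).differentiable (by simp) t).hasDerivAt

lemma hasDerivAt_deriv_legendre (n k : ℕ) (t : ℝ) :
    HasDerivAt (deriv (legendre n k)) (deriv (deriv (legendre n k)) t) t :=
  ((contDiff_infty_iff_deriv.1 (contDiff_legendre n k)).2.differentiable (by simp) t).hasDerivAt

lemma legendre_apply_one (hn : 2 ≤ n) (k : ℕ) : legendre n k 1 = 1 := by
  induction k using Nat.twoStepInduction with
  | zero => rw [legendre_zero]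
  | one => rw [legendre_one]
  | more k ih₀ ih₁ =>
    have hrec := legendre_add_two hn k 1
    rw [ih₀, ih₁] at hrec
    exact mul_left_cancel₀ (natCast_add_sub_one_pos hn k).ne' (by linarith)

lemma legendre_neg (n k : ℕ) (t : ℝ) : legendre n k (-t) = (-1) ^ k * legendre n k t := by
  induction k using Nat.twoStepInduction with
  | zero => simp [legendre]
  | one => simp [legendre]
  | more k ih₀ ih₁ =>
    rw [legendre, legendre, ih₀, ih₁]
    ring

lemma sq_legendre_abs (n k : ℕ) (t : ℝ) : legendre n k |t| ^ 2 = legendre n k t ^ 2 := by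
  rcases abs_choice t with h | h <;> rw [h]
  rw [legendre_neg, mul_pow, ← pow_mul, mul_comm k 2, pow_mul, neg_one_sq, one_pow, one_mul]

lemma deriv_legendre_add_two (hn : 2 ≤ n) (k : ℕ) (t : ℝ) :
    ((k : ℝ) + n - 1) * deriv (legendre n (k + 2)) t
      = (2 * (k : ℝ) + n) * (legendre n (k + 1) t + t * deriv (legendre n (k + 1)) t)
        - ((k : ℝ) + 1) * deriv (legendre n k) t := by
  have hlhs := (hasDerivAt_legendre n (k + 2) t).const_mul ((k : ℝ) + n - 1)
  have hrhs := (((hasDerivAt_id t).const_mul (2 * (k : ℝ) + n)).mul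
    (hasDerivAt_legendre n (k + 1) t)).sub ((hasDerivAt_legendre n k t).const_mul ((k : ℝ) + 1))
  rw [hlhs.unique (hrhs.congr_of_eventuallyEq (Eventually.of_forall (legendre_add_two hn k)))]
  simp only [id, mul_one]
  ring

lemma deriv_legendre_relations (hn : 2 ≤ n) (k : ℕ) (t : ℝ) :
    (1 - t ^ 2) * deriv (legendre n (k + 1)) t
        = ((k : ℝ) + 1) * (legendre n k t - t * legendre n (k + 1) t) ∧
      (1 - t ^ 2) * deriv (legendre n k) t
        = ((k : ℝ) + n - 2) * (t * legendre n k t - legendre n (k + 1) t) := by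
  induction k with
  | zero =>
    simp only [legendre_zero, zero_add, legendre_one, deriv_const', deriv_id'', Nat.cast_zero]
    constructor <;> ring
  | succ k ih =>
    obtain ⟨ih₁, ih₂⟩ := ih
    have hrec := legendre_add_two hn k t
    constructor
    · apply mul_left_cancel₀ (natCast_add_sub_one_pos hn k).ne'
      push_cast
      linear_combination (1 - t ^ 2) * deriv_legendre_add_two hn k t
        + (2 * (k : ℝ) + n) * t * ih₁ - ((k : ℝ) + 1) * ih₂ + ((k : ℝ) + 2) * t * hrec
    · push_cast
      rw [ih₁]
      linear_combination hrec

lemma hasDerivAt_one_sub_sq (t : ℝ) : HasDerivAt (fun t : ℝ => 1 - t ^ 2) (-(2 * t)) t := by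
  simpa using (hasDerivAt_pow 2 t).const_sub 1

lemma legendre_ode (hn : 2 ≤ n) (k : ℕ) {t : ℝ} (ht : 1 - t ^ 2 ≠ 0) :
    (1 - t ^ 2) * deriv (deriv (legendre n k)) t
      = ((n : ℝ) - 1) * t * deriv (legendre n k) t - k * ((k : ℝ) + n - 2) * legendre n k t := by
  have hlhs := (hasDerivAt_one_sub_sq t).mul (hasDerivAt_deriv_legendre n k t)
  have hrhs := (((hasDerivAt_id t).mul (hasDerivAt_legendre n k t)).sub
    (hasDerivAt_legendre n (k + 1) t)).const_mul ((k : ℝ) + n - 2)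
  have hderiv := hlhs.unique (hrhs.congr_of_eventuallyEq
    (Eventually.of_forall fun s => (deriv_legendre_relations hn k s).2))
  simp only [id] at hderiv
  obtain ⟨hup, hdown⟩ := deriv_legendre_relations hn k t
  apply mul_left_cancel₀ ht
  linear_combination (1 - t ^ 2) * hderiv - ((k : ℝ) + n - 2) * hup + ((k : ℝ) + 1) * t * hdown

lemma monotoneOn_legendre_sq_add_deriv_sq (hn : 2 ≤ n) (k : ℕ) :
    MonotoneOn (fun s => k * ((k : ℝ) + n - 2) * legendre n k s ^ 2
      + (1 - s ^ 2) * deriv (legendre n k) s ^ 2) (Set.Icc 0 1) := by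
  have hn' : (2 : ℝ) ≤ n := by exact_mod_cast hn
  have hderiv := fun s => (((hasDerivAt_legendre n k s).pow 2).const_mul
    (k * ((k : ℝ) + n - 2))).add ((hasDerivAt_one_sub_sq s).mul
      ((hasDerivAt_deriv_legendre n k s).pow 2))
  refine monotoneOn_of_hasDerivWithinAt_nonneg (convex_Icc 0 1)
    (fun s _ => (hderiv s).continuousAt.continuousWithinAt)
    (fun s _ => (hderiv s).hasDerivWithinAt) fun s hs => ?_
  rw [interior_Icc] at hs
  have hs' : 1 - s ^ 2 ≠ 0 := by nlinarith [hs.1, hs.2]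
  have hvalue : 0 ≤ 2 * ((n : ℝ) - 2) * s * deriv (legendre n k) s ^ 2 :=
    mul_nonneg (mul_nonneg (by linarith) hs.1.le) (sq_nonneg _)
  refine hvalue.trans_eq ?_
  simp only [Pi.pow_apply]
  push_cast
  linear_combination -2 * deriv (legendre n k) s * legendre_ode hn k hs'

lemma abs_legendre_le_one (hn : 2 ≤ n) (k : ℕ) {t : ℝ} (ht : |t| ≤ 1) :
    |legendre n k t| ≤ 1 := by
  rcases Nat.eq_zero_or_pos k with rfl | hk
  · simp [legendre]
  have hn' : (2 : ℝ) ≤ n := by exact_mod_cast hn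
  have hk' : (1 : ℝ) ≤ k := by exact_mod_cast hk
  have heig : 0 < k * ((k : ℝ) + n - 2) := mul_pos (by linarith) (by linarith)
  have hmono := monotoneOn_legendre_sq_add_deriv_sq hn k ⟨abs_nonneg t, ht⟩
    ⟨zero_le_one, le_rfl⟩ ht
  simp only [legendre_apply_one hn, sq_legendre_abs, sq_abs, one_pow, mul_one, sub_self,
    zero_mul, add_zero] at hmono
  have hrest : 0 ≤ (1 - t ^ 2) * deriv (legendre n k) |t| ^ 2 :=
    mul_nonneg (sub_nonneg.2 ((sq_le_one_iff_abs_le_one t).2 ht)) (sq_nonneg _)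
  rw [← sq_le_one_iff_abs_le_one]
  exact le_of_mul_le_mul_left (by linarith) heig

/-! ### Decay of the Legendre polynomials -/

/-- The index `λ = (n - 2) / 2` for which `P^n_k` is a multiple of the Gegenbauer polynomial
`C^λ_k`; it is the exponent of decay of the Legendre polynomials away from the poles. -/
noncomputable def gegenbauerIndex (n : ℕ) : ℝ := ((n : ℝ) - 2) / 2

lemma natCast_eq_gegenbauerIndex (n : ℕ) : (n : ℝ) = 2 * gegenbauerIndex n + 2 := by
  rw [gegenbauerIndex]
  ring

lemma gegenbauerIndex_nonneg (hn : 2 ≤ n) : 0 ≤ gegenbauerIndex n := by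
  have : (2 : ℝ) ≤ n := by exact_mod_cast hn
  linarith [natCast_eq_gegenbauerIndex n]

lemma half_le_gegenbauerIndex (hn : 3 ≤ n) : 1 / 2 ≤ gegenbauerIndex n := by
  have : (3 : ℝ) ≤ n := by exact_mod_cast hn
  linarith [natCast_eq_gegenbauerIndex n]

lemma one_sub_two_mul_div_le_rpow {x lam : ℝ} (hx : 0 < x) (hlam : 0 ≤ lam) :
    1 - 2 * lam / x ≤ (x / (x + 2)) ^ lam := by
  have hexp : Real.exp (-(2 / x)) ≤ x / (x + 2) := by
    rw [Real.exp_neg, show x / (x + 2) = (2 / x + 1)⁻¹ by field_simp; ring]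
    exact inv_anti₀ (by positivity) (Real.add_one_le_exp _)
  calc 1 - 2 * lam / x = -(2 / x) * lam + 1 := by ring
    _ ≤ Real.exp (-(2 / x) * lam) := Real.add_one_le_exp _
    _ = Real.exp (-(2 / x)) ^ lam := Real.exp_mul _ _
    _ ≤ (x / (x + 2)) ^ lam := Real.rpow_le_rpow (Real.exp_nonneg _) hexp hlam

lemma abs_legendre_apply_zero_le (hn : 2 ≤ n) (k : ℕ) :
    |legendre n k 0| ≤ (((n : ℝ) - 1) / (k + ((n : ℝ) - 1))) ^ gegenbauerIndex n := by
  have hlam := gegenbauerIndex_nonneg hn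
  have hn' : 0 < (n : ℝ) - 1 := by linarith [natCast_eq_gegenbauerIndex n]
  induction k using Nat.twoStepInduction with
  | zero => simp [legendre, hn'.ne']
  | one =>
    simp only [legendre, abs_zero]
    positivity
  | more k ih _ =>
    set lam := gegenbauerIndex n
    set s := (n : ℝ) - 1 with hs
    have hsl : s = 2 * lam + 1 := by linarith [natCast_eq_gegenbauerIndex n]
    have hrec : legendre n (k + 2) 0 = -(((k : ℝ) + 1) / (k + s)) * legendre n k 0 := by
      have := legendre_add_two hn k 0
      rw [show (k : ℝ) + n - 1 = k + s by rw [hs]; ring] at this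
      field_simp
      linarith
    have hfactor : ((k : ℝ) + 1) / (k + s) ≤ ((k + s) / (k + s + 2)) ^ lam := by
      refine (one_sub_two_mul_div_le_rpow (by positivity) hlam).trans_eq' ?_
      field_simp
      linarith
    rw [hrec, abs_mul, abs_neg, abs_of_nonneg (by positivity)]
    calc ((k : ℝ) + 1) / (k + s) * |legendre n k 0|
        ≤ ((k + s) / (k + s + 2)) ^ lam * (s / (k + s)) ^ lam := by gcongr
      _ = (s / ((k + 2 : ℕ) + s)) ^ lam := by
          rw [← Real.mul_rpow (by positivity) (by positivity)]
          congr 1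
          push_cast
          field_simp
          ring

/-- The potential `q = (k + λ)² + λ (1 - λ) / sin² θ`, as a function of `t = cos θ`, for which
`u = (sin θ)^λ P^n_k(cos θ)` solves `u'' + q u = 0` (Liouville normal form of the Legendre
equation). -/
noncomputable def liouvillePotential (n k : ℕ) (t : ℝ) : ℝ :=
  (k + gegenbauerIndex n) ^ 2 + gegenbauerIndex n * (1 - gegenbauerIndex n) * (1 - t ^ 2)⁻¹

/-- The energy `u'² + q u²` of the solution `u = (sin θ)^λ P^n_k(cos θ)` of the Liouville normal
form `u'' + q u = 0` of the Legendre equation, as a function of `t = cos θ`. -/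
noncomputable def liouvilleEnergy (n k : ℕ) (t : ℝ) : ℝ :=
  (1 - t ^ 2) ^ (gegenbauerIndex n - 1) *
      ((1 - t ^ 2) * deriv (legendre n k) t - gegenbauerIndex n * t * legendre n k t) ^ 2
    + liouvillePotential n k t * ((1 - t ^ 2) ^ gegenbauerIndex n * legendre n k t ^ 2)

lemma one_sub_sq_pos_of_mem_Ico {t : ℝ} (ht : t ∈ Set.Ico 0 1) : 0 < 1 - t ^ 2 := by
  nlinarith [ht.1, ht.2]

lemma hasDerivAt_liouvillePotential (n k : ℕ) {t : ℝ} (ht : 1 - t ^ 2 ≠ 0) :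
    HasDerivAt (liouvillePotential n k)
      (2 * gegenbauerIndex n * (1 - gegenbauerIndex n) * t / (1 - t ^ 2) ^ 2) t := by
  refine ((((hasDerivAt_one_sub_sq t).inv ht).const_mul
    (gegenbauerIndex n * (1 - gegenbauerIndex n))).const_add
      ((k + gegenbauerIndex n) ^ 2)).congr_deriv ?_
  ring

lemma hasDerivAt_liouvilleEnergy (hn : 2 ≤ n) (k : ℕ) {t : ℝ} (ht : 0 < 1 - t ^ 2) :
    HasDerivAt (liouvilleEnergy n k)
      (2 * gegenbauerIndex n * (1 - gegenbauerIndex n) * t / (1 - t ^ 2) ^ 2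
        * ((1 - t ^ 2) ^ gegenbauerIndex n * legendre n k t ^ 2)) t := by
  have hw := hasDerivAt_one_sub_sq t
  have hP := hasDerivAt_legendre n k t
  have hu' := (hw.mul (hasDerivAt_deriv_legendre n k t)).sub
    (((hasDerivAt_id t).const_mul (gegenbauerIndex n)).mul hP)
  have hE := ((hw.rpow_const (p := gegenbauerIndex n - 1) (Or.inl ht.ne')).mul (hu'.pow 2)).add
    ((hasDerivAt_liouvillePotential n k ht.ne').mul
      ((hw.rpow_const (p := gegenbauerIndex n) (Or.inl ht.ne')).mul (hP.pow 2)))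
  have hode := legendre_ode hn k ht.ne'
  refine hE.congr_deriv ?_
  have hpow : (1 - t ^ 2) ^ gegenbauerIndex n
      = (1 - t ^ 2) ^ (gegenbauerIndex n - 1) * (1 - t ^ 2) := by
    rw [← Real.rpow_add_one ht.ne', sub_add_cancel]
  have hpow' : (1 - t ^ 2) ^ (gegenbauerIndex n - 1 - 1)
      = (1 - t ^ 2) ^ (gegenbauerIndex n - 1) / (1 - t ^ 2) := by
    rw [Real.rpow_sub_one ht.ne']
  rw [natCast_eq_gegenbauerIndex n] at hode
  simp only [Pi.mul_apply, Pi.sub_apply, Pi.pow_apply, id, hpow, hpow', liouvillePotential]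
  set lam := gegenbauerIndex n
  field_simp
  push_cast
  linear_combination
    2 * (1 - t ^ 2) * ((1 - t ^ 2) * deriv (legendre n k) t - lam * t * legendre n k t) * hode

lemma liouvilleEnergy_zero (n k : ℕ) :
    liouvilleEnergy n k 0 = deriv (legendre n k) 0 ^ 2
      + (k * (k + 2 * gegenbauerIndex n) + gegenbauerIndex n) * legendre n k 0 ^ 2 := by
  rw [liouvilleEnergy, liouvillePotential]
  have hone : 1 - (0 : ℝ) ^ 2 = 1 := by norm_num
  rw [hone, Real.one_rpow, Real.one_rpow, inv_one]
  ring

lemma abs_deriv_legendre_apply_zero_le (hn : 2 ≤ n) {k : ℕ} (hk : 1 ≤ k) :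
    |deriv (legendre n k) 0| ≤ k * (((n : ℝ) - 1) / k) ^ gegenbauerIndex n := by
  have hlam := gegenbauerIndex_nonneg hn
  have hn' : 1 ≤ (n : ℝ) - 1 := by linarith [natCast_eq_gegenbauerIndex n]
  obtain ⟨j, rfl⟩ : ∃ j, k = j + 1 := ⟨k - 1, by omega⟩
  have hderiv : deriv (legendre n (j + 1)) 0 = ((j : ℝ) + 1) * legendre n j 0 := by
    simpa using (deriv_legendre_relations hn j 0).1
  rw [hderiv, abs_mul, abs_of_nonneg (by positivity)]
  push_cast
  have := abs_legendre_apply_zero_le hn j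
  refine mul_le_mul_of_nonneg_left (this.trans ?_) (by positivity)
  gcongr

lemma liouvilleEnergy_zero_le (hn : 2 ≤ n) {k : ℕ} (hk : 1 ≤ k) :
    liouvilleEnergy n k 0 ≤ (2 + 3 * gegenbauerIndex n) * (k : ℝ) ^ 2
      * ((((n : ℝ) - 1) / k) ^ gegenbauerIndex n) ^ 2 := by
  have hk' : (1 : ℝ) ≤ k := by exact_mod_cast hk
  have hlam := gegenbauerIndex_nonneg hn
  have hn' : 1 ≤ (n : ℝ) - 1 := by linarith [natCast_eq_gegenbauerIndex n]
  have hD := abs_deriv_legendre_apply_zero_le hn hk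
  have hP : |legendre n k 0| ≤ (((n : ℝ) - 1) / k) ^ gegenbauerIndex n := by
    refine (abs_legendre_apply_zero_le hn k).trans ?_
    gcongr
    linarith
  rw [liouvilleEnergy_zero]
  set X := (((n : ℝ) - 1) / k) ^ gegenbauerIndex n
  have hcoeff : k * (k + 2 * gegenbauerIndex n) + gegenbauerIndex n
      ≤ (1 + 3 * gegenbauerIndex n) * (k : ℝ) ^ 2 := by
    have h₁ : gegenbauerIndex n * 1 ≤ gegenbauerIndex n * (k : ℝ) ^ 2 := by
      gcongr; exact one_le_pow₀ hk'
    have h₂ : gegenbauerIndex n * (k : ℝ) ≤ gegenbauerIndex n * (k : ℝ) ^ 2 := by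
      gcongr; exact le_self_pow₀ hk' two_ne_zero
    linarith
  calc deriv (legendre n k) 0 ^ 2
        + (k * (k + 2 * gegenbauerIndex n) + gegenbauerIndex n) * legendre n k 0 ^ 2
      ≤ (k * X) ^ 2 + (1 + 3 * gegenbauerIndex n) * (k : ℝ) ^ 2 * X ^ 2 := by
        rw [← sq_abs (deriv _ _), ← sq_abs (legendre n k 0)]
        gcongr
    _ = _ := by ring

lemma liouvillePotential_mul_le_liouvilleEnergy (n k : ℕ) {t : ℝ} (ht : t ∈ Set.Ico 0 1) :
    liouvillePotential n k t * ((1 - t ^ 2) ^ gegenbauerIndex n * legendre n k t ^ 2)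
      ≤ liouvilleEnergy n k t :=
  le_add_of_nonneg_left (mul_nonneg
    (Real.rpow_nonneg (one_sub_sq_pos_of_mem_Ico ht).le _) (sq_nonneg _))

-- Here `q' ≤ 0` on `[0, 1)`, and `E' = q' u²`.
lemma antitoneOn_liouvilleEnergy (hn : 2 ≤ n) (hlam : 1 ≤ gegenbauerIndex n) (k : ℕ) :
    AntitoneOn (liouvilleEnergy n k) (Set.Ico 0 1) := by
  have hderiv := fun t ht => hasDerivAt_liouvilleEnergy hn k
    (one_sub_sq_pos_of_mem_Ico (t := t) ht)
  refine antitoneOn_of_hasDerivWithinAt_nonpos (convex_Ico 0 1)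
    (fun t ht => (hderiv t ht).continuousAt.continuousWithinAt)
    (fun t ht => (hderiv t (interior_subset ht)).hasDerivWithinAt) fun t ht => ?_
  have hw := one_sub_sq_pos_of_mem_Ico (interior_subset ht)
  refine mul_nonpos_of_nonpos_of_nonneg (div_nonpos_of_nonpos_of_nonneg ?_ (by positivity))
    (by positivity)
  exact mul_nonpos_of_nonpos_of_nonneg
    (mul_nonpos_of_nonneg_of_nonpos (by linarith) (by linarith)) (interior_subset ht).1

lemma sq_add_le_liouvillePotential (hn : 2 ≤ n) (hlam : gegenbauerIndex n ≤ 1) (k : ℕ) {t : ℝ}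
    (ht : t ∈ Set.Ico 0 1) : (k + gegenbauerIndex n) ^ 2 ≤ liouvillePotential n k t :=
  le_add_of_nonneg_right (mul_nonneg
    (mul_nonneg (gegenbauerIndex_nonneg hn) (sub_nonneg.2 hlam))
    (inv_nonneg.2 (one_sub_sq_pos_of_mem_Ico ht).le))

-- Here `q' ≥ 0` on `[0, 1)`, and `(E / q)' = - q' u'² / q²`.
lemma antitoneOn_liouvilleEnergy_div (hn : 3 ≤ n) (hlam : gegenbauerIndex n ≤ 1) (k : ℕ) :
    AntitoneOn (fun t => liouvilleEnergy n k t / liouvillePotential n k t) (Set.Ico 0 1) := by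
  have hn2 : 2 ≤ n := by omega
  have hlam0 := half_le_gegenbauerIndex hn
  have hq : ∀ t ∈ Set.Ico (0 : ℝ) 1, 0 < liouvillePotential n k t := fun t ht =>
    (sq_add_le_liouvillePotential hn2 hlam k ht).trans_lt' (by positivity)
  have hderiv := fun t ht => (hasDerivAt_liouvilleEnergy hn2 k
    (one_sub_sq_pos_of_mem_Ico (t := t) ht)).div
      (hasDerivAt_liouvillePotential n k (one_sub_sq_pos_of_mem_Ico ht).ne') (hq t ht).ne'
  refine antitoneOn_of_hasDerivWithinAt_nonpos (convex_Ico 0 1)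
    (fun t ht => (hderiv t ht).continuousAt.continuousWithinAt)
    (fun t ht => (hderiv t (interior_subset ht)).hasDerivWithinAt) fun t ht => ?_
  have hw := one_sub_sq_pos_of_mem_Ico (interior_subset ht)
  have hq' : 0 ≤ 2 * gegenbauerIndex n * (1 - gegenbauerIndex n) * t / (1 - t ^ 2) ^ 2 :=
    div_nonneg (mul_nonneg (mul_nonneg (by linarith) (sub_nonneg.2 hlam))
      (interior_subset ht).1) (by positivity)
  refine div_nonpos_of_nonpos_of_nonneg ?_ (sq_nonneg _)
  rw [liouvilleEnergy]
  set q' := 2 * gegenbauerIndex n * (1 - gegenbauerIndex n) * t / (1 - t ^ 2) ^ 2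
  have hv : 0 ≤ q' * ((1 - t ^ 2) ^ (gegenbauerIndex n - 1) *
      ((1 - t ^ 2) * deriv (legendre n k) t - gegenbauerIndex n * t * legendre n k t) ^ 2) := by
    positivity
  linarith

lemma rpow_mul_sq_legendre_mul_le_of_le_one (hn : 3 ≤ n) (hlam : gegenbauerIndex n ≤ 1) (k : ℕ)
    {t : ℝ} (ht : t ∈ Set.Ico 0 1) :
    (1 - t ^ 2) ^ gegenbauerIndex n * legendre n k t ^ 2 * (k : ℝ) ^ 2
      ≤ liouvilleEnergy n k 0 := by
  have hn2 : 2 ≤ n := by omega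
  have hlam0 := half_le_gegenbauerIndex hn
  have hq : ∀ {s : ℝ}, s ∈ Set.Ico 0 1 → 0 < liouvillePotential n k s := fun hs =>
    (sq_add_le_liouvillePotential hn2 hlam k hs).trans_lt' (by positivity)
  have h0 : (0 : ℝ) ∈ Set.Ico 0 1 := ⟨le_rfl, one_pos⟩
  have hu : (1 - t ^ 2) ^ gegenbauerIndex n * legendre n k t ^ 2
      ≤ liouvilleEnergy n k 0 / liouvillePotential n k 0 := by
    refine le_trans ?_ (antitoneOn_liouvilleEnergy_div hn hlam k h0 ht ht.1)
    rw [le_div_iff₀' (hq ht)]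
    exact liouvillePotential_mul_le_liouvilleEnergy n k ht
  rw [le_div_iff₀ (hq h0)] at hu
  refine le_trans ?_ hu
  have hw := one_sub_sq_pos_of_mem_Ico ht
  gcongr
  refine le_trans ?_ (sq_add_le_liouvillePotential hn2 hlam k h0)
  gcongr
  linarith

lemma rpow_mul_sq_legendre_mul_le_of_one_le (hn : 2 ≤ n) (hlam : 1 ≤ gegenbauerIndex n) (k : ℕ)
    {t : ℝ} (ht : t ∈ Set.Ico 0 1)
    (hk : 2 * gegenbauerIndex n ^ 2 ≤ (k : ℝ) ^ 2 * (1 - t ^ 2)) :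
    (1 - t ^ 2) ^ gegenbauerIndex n * legendre n k t ^ 2 * (k : ℝ) ^ 2
      ≤ 2 * liouvilleEnergy n k 0 := by
  have hw := one_sub_sq_pos_of_mem_Ico ht
  have hq : (k : ℝ) ^ 2 ≤ 2 * liouvillePotential n k t := by
    have hmul : (k : ℝ) ^ 2 * (1 - t ^ 2) ≤ 2 * liouvillePotential n k t * (1 - t ^ 2) := by
      have hk2 : (k : ℝ) ^ 2 * (1 - t ^ 2) ≤ (k + gegenbauerIndex n) ^ 2 * (1 - t ^ 2) := by
        gcongr; linarith
      rw [liouvillePotential, mul_assoc, add_mul, mul_assoc _ (_⁻¹), inv_mul_cancel₀ hw.ne']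
      linarith
    exact le_of_mul_le_mul_right hmul hw
  set u2 := (1 - t ^ 2) ^ gegenbauerIndex n * legendre n k t ^ 2
  have : 0 ≤ u2 := by positivity
  calc u2 * (k : ℝ) ^ 2 ≤ u2 * (2 * liouvillePotential n k t) := by gcongr
    _ = 2 * (liouvillePotential n k t * u2) := by ring
    _ ≤ 2 * liouvilleEnergy n k t := by
        gcongr; exact liouvillePotential_mul_le_liouvilleEnergy n k ht
    _ ≤ 2 * liouvilleEnergy n k 0 := by
        gcongr; exact antitoneOn_liouvilleEnergy hn hlam k ⟨le_rfl, one_pos⟩ ht ht.1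

lemma rpow_mul_sq_legendre_le_of_le (hn : 3 ≤ n) {k : ℕ} (hk : 1 ≤ k) {t : ℝ}
    (ht : t ∈ Set.Ico 0 1) (hkt : 2 * gegenbauerIndex n ^ 2 ≤ (k : ℝ) ^ 2 * (1 - t ^ 2)) :
    ((k : ℝ) ^ 2 * (1 - t ^ 2)) ^ gegenbauerIndex n * legendre n k t ^ 2
      ≤ 2 * (2 + 3 * gegenbauerIndex n) * (((n : ℝ) - 1) ^ gegenbauerIndex n) ^ 2 := by
  have hw := one_sub_sq_pos_of_mem_Ico ht
  have hn' : 0 < (n : ℝ) - 1 := by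
    linarith [natCast_eq_gegenbauerIndex n, half_le_gegenbauerIndex hn]
  have hkpos : (0 : ℝ) < k := by exact_mod_cast hk
  have hE0 : liouvilleEnergy n k 0 ≤ _ := liouvilleEnergy_zero_le (by omega) hk
  have hE0_nonneg : 0 ≤ liouvilleEnergy n k 0 := by
    rw [liouvilleEnergy_zero]
    have := gegenbauerIndex_nonneg (n := n) (by omega)
    positivity
  have hbound : (1 - t ^ 2) ^ gegenbauerIndex n * legendre n k t ^ 2 * (k : ℝ) ^ 2
      ≤ 2 * liouvilleEnergy n k 0 := by
    rcases le_total (gegenbauerIndex n) 1 with hlam | hlam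
    · linarith [rpow_mul_sq_legendre_mul_le_of_le_one hn hlam k ht]
    · exact rpow_mul_sq_legendre_mul_le_of_one_le (by omega) hlam k ht hkt
  rw [Real.div_rpow hn'.le hkpos.le] at hE0
  rw [Real.mul_rpow (by positivity) hw.le, ← Real.rpow_pow_comm hkpos.le]
  set X := (k : ℝ) ^ gegenbauerIndex n
  have hX : 0 < X := Real.rpow_pos_of_pos hkpos _
  refine le_of_mul_le_mul_right ?_ (sq_pos_of_pos hkpos)
  calc X ^ 2 * (1 - t ^ 2) ^ gegenbauerIndex n * legendre n k t ^ 2 * (k : ℝ) ^ 2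
      = X ^ 2 * ((1 - t ^ 2) ^ gegenbauerIndex n * legendre n k t ^ 2 * (k : ℝ) ^ 2) := by ring
    _ ≤ X ^ 2 * (2 * ((2 + 3 * gegenbauerIndex n) * (k : ℝ) ^ 2
          * (((n : ℝ) - 1) ^ gegenbauerIndex n / X) ^ 2)) := by
        exact mul_le_mul_of_nonneg_left
          (hbound.trans (mul_le_mul_of_nonneg_left hE0 two_pos.le)) (sq_nonneg _)
    _ = _ := by field_simp

theorem exists_rpow_mul_sq_legendre_le (hn : 3 ≤ n) :
    ∃ C : ℝ, 0 < C ∧ ∀ (k : ℕ) (t : ℝ), 1 ≤ k → |t| ≤ 1 →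
      ((k : ℝ) ^ 2 * (1 - t ^ 2)) ^ gegenbauerIndex n * legendre n k t ^ 2 ≤ C := by
  have hlam := half_le_gegenbauerIndex hn
  have hn' : 0 < (n : ℝ) - 1 := by linarith [natCast_eq_gegenbauerIndex n]
  set A := 2 * (2 + 3 * gegenbauerIndex n) * (((n : ℝ) - 1) ^ gegenbauerIndex n) ^ 2
  set B := (2 * gegenbauerIndex n ^ 2) ^ gegenbauerIndex n
  have hA : 0 < A := by positivity
  have hB : 0 < B := by positivity
  refine ⟨A + B, by positivity, fun k t hk ht => ?_⟩
  have hw : 0 ≤ 1 - t ^ 2 := sub_nonneg.2 ((sq_le_one_iff_abs_le_one t).2 ht)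
  rcases le_or_gt (2 * gegenbauerIndex n ^ 2) ((k : ℝ) ^ 2 * (1 - t ^ 2)) with hfar | hnear
  · have ht1 : |t| ≠ 1 := fun h => by
      have hsq : 0 < gegenbauerIndex n ^ 2 := by positivity
      rw [← sq_abs t, h] at hfar
      linarith
    rw [← sq_legendre_abs, ← sq_abs t]
    rw [← sq_abs t] at hfar
    linarith [rpow_mul_sq_legendre_le_of_le hn hk ⟨abs_nonneg t, lt_of_le_of_ne ht ht1⟩ hfar]
  · have hle : legendre n k t ^ 2 ≤ 1 :=
      (sq_le_one_iff_abs_le_one _).2 (abs_legendre_le_one (by omega) k ht)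
    calc ((k : ℝ) ^ 2 * (1 - t ^ 2)) ^ gegenbauerIndex n * legendre n k t ^ 2 ≤ B * 1 :=
          mul_le_mul (Real.rpow_le_rpow (by positivity) hnear.le (by linarith)) hle (sq_nonneg _)
            hB.le
      _ ≤ A + B := by linarith

/-! ### Dyadic sums -/

lemma exists_le_dyadic_of_rpow_mul_sq_le {lam C x y : ℝ} (hlam : 0 ≤ lam) (hy1 : y ≤ 1)
    (h : x ^ lam * y ^ 2 ≤ C) (J : ℕ) :
    ∃ j ≤ J, (j < J → x < 4 ^ j) ∧ y ≤ (1 + √C * 2 ^ lam) * ((2 : ℝ) ^ (-lam)) ^ j := by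
  classical
  have hex : ∃ j, j = J ∨ x < 4 ^ j := ⟨J, Or.inl rfl⟩
  have hspec := Nat.find_spec hex
  refine ⟨Nat.find hex, Nat.find_min' hex (Or.inl rfl), fun hlt => hspec.resolve_left hlt.ne, ?_⟩
  have hC : 0 ≤ √C * (2 : ℝ) ^ lam := by positivity
  rcases hj : Nat.find hex with _ | i
  · rw [pow_zero, mul_one]
    linarith
  have hx : (4 : ℝ) ^ i ≤ x := by
    have hmin := Nat.find_min hex (m := i) (by omega)
    push Not at hmin
    exact hmin.2
  set p := (2 : ℝ) ^ lam with hp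
  have : 0 < p := by positivity
  have h4 : ((4 : ℝ) ^ i) ^ lam = (p ^ i) ^ 2 := by
    rw [← Real.rpow_pow_comm (by norm_num), show (4 : ℝ) = 2 ^ 2 by norm_num,
      ← Real.rpow_pow_comm (by norm_num), pow_right_comm]
  have hpy : p ^ i * y ≤ √C := by
    refine Real.le_sqrt_of_sq_le (le_trans ?_ h)
    rw [mul_pow, ← h4]
    gcongr
  rw [Real.rpow_neg zero_le_two, ← hp, inv_pow, ← div_eq_mul_inv, le_div_iff₀ (by positivity)]
  calc y * p ^ (i + 1) = p * (p ^ i * y) := by ring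
    _ ≤ p * √C := by gcongr
    _ ≤ 1 + √C * p := by linarith

theorem exists_abs_legendre_le_sum_dyadic (hn : 3 ≤ n) {b : ℝ} (hb0 : 0 ≤ b)
    (hb : b ≤ gegenbauerIndex n) :
    ∃ C : ℝ, 0 < C ∧ ∀ (k : ℕ) (t : ℝ) (J : ℕ) (c : ℕ → ℝ), 1 ≤ k → |t| ≤ 1 → (∀ j, 0 ≤ c j) →
      (∀ j, (k : ℝ) ^ 2 * (1 - t ^ 2) < 4 ^ j → 1 ≤ c j) →
      |legendre n k t| ≤ C * (∑ j ∈ Finset.range J, ((2 : ℝ) ^ (-b)) ^ j * c j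
        + ((2 : ℝ) ^ (-b)) ^ J) := by
  obtain ⟨C, hC, hdecay⟩ := exists_rpow_mul_sq_legendre_le hn
  refine ⟨1 + √C * 2 ^ gegenbauerIndex n, by positivity, fun k t J c hk ht hc0 hc1 => ?_⟩
  obtain ⟨j, hjJ, hjx, hy⟩ := exists_le_dyadic_of_rpow_mul_sq_le (hb0.trans hb)
    (abs_legendre_le_one (by omega) k ht) ((sq_abs (legendre n k t)).symm ▸ hdecay k t hk ht) J
  refine hy.trans ?_
  have hexp : ((2 : ℝ) ^ (-gegenbauerIndex n)) ^ j ≤ ((2 : ℝ) ^ (-b)) ^ j := by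
    gcongr
    exact one_le_two
  have hterm : ∀ i ∈ Finset.range J, 0 ≤ ((2 : ℝ) ^ (-b)) ^ i * c i :=
    fun i _ => mul_nonneg (by positivity) (hc0 i)
  refine mul_le_mul_of_nonneg_left (hexp.trans ?_) (by positivity)
  rcases hjJ.eq_or_lt with rfl | hlt
  · exact le_add_of_nonneg_left (Finset.sum_nonneg hterm)
  · calc ((2 : ℝ) ^ (-b)) ^ j ≤ ((2 : ℝ) ^ (-b)) ^ j * c j :=
          le_mul_of_one_le_right (by positivity) (hc1 j (hjx hlt))
      _ ≤ ∑ i ∈ Finset.range J, ((2 : ℝ) ^ (-b)) ^ i * c i :=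
          Finset.single_le_sum hterm (Finset.mem_range.2 hlt)
      _ ≤ _ := le_add_of_nonneg_right (by positivity)

lemma two_pow_clog_lt {k : ℕ} (hk : 1 ≤ k) : 2 ^ Nat.clog 2 k < 2 * k := by
  rcases hk.eq_or_lt with rfl | h
  · simp
  · have hlt := Nat.pow_pred_clog_lt_self one_lt_two h
    have hpos := Nat.clog_pos one_lt_two h
    calc 2 ^ Nat.clog 2 k = 2 * 2 ^ (Nat.clog 2 k).pred := by
          rw [← pow_succ', ← Nat.succ_eq_add_one, Nat.succ_pred hpos.ne']
      _ < 2 * k := by omega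

/-- The integral of the majorant of `P^n_k` obtained from the bound `2^(-b j)` on the `j`-th dyadic
shell around the poles, when the polar caps of chordal radius `r` have mass `r ^ α`. The number of
shells is the least `J` with `k ≤ 2 ^ J`. -/
noncomputable def dyadicSum (b α : ℝ) (k : ℕ) : ℝ :=
  ∑ j ∈ Finset.range (Nat.clog 2 k), ((2 : ℝ) ^ (-b)) ^ j * ((2 : ℝ) ^ j / k) ^ α
    + ((2 : ℝ) ^ (-b)) ^ Nat.clog 2 k

lemma dyadicSum_nonneg (b α : ℝ) (k : ℕ) : 0 ≤ dyadicSum b α k := by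
  rw [dyadicSum]
  positivity

lemma dyadicSum_le {b : ℝ} (hb : 0 ≤ b) (α : ℝ) {k : ℕ} (hk : 1 ≤ k) :
    dyadicSum b α k ≤ (k : ℝ) ^ (-α) * ∑ j ∈ Finset.range (Nat.clog 2 k), ((2 : ℝ) ^ (α - b)) ^ j
      + (k : ℝ) ^ (-b) := by
  have hk' : (0 : ℝ) < k := by exact_mod_cast hk
  rw [dyadicSum, Finset.mul_sum]
  refine add_le_add (Finset.sum_congr rfl fun j _ => ?_).le ?_
  · rw [Real.div_rpow (by positivity) hk'.le, ← Real.rpow_pow_comm zero_le_two,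
      Real.rpow_neg hk'.le, Real.rpow_sub two_pos, Real.rpow_neg zero_le_two, div_pow, inv_pow]
    field_simp
  · rw [Real.rpow_pow_comm zero_le_two]
    exact Real.rpow_le_rpow_of_nonpos hk' (by exact_mod_cast Nat.le_pow_clog one_lt_two k)
      (by linarith)

lemma isBigO_of_dyadicSum_le {b α D : ℝ} {g : ℕ → ℝ} {k₀ : ℕ}
    (h : ∀ k ≥ k₀, dyadicSum b α k ≤ D * g k) (hg : ∀ k, 0 ≤ g k) :
    dyadicSum b α =O[atTop] g := by
  refine IsBigO.of_bound D ?_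
  filter_upwards [eventually_ge_atTop k₀] with k hk
  rw [Real.norm_of_nonneg (dyadicSum_nonneg b α k), Real.norm_of_nonneg (hg k)]
  exact h k hk

lemma dyadicSum_isBigO_of_lt {b α : ℝ} (hb : 0 ≤ b) (h : α < b) :
    dyadicSum b α =O[atTop] fun k => (k : ℝ) ^ (-α) := by
  set ρ := (2 : ℝ) ^ (α - b)
  have hρ1 : ρ < 1 := Real.rpow_lt_one_of_one_lt_of_neg one_lt_two (by linarith)
  have hρ0 : 0 ≤ ρ := by positivity
  refine isBigO_of_dyadicSum_le (D := (1 - ρ)⁻¹ + 1) (k₀ := 1) (fun k hk => ?_)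
    fun k => by positivity
  have hk' : (1 : ℝ) ≤ k := by exact_mod_cast hk
  have hgeom : ∑ j ∈ Finset.range (Nat.clog 2 k), ρ ^ j ≤ (1 - ρ)⁻¹ := by
    rw [← tsum_geometric_of_lt_one hρ0 hρ1]
    exact (summable_geometric_of_lt_one hρ0 hρ1).sum_le_tsum _ fun i _ => by positivity
  calc dyadicSum b α k
      ≤ (k : ℝ) ^ (-α) * ∑ j ∈ Finset.range (Nat.clog 2 k), ρ ^ j + (k : ℝ) ^ (-b) :=
        dyadicSum_le hb α hk
    _ ≤ (k : ℝ) ^ (-α) * (1 - ρ)⁻¹ + (k : ℝ) ^ (-α) := by gcongr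
    _ = _ := by ring

lemma dyadicSum_self_isBigO {b : ℝ} (hb : 0 ≤ b) :
    dyadicSum b b =O[atTop] fun k => (k : ℝ) ^ (-b) * Real.log k := by
  have hlog2 : 0 < Real.log 2 := Real.log_pos one_lt_two
  refine isBigO_of_dyadicSum_le (D := 3 / Real.log 2) (k₀ := 2) (fun k hk => ?_) fun k =>
    mul_nonneg (by positivity) (Real.log_natCast_nonneg k)
  have hk' : (2 : ℝ) ≤ k := by exact_mod_cast hk
  have hlogk : Real.log 2 ≤ Real.log k := Real.log_le_log two_pos hk'
  have hclog : Nat.clog 2 k * Real.log 2 ≤ Real.log 2 + Real.log k := by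
    rw [← Real.log_pow, ← Real.log_mul two_ne_zero (by linarith)]
    exact Real.log_le_log (by positivity) (by exact_mod_cast (two_pow_clog_lt (by omega)).le)
  calc dyadicSum b b k ≤ (k : ℝ) ^ (-b) * (Nat.clog 2 k + 1) := by
        refine (dyadicSum_le hb b (by omega)).trans_eq ?_
        simp only [sub_self, Real.rpow_zero, one_pow, Finset.sum_const, Finset.card_range,
          nsmul_eq_mul]
        ring
    _ ≤ (k : ℝ) ^ (-b) * (3 / Real.log 2 * Real.log k) := by
        gcongr
        rw [div_mul_eq_mul_div, le_div_iff₀ hlog2]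
        linarith
    _ = _ := by ring

lemma dyadicSum_isBigO_of_gt {b α : ℝ} (hb : 0 ≤ b) (h : b < α) :
    dyadicSum b α =O[atTop] fun k => (k : ℝ) ^ (-b) := by
  set ρ := (2 : ℝ) ^ (α - b) with hρ
  have hρ1 : 1 < ρ := Real.one_lt_rpow one_lt_two (by linarith)
  have : 0 < ρ - 1 := by linarith
  refine isBigO_of_dyadicSum_le (D := ρ / (ρ - 1) + 1) (k₀ := 1) (fun k hk => ?_)
    fun k => by positivity
  have hk' : (1 : ℝ) ≤ k := by exact_mod_cast hk
  have hpow : ρ ^ Nat.clog 2 k ≤ ρ * (k : ℝ) ^ (α - b) := by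
    rw [hρ, Real.rpow_pow_comm zero_le_two, ← Real.mul_rpow zero_le_two (by linarith)]
    exact Real.rpow_le_rpow (by positivity) (by exact_mod_cast (two_pow_clog_lt hk).le)
      (by linarith)
  have hgeom : ∑ j ∈ Finset.range (Nat.clog 2 k), ρ ^ j ≤ ρ * (k : ℝ) ^ (α - b) / (ρ - 1) := by
    rw [geom_sum_eq hρ1.ne']
    gcongr
    linarith
  have hexp : (k : ℝ) ^ (-α) * (k : ℝ) ^ (α - b) = (k : ℝ) ^ (-b) := by
    rw [← Real.rpow_add (by linarith)]
    ring_nf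
  calc dyadicSum b α k
      ≤ (k : ℝ) ^ (-α) * (ρ * (k : ℝ) ^ (α - b) / (ρ - 1)) + (k : ℝ) ^ (-b) :=
        (dyadicSum_le hb α hk).trans (by gcongr)
    _ = (ρ / (ρ - 1) + 1) * (k : ℝ) ^ (-b) := by rw [← hexp]; ring

/-! ### Multipliers of measures -/

lemma abs_inner_sph_le_one (e u : Sph n) : |⟪(e : Euc n), (u : Euc n)⟫| ≤ 1 := by
  have := abs_real_inner_le_norm (e : Euc n) (u : Euc n)
  rwa [norm_eq_of_mem_sphere, norm_eq_of_mem_sphere, one_mul] at this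

lemma integrable_of_continuous {E : Type*} [NormedAddCommGroup E] (ν : Measure (Sph n))
    [IsFiniteMeasure ν] {g : Sph n → E} (hg : Continuous g) : Integrable g ν :=
  hg.integrable_of_hasCompactSupport (HasCompactSupport.of_compactSpace g)

/-- The pair of opposite polar caps of the sphere of chordal radius `r`; in terms of
`t = ⟨e, u⟩ = cos θ` it is given by `sin θ < r`. -/
def polarCaps (e : Sph n) (r : ℝ) : Set (Sph n) :=
  {u | 1 - ⟪(e : Euc n), (u : Euc n)⟫ ^ 2 < r ^ 2}

lemma measurableSet_polarCaps (e : Sph n) (r : ℝ) : MeasurableSet (polarCaps e r) :=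
  (isOpen_lt (by fun_prop) continuous_const).measurableSet

lemma mem_polarCaps_two_pow_div {e u : Sph n} {k : ℕ} (hk : 1 ≤ k) (j : ℕ) :
    u ∈ polarCaps e (2 ^ j / k) ↔ (k : ℝ) ^ 2 * (1 - ⟪(e : Euc n), (u : Euc n)⟫ ^ 2) < 4 ^ j := by
  have : (0 : ℝ) < k := by exact_mod_cast hk
  rw [polarCaps, Set.mem_ofPred_eq, div_pow, lt_div_iff₀' (by positivity), pow_right_comm]
  norm_num

lemma integrable_sum_mul_indicator_add {X : Type*} [MeasurableSpace X] (ν : Measure X)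
    [IsFiniteMeasure ν] {s : ℕ → Set X} (hs : ∀ j, MeasurableSet (s j)) (a : ℕ → ℝ) (d : ℝ)
    (J : ℕ) :
    Integrable (fun x => ∑ j ∈ Finset.range J, a j * (s j).indicator 1 x + d) ν :=
  (integrable_finsetSum _ fun j _ =>
    ((integrable_const (1 : ℝ)).indicator (hs j)).const_mul _).add (integrable_const _)

lemma integral_sum_mul_indicator_add {X : Type*} [MeasurableSpace X] (ν : Measure X)
    [IsFiniteMeasure ν] {s : ℕ → Set X} (hs : ∀ j, MeasurableSet (s j)) (a : ℕ → ℝ) (d : ℝ)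
    (J : ℕ) :
    ∫ x, (∑ j ∈ Finset.range J, a j * (s j).indicator 1 x + d) ∂ν
      = ∑ j ∈ Finset.range J, a j * ν.real (s j) + ν.real Set.univ * d := by
  have hint : ∀ j ∈ Finset.range J, Integrable (fun x => a j * (s j).indicator 1 x) ν :=
    fun j _ => ((integrable_const (1 : ℝ)).indicator (hs j)).const_mul _
  rw [integral_add (integrable_finsetSum _ hint) (integrable_const _), integral_finsetSum _ hint,
    integral_const, smul_eq_mul]
  simp_rw [integral_const_mul, integral_indicator_one (hs _)]

lemma exists_integral_abs_legendre_le (hn : 3 ≤ n) (e : Sph n) (ν : Measure (Sph n))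
    [IsFiniteMeasure ν] {b C α : ℝ} (hb0 : 0 ≤ b) (hb : b ≤ gegenbauerIndex n)
    (hν : ∀ r : ℝ, 0 < r → ν.real (polarCaps e r) ≤ C * r ^ α) :
    ∃ D : ℝ, ∀ k : ℕ, 1 ≤ k →
      ∫ u, |legendre n k ⟪(e : Euc n), (u : Euc n)⟫| ∂ν ≤ D * dyadicSum b α k := by
  obtain ⟨A, hA, hmajorant⟩ := exists_abs_legendre_le_sum_dyadic hn hb0 hb
  have hC : 0 ≤ C := by simpa using measureReal_nonneg.trans (hν 1 one_pos)
  refine ⟨A * (C + ν.real Set.univ), fun k hk => ?_⟩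
  have : (0 : ℝ) < k := by exact_mod_cast hk
  have hcap : ∀ j : ℕ, MeasurableSet (polarCaps e (2 ^ j / k)) := fun j =>
    measurableSet_polarCaps e _
  calc ∫ u, |legendre n k ⟪(e : Euc n), (u : Euc n)⟫| ∂ν
      ≤ ∫ u, A * (∑ j ∈ Finset.range (Nat.clog 2 k), ((2 : ℝ) ^ (-b)) ^ j
          * (polarCaps e (2 ^ j / k)).indicator 1 u + ((2 : ℝ) ^ (-b)) ^ Nat.clog 2 k) ∂ν := by
        refine integral_mono (integrable_of_continuous ν
          ((continuous_legendre n k).comp (by fun_prop)).abs)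
          ((integrable_sum_mul_indicator_add ν hcap _ _ _).const_mul A) fun u => ?_
        refine hmajorant k _ _ (fun j => (polarCaps e (2 ^ j / k)).indicator 1 u) hk
          (abs_inner_sph_le_one e u) (fun j => Set.indicator_nonneg (fun _ _ => zero_le_one) u)
          fun j hj => ?_
        rw [Set.indicator_of_mem ((mem_polarCaps_two_pow_div hk j).2 hj), Pi.one_apply]
    _ = A * (∑ j ∈ Finset.range (Nat.clog 2 k), ((2 : ℝ) ^ (-b)) ^ j
          * ν.real (polarCaps e (2 ^ j / k))
          + ν.real Set.univ * ((2 : ℝ) ^ (-b)) ^ Nat.clog 2 k) := by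
        rw [integral_const_mul, integral_sum_mul_indicator_add ν hcap]
    _ ≤ A * (∑ j ∈ Finset.range (Nat.clog 2 k), ((2 : ℝ) ^ (-b)) ^ j
          * ((C + ν.real Set.univ) * ((2 : ℝ) ^ j / k) ^ α)
          + (C + ν.real Set.univ) * ((2 : ℝ) ^ (-b)) ^ Nat.clog 2 k) := by
        have hC' : C ≤ C + ν.real Set.univ := le_add_of_nonneg_right measureReal_nonneg
        gcongr with j
        · exact (hν _ (by positivity)).trans (by gcongr)
        · linarith
    _ = _ := by
        simp_rw [mul_left_comm _ (C + ν.real Set.univ), ← Finset.mul_sum, dyadicSum]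
        ring

lemma abs_multiplier_measurePairing_le (e : Sph n) (μ : SignedMeasure (Sph n)) (k : ℕ) :
    |multiplier e (measurePairing μ) k|
      ≤ ∫ u, |legendre n k ⟪(e : Euc n), (u : Euc n)⟫| ∂μ.totalVariation := by
  have hint (ν : Measure (Sph n)) [IsFiniteMeasure ν] :
      Integrable (fun u : Sph n => |legendre n k ⟪(e : Euc n), (u : Euc n)⟫|) ν :=
    integrable_of_continuous ν ((continuous_legendre n k).comp (by fun_prop)).abs
  rw [SignedMeasure.totalVariation, integral_add_measure (hint _) (hint _)]
  exact (abs_sub _ _).trans (add_le_add abs_integral_le_integral_abs abs_integral_le_integral_abs)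

lemma polarCaps_subset_of_le_one (e : Sph n) {r : ℝ} (hr : 0 ≤ r) (hr1 : r ≤ 1) :
    polarCaps e r ⊆ {u | Real.cos (Real.arcsin r) < |⟪(e : Euc n), (u : Euc n)⟫|} := by
  intro u hu
  rw [polarCaps, Set.mem_ofPred_eq] at hu
  rw [Set.mem_ofPred_eq, Real.cos_arcsin, Real.sqrt_lt (by nlinarith) (abs_nonneg _), sq_abs]
  linarith

lemma arcsin_le_pi_mul {r : ℝ} (hr : 0 ≤ r) (hr1 : r ≤ 1) : Real.arcsin r ≤ Real.pi * r := by
  have hnonneg := Real.arcsin_nonneg.2 hr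
  have hjordan := Real.mul_le_sin hnonneg (Real.arcsin_le_pi_div_two r)
  rw [Real.sin_arcsin (by linarith) hr1, div_mul_eq_mul_div, div_le_iff₀ Real.pi_pos] at hjordan
  linarith

lemma measureReal_polarCaps_le (e : Sph n) (ν : Measure (Sph n)) [IsFiniteMeasure ν]
    {C α : ℝ} (hα : 0 ≤ α)
    (hν : ∀ r : ℝ, 0 ≤ r →
      ν.real {u | Real.cos r < |⟪(e : Euc n), (u : Euc n)⟫|} ≤ C * r ^ α) {r : ℝ} (hr : 0 < r) :
    ν.real (polarCaps e r) ≤ C * Real.pi ^ α * r ^ α := by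
  have hpi := Real.pi_pos
  have hC : 0 ≤ C := by simpa using measureReal_nonneg.trans (hν 1 zero_le_one)
  rcases le_or_gt r 1 with hr1 | hr1
  · have harcsin := Real.arcsin_nonneg.2 hr.le
    calc ν.real (polarCaps e r) ≤ C * (Real.arcsin r) ^ α :=
          (measureReal_mono (polarCaps_subset_of_le_one e hr.le hr1)).trans (hν _ harcsin)
      _ ≤ C * (Real.pi * r) ^ α := by
          gcongr
          exact arcsin_le_pi_mul hr.le hr1
      _ = _ := by rw [Real.mul_rpow hpi.le hr.le, mul_assoc]
  · have hall : polarCaps e r ⊆ {u | Real.cos Real.pi < |⟪(e : Euc n), (u : Euc n)⟫|} := by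
      intro u _
      rw [Set.mem_ofPred_eq, Real.cos_pi]
      linarith [abs_nonneg ⟪(e : Euc n), (u : Euc n)⟫]
    calc ν.real (polarCaps e r) ≤ C * Real.pi ^ α :=
          (measureReal_mono hall).trans (hν _ hpi.le)
      _ ≤ _ := le_mul_of_one_le_right (by positivity) (Real.one_le_rpow hr1.le hα)

theorem multiplier_measurePairing_isBigO_dyadicSum (hn : 3 ≤ n) (e : Sph n)
    (μ : SignedMeasure (Sph n)) {C α : ℝ} (hα : 0 ≤ α)
    (hμ : ∀ r : ℝ, 0 ≤ r →
      μ.totalVariation.real {u | Real.cos r < |⟪(e : Euc n), (u : Euc n)⟫|} ≤ C * r ^ α) :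
    multiplier e (measurePairing μ) =O[atTop] dyadicSum (gegenbauerIndex n) α := by
  have : IsFiniteMeasure μ.totalVariation := by
    rw [SignedMeasure.totalVariation]
    infer_instance
  obtain ⟨D, hD⟩ := exists_integral_abs_legendre_le hn e μ.totalVariation
    (gegenbauerIndex_nonneg (by omega)) le_rfl fun r hr => measureReal_polarCaps_le e _ hα hμ hr
  refine IsBigO.of_bound D ?_
  filter_upwards [eventually_ge_atTop 1] with k hk
  rw [Real.norm_of_nonneg (dyadicSum_nonneg _ α k)]
  exact (abs_multiplier_measurePairing_le e μ k).trans (hD k hk)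

/-! ### Rotations and the surface area measure -/

section Rotations

open scoped Pointwise

variable {E : Type*} [NormedAddCommGroup E] [InnerProductSpace ℝ E] [FiniteDimensional ℝ E]

lemma det_reflection_orthogonal_span_singleton {v : E} (hv : v ≠ 0) :
    LinearMap.det ((ℝ ∙ v)ᗮ.reflection.toLinearEquiv : E →ₗ[ℝ] E) = -1 := by
  have h := Submodule.det_reflection (𝕜 := ℝ) (ℝ ∙ v)ᗮ
  rwa [Submodule.orthogonal_orthogonal, finrank_span_singleton hv, pow_one] at h

lemma exists_ne_zero_inner_eq_zero (hE : 3 ≤ Module.finrank ℝ E) (a b : E) :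
    ∃ c : E, c ≠ 0 ∧ ⟪c, a⟫ = 0 ∧ ⟪c, b⟫ = 0 := by
  classical
  set S : Submodule ℝ E := Submodule.span ℝ {a, b}
  have hS : Module.finrank ℝ S ≤ 2 := by
    have h := finrank_span_finset_le_card (R := ℝ) ({a, b} : Finset E)
    rw [Finset.coe_pair] at h
    exact h.trans Finset.card_le_two
  have hS' : Sᗮ ≠ ⊥ := fun h => by
    have hsum := Submodule.finrank_add_finrank_orthogonal S
    rw [h, finrank_bot] at hsum
    omega
  obtain ⟨c, hc, hc0⟩ := Submodule.exists_mem_ne_zero_of_ne_bot hS'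
  have hcS := (Submodule.mem_orthogonal' S c).1 hc
  exact ⟨c, hc0, hcS a (Submodule.subset_span (by simp)), hcS b (Submodule.subset_span (by simp))⟩

lemma exists_norm_eq_one_inner_eq_zero (hE : 3 ≤ Module.finrank ℝ E) (a : E) :
    ∃ c : E, ‖c‖ = 1 ∧ ⟪c, a⟫ = 0 := by
  obtain ⟨c, hc0, hca, -⟩ := exists_ne_zero_inner_eq_zero hE a a
  exact ⟨‖c‖⁻¹ • c,
    by rw [norm_smul, norm_inv, norm_norm, inv_mul_cancel₀ (norm_ne_zero_iff.2 hc0)],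
    by rw [real_inner_smul_left, hca, mul_zero]⟩

lemma exists_isRotation_apply_eq (hn : 3 ≤ n) {a b x : Euc n} (hab : ‖a‖ = ‖b‖)
    (hx : ⟪a, x⟫ = ⟪b, x⟫) :
    ∃ θ : Euc n ≃ₗᵢ[ℝ] Euc n, IsRotation θ ∧ θ a = b ∧ θ x = x := by
  have reflection_eq_self {c y : Euc n} (h : ⟪c, y⟫ = 0) : (ℝ ∙ c)ᗮ.reflection y = y :=
    Submodule.reflection_mem_subspace_eq_self
      (Submodule.mem_orthogonal_singleton_iff_inner_right.2 h)
  obtain rfl | hne := eq_or_ne a b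
  · exact ⟨LinearIsometryEquiv.refl ℝ _, LinearMap.det_id, rfl, rfl⟩
  obtain ⟨c, hc0, hcb, hcx⟩ := exists_ne_zero_inner_eq_zero (by simpa using hn) b x
  refine ⟨(ℝ ∙ (a - b))ᗮ.reflection.trans (ℝ ∙ c)ᗮ.reflection, ?_, ?_, ?_⟩
  · change LinearMap.det (((ℝ ∙ c)ᗮ.reflection.toLinearEquiv : Euc n →ₗ[ℝ] Euc n) ∘ₗ
      ((ℝ ∙ (a - b))ᗮ.reflection.toLinearEquiv : Euc n →ₗ[ℝ] Euc n)) = 1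
    rw [LinearMap.det_comp, det_reflection_orthogonal_span_singleton hc0,
      det_reflection_orthogonal_span_singleton (sub_ne_zero.2 hne)]
    norm_num
  · rw [LinearIsometryEquiv.trans_apply, Submodule.reflection_sub hab, reflection_eq_self hcb]
  · have habx : ⟪a - b, x⟫ = 0 := by rw [inner_sub_left, hx, sub_self]
    rw [LinearIsometryEquiv.trans_apply, reflection_eq_self habx, reflection_eq_self hcx]

instance : IsFiniteMeasure (surf n) := inferInstanceAs (IsFiniteMeasure (Measure.toSphere _))

lemma surf_apply {A : Set (Sph n)} (hA : MeasurableSet A) :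
    surf n A = n * volume (Set.Ioo (0 : ℝ) 1 • ((↑) '' A : Set (Euc n))) := by
  rw [surf, Measure.toSphere_apply' _ hA, finrank_euclideanSpace_fin]

lemma rotSph_symm_rotSph (θ : Euc n ≃ₗᵢ[ℝ] Euc n) (u : Sph n) : rotSph θ.symm (rotSph θ u) = u :=
  Subtype.ext (θ.symm_apply_apply _)

lemma rotSph_rotSph_symm (θ : Euc n ≃ₗᵢ[ℝ] Euc n) (u : Sph n) : rotSph θ (rotSph θ.symm u) = u :=
  Subtype.ext (θ.apply_symm_apply _)

lemma continuous_rotSph (θ : Euc n ≃ₗᵢ[ℝ] Euc n) : Continuous (rotSph θ) :=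
  (θ.continuous.comp continuous_subtype_val).subtype_mk _

lemma Ioo_smul_preimage_rotSph (θ : Euc n ≃ₗᵢ[ℝ] Euc n) (A : Set (Sph n)) :
    Set.Ioo (0 : ℝ) 1 • ((↑) '' (rotSph θ ⁻¹' A) : Set (Euc n))
      = θ ⁻¹' (Set.Ioo (0 : ℝ) 1 • ((↑) '' A : Set (Euc n))) := by
  ext x
  simp only [Set.mem_smul, Set.mem_image, Set.mem_preimage]
  constructor
  · rintro ⟨r, hr, _, ⟨u, hu, rfl⟩, rfl⟩
    exact ⟨r, hr, _, ⟨_, hu, rfl⟩, (θ.map_smul r u).symm⟩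
  · rintro ⟨r, hr, _, ⟨u, hu, rfl⟩, hx⟩
    refine ⟨r, hr, _, ⟨rotSph θ.symm u, by rwa [rotSph_rotSph_symm], rfl⟩, θ.injective ?_⟩
    rw [← hx, θ.map_smul]
    exact congrArg (r • ·) (θ.apply_symm_apply _)

lemma measurePreserving_rotSph (θ : Euc n ≃ₗᵢ[ℝ] Euc n) :
    MeasurePreserving (rotSph θ) (surf n) (surf n) := by
  have hmeas := (continuous_rotSph θ).measurable
  refine ⟨hmeas, Measure.ext fun A hA => ?_⟩
  rw [Measure.map_apply hmeas hA, surf_apply hA, surf_apply (hmeas hA), Ioo_smul_preimage_rotSph]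
  congr 1
  exact θ.measurePreserving.measure_preimage_equiv (f := θ.toMeasurableEquiv) _

lemma integral_comp_rotSph {F : Type*} [NormedAddCommGroup F] [NormedSpace ℝ F]
    (θ : Euc n ≃ₗᵢ[ℝ] Euc n) (g : Sph n → F) :
    ∫ u, g (rotSph θ u) ∂(surf n) = ∫ u, g u ∂(surf n) := by
  have hinj : Function.Injective (rotSph θ) := Function.LeftInverse.injective (rotSph_symm_rotSph θ)
  exact (measurePreserving_rotSph θ).integral_comp
    ((continuous_rotSph θ).isClosedEmbedding hinj).measurableEmbedding g

end Rotations

section RankTwo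

variable {E : Type*} [NormedAddCommGroup E] [InnerProductSpace ℝ E]

/-- The operator `a Id + b u ⊗ u + c w ⊗ w`: the shape of the Hessian of a zonal function. -/
noncomputable def rankTwo (a b c : ℝ) (u w : E) : E →L[ℝ] E :=
  a • ContinuousLinearMap.id ℝ E + b • (innerSL ℝ u).smulRight u + c • (innerSL ℝ w).smulRight w

lemma rankTwo_apply (a b c : ℝ) (u w v : E) :
    rankTwo a b c u w v = a • v + (b * ⟪u, v⟫) • u + (c * ⟪w, v⟫) • w := by
  simp [rankTwo, mul_smul]

lemma det_rankTwo [FiniteDimensional ℝ E] (hE : 2 ≤ Module.finrank ℝ E) {a b c : ℝ} (ha : a ≠ 0)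
    {u w : E} (huw : ⟪u, w⟫ = 0) :
    (rankTwo a b c u w).det
      = a ^ (Module.finrank ℝ E - 2) * ((a + b * ‖u‖ ^ 2) * (a + c * ‖w‖ ^ 2)) := by
  have hcomp : (rankTwo a b c u w : E →ₗ[ℝ] E)
      = a • (LinearMap.transvection ((c / a) • innerₗ E w) w
        ∘ₗ LinearMap.transvection ((b / a) • innerₗ E u) u) := by
    ext v
    simp only [ContinuousLinearMap.coe_coe, rankTwo_apply, LinearMap.smul_apply,
      LinearMap.comp_apply, LinearMap.transvection.apply, innerₗ_apply_apply, smul_eq_mul,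
      inner_add_right, real_inner_smul_right, real_inner_comm u w ▸ huw, smul_add, smul_smul]
    rw [mul_zero, add_zero, ← mul_assoc, ← mul_assoc, mul_div_cancel₀ _ ha, mul_div_cancel₀ _ ha]
  obtain ⟨m, hm⟩ := Nat.exists_eq_add_of_le' hE
  rw [ContinuousLinearMap.det, hcomp, LinearMap.det_smul, LinearMap.det_comp,
    LinearMap.transvection.det, LinearMap.transvection.det, hm, Nat.add_sub_cancel]
  simp only [LinearMap.smul_apply, innerₗ_apply_apply, real_inner_self_eq_norm_sq, smul_eq_mul]
  field_simp
  ring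

end RankTwo

section SurfaceOfCaps

open scoped Pointwise

variable {E : Type*} [NormedAddCommGroup E] [InnerProductSpace ℝ E]

lemma slab_subset_image_rankTwo {c : E} (hc : ‖c‖ = 1) {r : ℝ} (hr : 0 < r) :
    {x : E | ‖x‖ < 1 ∧ |⟪c, x⟫| < r} ⊆ rankTwo 1 (r - 1) 0 c 0 '' Metric.ball 0 2 := by
  rintro x ⟨hx, hcx⟩
  refine ⟨x + ((r⁻¹ - 1) * ⟪c, x⟫) • c, ?_, ?_⟩
  · have hnorm : ‖x + ((r⁻¹ - 1) * ⟪c, x⟫) • c‖ ^ 2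
        = ‖x‖ ^ 2 - ⟪c, x⟫ ^ 2 + (r⁻¹ * ⟪c, x⟫) ^ 2 := by
      rw [norm_add_sq_real, real_inner_smul_right, norm_smul, hc, mul_one, Real.norm_eq_abs,
        sq_abs, real_inner_comm]
      ring
    have hscaled : (r⁻¹ * ⟪c, x⟫) ^ 2 < 1 := by
      rwa [sq_lt_one_iff_abs_lt_one, abs_mul, abs_of_pos (inv_pos.2 hr), inv_mul_lt_iff₀ hr,
        mul_one]
    have hx2 : ‖x‖ ^ 2 < 1 := (sq_lt_one_iff₀ (norm_nonneg x)).2 hx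
    rw [mem_ball_zero_iff]
    nlinarith [sq_nonneg ⟪c, x⟫, norm_nonneg (x + ((r⁻¹ - 1) * ⟪c, x⟫) • c)]
  · have hcc : ⟪c, c⟫ = 1 := by rw [real_inner_self_eq_norm_sq, hc, one_pow]
    have hcoef : (r⁻¹ - 1) * ⟪c, x⟫ + (r - 1) * (⟪c, x⟫ + (r⁻¹ - 1) * ⟪c, x⟫) = 0 := by
      field_simp
      ring
    rw [rankTwo_apply, inner_add_right, real_inner_smul_right, hcc, one_smul, smul_zero, add_zero,
      mul_one, add_assoc, ← add_smul, hcoef, zero_smul, add_zero]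

lemma volume_slab_le [FiniteDimensional ℝ E] [MeasurableSpace E] [BorelSpace E]
    (hE : 2 ≤ Module.finrank ℝ E) {c : E} (hc : ‖c‖ = 1) {r : ℝ} (hr : 0 < r) :
    volume {x : E | ‖x‖ < 1 ∧ |⟪c, x⟫| < r}
      ≤ ENNReal.ofReal r * volume (Metric.ball (0 : E) 2) := by
  refine (measure_mono (slab_subset_image_rankTwo hc hr)).trans (le_of_eq ?_)
  rw [Measure.addHaar_image_continuousLinearMap, ← ContinuousLinearMap.det,
    det_rankTwo hE one_ne_zero (inner_zero_right c), hc]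
  simp [abs_of_pos hr]

lemma abs_inner_lt_of_mem_polarCaps {e u : Sph n} {c : Euc n} (hc : ‖c‖ = 1)
    (hce : ⟪c, (e : Euc n)⟫ = 0) {r : ℝ} (hr : 0 ≤ r) (hu : u ∈ polarCaps e r) :
    |⟪c, (u : Euc n)⟫| < r := by
  set t := ⟪(e : Euc n), (u : Euc n)⟫ with ht
  have hperp : ⟪c, (u : Euc n)⟫ = ⟪c, (u : Euc n) - t • (e : Euc n)⟫ := by
    rw [inner_sub_right, real_inner_smul_right, hce, mul_zero, sub_zero]
  have hnorm : ‖(u : Euc n) - t • (e : Euc n)‖ ^ 2 = 1 - t ^ 2 := by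
    rw [norm_sub_sq_real, real_inner_smul_right, norm_smul, norm_eq_of_mem_sphere u,
      norm_eq_of_mem_sphere e, real_inner_comm, ← ht, Real.norm_eq_abs, mul_one, sq_abs]
    ring
  have hlt : ‖(u : Euc n) - t • (e : Euc n)‖ < r := lt_of_pow_lt_pow_left₀ 2 hr (hnorm ▸ hu)
  calc |⟪c, (u : Euc n)⟫| ≤ ‖c‖ * ‖(u : Euc n) - t • (e : Euc n)‖ := by
        rw [hperp]
        exact abs_real_inner_le_norm _ _
    _ < r := by rwa [hc, one_mul]

lemma exists_surf_polarCaps_le (hn : 3 ≤ n) (e : Sph n) :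
    ∃ C : ℝ, ∀ r : ℝ, 0 < r → (surf n).real (polarCaps e r) ≤ C * r := by
  obtain ⟨c, hc, hce⟩ := exists_norm_eq_one_inner_eq_zero (by simpa using hn) (e : Euc n)
  refine ⟨n * volume.real (Metric.ball (0 : Euc n) 2), fun r hr => ?_⟩
  have hcone : Set.Ioo (0 : ℝ) 1 • ((↑) '' (polarCaps e r) : Set (Euc n))
      ⊆ {x : Euc n | ‖x‖ < 1 ∧ |⟪c, x⟫| < r} := by
    rintro _ ⟨s, ⟨hs0, hs1⟩, _, ⟨u, hu, rfl⟩, rfl⟩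
    have hcu := abs_inner_lt_of_mem_polarCaps hc hce hr.le hu
    refine ⟨by simpa [norm_smul, abs_of_pos hs0] using hs1, ?_⟩
    simp only [real_inner_smul_right, abs_mul, abs_of_pos hs0]
    nlinarith [abs_nonneg ⟪c, (u : Euc n)⟫]
  have hvol := ENNReal.toReal_mono
    (ENNReal.mul_ne_top ENNReal.ofReal_ne_top measure_ball_lt_top.ne)
    ((measure_mono hcone).trans (volume_slab_le (by simp; omega) hc hr))
  rw [ENNReal.toReal_mul, ENNReal.toReal_ofReal hr.le, mul_comm] at hvol
  rw [Measure.real, surf_apply (measurableSet_polarCaps e r), ENNReal.toReal_mul,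
    ENNReal.toReal_natCast, mul_assoc]
  exact mul_le_mul_of_nonneg_left hvol n.cast_nonneg

end SurfaceOfCaps

/-! ### Zonal convex bodies -/

/-- The `C²` functions `q` of the latitude `t = ⟪e, u⟫`; they encode the zonal functions
`u ↦ q ⟪e, u⟫` on the sphere. -/
noncomputable def profileSubmodule : Submodule ℝ (ℝ → ℝ) where
  carrier := {q | ContDiff ℝ 2 q}
  add_mem' := fun (hp : ContDiff ℝ 2 _) (hq : ContDiff ℝ 2 _) => hp.add hq
  zero_mem' := (contDiff_const : ContDiff ℝ 2 fun _ : ℝ => (0 : ℝ))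
  smul_mem' := fun c _ (hq : ContDiff ℝ 2 _) => hq.const_smul c

lemma mem_profileSubmodule {q : ℝ → ℝ} : q ∈ profileSubmodule ↔ ContDiff ℝ 2 q := Iff.rfl

/-- The vector space of profiles of zonal functions. -/
abbrev Profile : Type := profileSubmodule

namespace Profile

instance : CoeFun Profile fun _ => ℝ → ℝ := ⟨Subtype.val⟩

/-- The first derivative of a profile. -/
noncomputable def d1 (q : Profile) : ℝ → ℝ := deriv q.1

/-- The second derivative of a profile. -/
noncomputable def d2 (q : Profile) : ℝ → ℝ := deriv q.d1

/-- The principal radius of curvature in the directions of the parallels of the body of revolution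
with support function `u ↦ q ⟪e, u⟫`. -/
noncomputable def tan (q : Profile) (t : ℝ) : ℝ := q t - t * q.d1 t

/-- The principal radius of curvature in the direction of the meridians of the body of revolution
with support function `u ↦ q ⟪e, u⟫`. -/
noncomputable def rad (q : Profile) (t : ℝ) : ℝ := q.tan t + (1 - t ^ 2) * q.d2 t

/-- The profiles of support functions of convex bodies of revolution containing the origin. -/
structure IsConvex (q : Profile) : Prop where
  nonneg : ∀ t, |t| ≤ 1 → 0 ≤ q t
  tan_nonneg : ∀ t, |t| ≤ 1 → 0 ≤ q.tan t
  rad_nonneg : ∀ t, |t| ≤ 1 → 0 ≤ q.rad t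

variable (q : Profile)

lemma contDiff : ContDiff ℝ 2 q := mem_profileSubmodule.1 q.2

lemma contDiff_d1 : ContDiff ℝ 1 q.d1 :=
  (contDiff_succ_iff_deriv (n := 1)).1 q.contDiff |>.2.2

@[fun_prop]
lemma continuous : Continuous q := q.contDiff.continuous

@[fun_prop]
lemma continuous_d1 : Continuous q.d1 := q.contDiff_d1.continuous

@[fun_prop]
lemma continuous_d2 : Continuous q.d2 := q.contDiff_d1.continuous_deriv le_rfl

lemma hasDerivAt (t : ℝ) : HasDerivAt q (q.d1 t) t :=
  (q.contDiff.differentiable two_ne_zero t).hasDerivAt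

lemma hasDerivAt_d1 (t : ℝ) : HasDerivAt q.d1 (q.d2 t) t :=
  (q.contDiff_d1.differentiable one_ne_zero t).hasDerivAt

@[fun_prop]
lemma continuous_tan : Continuous q.tan :=
  q.continuous.sub (continuous_id.mul q.continuous_d1)

@[fun_prop]
lemma continuous_rad : Continuous q.rad :=
  q.continuous_tan.add ((continuous_const.sub (continuous_pow 2)).mul q.continuous_d2)

lemma hasDerivAt_tan (t : ℝ) : HasDerivAt q.tan (-(t * q.d2 t)) t := by
  refine ((q.hasDerivAt t).sub ((hasDerivAt_id t).mul (q.hasDerivAt_d1 t))).congr_deriv ?_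
  simp

end Profile

section Latitude

variable {E : Type*} [NormedAddCommGroup E] [InnerProductSpace ℝ E] {e x : E}

/-- The unit vector in the direction of `x ≠ 0`. -/
noncomputable def dir (x : E) : E := ‖x‖⁻¹ • x

/-- The latitude of `x ≠ 0` with respect to the pole `e`. -/
noncomputable def lat (e x : E) : ℝ := ⟪e, dir x⟫

/-- The component of the pole `e` orthogonal to `x ≠ 0`. -/
noncomputable def perp (e x : E) : E := e - lat e x • dir x

lemma norm_dir (hx : x ≠ 0) : ‖dir x‖ = 1 := by
  rw [dir, norm_smul, norm_inv, norm_norm, inv_mul_cancel₀ (norm_ne_zero_iff.2 hx)]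

lemma norm_smul_dir (hx : x ≠ 0) : ‖x‖ • dir x = x := by
  rw [dir, smul_inv_smul₀ (norm_ne_zero_iff.2 hx)]

lemma inner_dir_self (hx : x ≠ 0) : ⟪dir x, x⟫ = ‖x‖ := by
  rw [dir, real_inner_smul_left, real_inner_self_eq_norm_sq, sq,
    inv_mul_cancel_left₀ (norm_ne_zero_iff.2 hx)]

lemma norm_mul_lat (e : E) (hx : x ≠ 0) : ‖x‖ * lat e x = ⟪e, x⟫ := by
  rw [lat, ← real_inner_smul_right, norm_smul_dir hx]

lemma abs_lat_le_one (he : ‖e‖ = 1) (hx : x ≠ 0) : |lat e x| ≤ 1 := by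
  simpa [lat, he, norm_dir hx] using abs_real_inner_le_norm e (dir x)

lemma inner_dir_perp (e : E) (hx : x ≠ 0) : ⟪dir x, perp e x⟫ = 0 := by
  rw [perp, inner_sub_right, real_inner_smul_right, real_inner_self_eq_norm_sq, norm_dir hx,
    real_inner_comm, lat, one_pow, mul_one, sub_self]

lemma norm_perp_sq (he : ‖e‖ = 1) (hx : x ≠ 0) : ‖perp e x‖ ^ 2 = 1 - lat e x ^ 2 := by
  rw [perp, norm_sub_sq_real, real_inner_smul_right, norm_smul, norm_dir hx, he, ← lat,
    Real.norm_eq_abs, mul_one, sq_abs]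
  ring

lemma dir_smul {c : ℝ} (hc : 0 < c) (x : E) : dir (c • x) = dir x := by
  rw [dir, dir, norm_smul, Real.norm_of_nonneg hc.le, mul_inv, smul_smul, mul_right_comm,
    inv_mul_cancel₀ hc.ne', one_mul]

lemma lat_smul {c : ℝ} (hc : 0 < c) (e x : E) : lat e (c • x) = lat e x := by
  rw [lat, lat, dir_smul hc]

lemma dir_of_norm_eq_one (hx : ‖x‖ = 1) : dir x = x := by rw [dir, hx, inv_one, one_smul]

lemma lat_of_norm_eq_one (e : E) (hx : ‖x‖ = 1) : lat e x = ⟪e, x⟫ := by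
  rw [lat, dir_of_norm_eq_one hx]

lemma sph_ne_zero (u : Sph n) : (u : Euc n) ≠ 0 :=
  Metric.ne_of_mem_sphere u.2 one_ne_zero

lemma hasFDerivAt_norm_of_ne_zero (hx : x ≠ 0) :
    HasFDerivAt (fun y : E => ‖y‖) (innerSL ℝ (dir x)) x := by
  have hx' : ‖x‖ ≠ 0 := norm_ne_zero_iff.2 hx
  have hsqrt := (hasStrictFDerivAt_norm_sq x).hasFDerivAt.sqrt (pow_ne_zero 2 hx')
  simp only [Real.sqrt_sq (norm_nonneg _)] at hsqrt
  refine hsqrt.congr_fderiv ?_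
  ext v
  simp only [one_div, mul_inv_rev, smul_apply, coe_innerSL_apply, nsmul_eq_mul, Nat.cast_ofNat,
    smul_eq_mul, dir, map_smul]
  field_simp

lemma hasFDerivAt_inv_norm (hx : x ≠ 0) :
    HasFDerivAt (fun y : E => ‖y‖⁻¹) (-(‖x‖⁻¹ ^ 2) • innerSL ℝ (dir x)) x := by
  refine ((hasDerivAt_inv (norm_ne_zero_iff.2 hx)).comp_hasFDerivAt x
    (hasFDerivAt_norm_of_ne_zero hx)).congr_fderiv ?_
  simp

lemma hasFDerivAt_dir (hx : x ≠ 0) :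
    HasFDerivAt dir (rankTwo ‖x‖⁻¹ (-‖x‖⁻¹) 0 (dir x) 0) x := by
  refine ((hasFDerivAt_inv_norm hx).smul (hasFDerivAt_id x)).congr_fderiv ?_
  ext1 v
  rw [rankTwo_apply]
  simp only [inv_pow, dir, map_smul, smul_smul, neg_mul, neg_smul, id_eq, add_apply, smul_apply,
    ContinuousLinearMap.id_apply, ContinuousLinearMap.smulRight_apply, neg_apply,
    coe_innerSL_apply, smul_eq_mul, real_inner_smul_left, inner_zero_left, mul_zero, smul_zero,
    add_zero]
  module

lemma hasFDerivAt_lat (e : E) (hx : x ≠ 0) :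
    HasFDerivAt (lat e) (‖x‖⁻¹ • innerSL ℝ (perp e x)) x := by
  refine ((innerSL ℝ e).hasFDerivAt.comp x (hasFDerivAt_dir hx)).congr_fderiv ?_
  ext v
  simp only [ContinuousLinearMap.comp_apply, rankTwo_apply, neg_mul, neg_smul, inner_zero_left,
    mul_zero, smul_zero, add_zero, coe_innerSL_apply, inner_add_right, real_inner_smul_right,
    inner_neg_right, perp, lat, map_sub, map_smul, smul_apply, sub_apply, smul_eq_mul]
  ring

end Latitude

section ZonalExtension

variable {E : Type*} [NormedAddCommGroup E] [InnerProductSpace ℝ E] {q : Profile} {e x y : E}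

/-- The `1`-homogeneous extension of the zonal function with profile `q`. -/
noncomputable def zonalExt (q : Profile) (e x : E) : ℝ := ‖x‖ * q (lat e x)

/-- The gradient of the `1`-homogeneous extension of the zonal function with profile `q`. -/
noncomputable def zonalGrad (q : Profile) (e x : E) : E :=
  q.tan (lat e x) • dir x + q.d1 (lat e x) • e

/-- The Hessian of the `1`-homogeneous extension of the zonal function with profile `q`. -/
noncomputable def zonalHess (q : Profile) (e x : E) : E →L[ℝ] E :=
  rankTwo (‖x‖⁻¹ * q.tan (lat e x)) (-(‖x‖⁻¹ * q.tan (lat e x))) (‖x‖⁻¹ * q.d2 (lat e x))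
    (dir x) (perp e x)

lemma zonalExt_of_norm_eq_one (q : Profile) (e : E) (hx : ‖x‖ = 1) :
    zonalExt q e x = q ⟪e, x⟫ := by
  rw [zonalExt, hx, one_mul, lat_of_norm_eq_one e hx]

lemma hasFDerivAt_zonalExt (q : Profile) (e : E) (hx : x ≠ 0) :
    HasFDerivAt (zonalExt q e) (innerSL ℝ (zonalGrad q e x)) x := by
  have hx' : ‖x‖ ≠ 0 := norm_ne_zero_iff.2 hx
  refine ((hasFDerivAt_norm_of_ne_zero hx).mul
    ((q.hasDerivAt (lat e x)).comp_hasFDerivAt x (hasFDerivAt_lat e hx))).congr_fderiv ?_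
  ext v
  simp only [perp, map_sub, map_smul, Function.comp_apply, add_apply, smul_apply, sub_apply,
    coe_innerSL_apply, smul_eq_mul, zonalGrad, Profile.tan, map_add]
  field_simp
  ring

lemma hasFDerivAt_zonalGrad (q : Profile) (e : E) (hx : x ≠ 0) :
    HasFDerivAt (zonalGrad q e) (zonalHess q e x) x := by
  have hlat := hasFDerivAt_lat e hx
  have htan := (q.hasDerivAt_tan (lat e x)).comp_hasFDerivAt x hlat
  have hd1 := (q.hasDerivAt_d1 (lat e x)).comp_hasFDerivAt x hlat
  refine ((htan.smul (hasFDerivAt_dir hx)).add (hd1.smul_const e)).congr_fderiv ?_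
  ext1 v
  simp only [zonalHess, rankTwo_apply, add_apply, smul_apply,
    ContinuousLinearMap.smulRight_apply, Function.comp, innerSL_apply_apply, smul_eq_mul,
    inner_zero_left]
  generalize ⟪perp e x, v⟫ = s
  rw [perp]
  module

lemma inner_zonalGrad_self (q : Profile) (e : E) (hx : x ≠ 0) :
    ⟪zonalGrad q e x, x⟫ = zonalExt q e x := by
  rw [zonalGrad, inner_add_left, real_inner_smul_left, real_inner_smul_left, inner_dir_self hx,
    ← norm_mul_lat e hx, zonalExt, Profile.tan]
  ring

lemma zonalGrad_smul (q : Profile) (e x : E) {c : ℝ} (hc : 0 < c) :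
    zonalGrad q e (c • x) = zonalGrad q e x := by
  rw [zonalGrad, zonalGrad, lat_smul hc, dir_smul hc]

lemma zonalExt_nonneg (hq : q.IsConvex) (he : ‖e‖ = 1) (hx : x ≠ 0) : 0 ≤ zonalExt q e x :=
  mul_nonneg (norm_nonneg x) (hq.nonneg _ (abs_lat_le_one he hx))

lemma inner_zonalHess (q : Profile) (e x v : E) :
    ⟪zonalHess q e x v, v⟫ = ‖x‖⁻¹ * (q.tan (lat e x) * (‖v‖ ^ 2 - ⟪dir x, v⟫ ^ 2)
      + q.d2 (lat e x) * ⟪perp e x, v⟫ ^ 2) := by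
  rw [zonalHess, rankTwo_apply, inner_add_left, inner_add_left, real_inner_smul_left,
    real_inner_smul_left, real_inner_smul_left, real_inner_self_eq_norm_sq]
  ring

lemma inner_perp_sq_le (he : ‖e‖ = 1) (hx : x ≠ 0) (v : E) :
    ⟪perp e x, v⟫ ^ 2 ≤ (1 - lat e x ^ 2) * (‖v‖ ^ 2 - ⟪dir x, v⟫ ^ 2) := by
  set u := dir x
  have hproj : ‖v - ⟪u, v⟫ • u‖ ^ 2 = ‖v‖ ^ 2 - ⟪u, v⟫ ^ 2 := by
    rw [norm_sub_sq_real, real_inner_smul_right, norm_smul, norm_dir hx, Real.norm_eq_abs,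
      mul_one, sq_abs, real_inner_comm]
    ring
  have hperp : ⟪perp e x, v⟫ = ⟪perp e x, v - ⟪u, v⟫ • u⟫ := by
    rw [inner_sub_right, real_inner_smul_right, real_inner_comm u, inner_dir_perp e hx, mul_zero,
      sub_zero]
  rw [← hproj, ← norm_perp_sq he hx, hperp, ← mul_pow, ← sq_abs]
  gcongr
  exact abs_real_inner_le_norm _ _

lemma inner_zonalHess_nonneg (hq : q.IsConvex) (he : ‖e‖ = 1) (hx : x ≠ 0) (v : E) :
    0 ≤ ⟪zonalHess q e x v, v⟫ := by
  have ht := abs_lat_le_one he hx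
  have htan := hq.tan_nonneg _ ht
  have hrad := hq.rad_nonneg _ ht
  have hperp := inner_perp_sq_le he hx v
  rw [Profile.rad] at hrad
  have : 0 ≤ 1 - lat e x ^ 2 := by
    rw [← norm_perp_sq he hx]
    positivity
  have hproj : 0 ≤ ‖v‖ ^ 2 - ⟪dir x, v⟫ ^ 2 := by
    rw [sub_nonneg, ← sq_abs ⟪dir x, v⟫]
    gcongr
    simpa [norm_dir hx] using abs_real_inner_le_norm (dir x) v
  rw [inner_zonalHess]
  refine mul_nonneg (inv_nonneg.2 (norm_nonneg x)) ?_
  rcases le_or_gt 0 (q.d2 (lat e x)) with hd2 | hd2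
  · positivity
  · nlinarith

lemma add_deriv_le_of_deriv2_nonneg {g g' g'' : ℝ → ℝ}
    (hg : ∀ τ ∈ Set.Icc (0 : ℝ) 1, HasDerivAt g (g' τ) τ)
    (hg' : ∀ τ ∈ Set.Icc (0 : ℝ) 1, HasDerivAt g' (g'' τ) τ)
    (hg'' : ∀ τ ∈ Set.Icc (0 : ℝ) 1, 0 ≤ g'' τ) : g 0 + g' 0 ≤ g 1 := by
  have hsub : interior (Set.Icc (0 : ℝ) 1) ⊆ Set.Icc 0 1 := interior_subset
  have hconv : ConvexOn ℝ (Set.Icc 0 1) g :=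
    convexOn_of_hasDerivWithinAt2_nonneg (convex_Icc 0 1)
      (fun τ hτ => (hg τ hτ).continuousAt.continuousWithinAt)
      (fun τ hτ => (hg τ (hsub hτ)).hasDerivWithinAt)
      (fun τ hτ => (hg' τ (hsub hτ)).hasDerivWithinAt) (fun τ hτ => hg'' τ (hsub hτ))
  have hzero : (0 : ℝ) ∈ Set.Icc (0 : ℝ) 1 := by simp
  have hslope := hconv.le_slope_of_hasDerivAt hzero (by simp) one_pos (hg 0 hzero)
  rw [slope_def_field, sub_zero, div_one] at hslope
  linarith

lemma inner_zonalGrad_le_of_segment (hq : q.IsConvex) (he : ‖e‖ = 1)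
    (h0 : ∀ τ ∈ Set.Icc (0 : ℝ) 1, AffineMap.lineMap (k := ℝ) x y τ ≠ 0) :
    ⟪zonalGrad q e x, y⟫ ≤ zonalExt q e y := by
  set γ : ℝ → E := ⇑(AffineMap.lineMap (k := ℝ) x y)
  have hγ (τ : ℝ) : HasDerivAt γ (y - x) τ := AffineMap.hasDerivAt_lineMap
  have hext : ∀ τ ∈ Set.Icc (0 : ℝ) 1,
      HasDerivAt (fun τ => zonalExt q e (γ τ)) ⟪zonalGrad q e (γ τ), y - x⟫ τ := fun τ hτ =>
    (hasFDerivAt_zonalExt q e (h0 τ hτ)).comp_hasDerivAt τ (hγ τ)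
  have hgrad : ∀ τ ∈ Set.Icc (0 : ℝ) 1, HasDerivAt (fun τ => ⟪zonalGrad q e (γ τ), y - x⟫)
      ⟪zonalHess q e (γ τ) (y - x), y - x⟫ τ := fun τ hτ => by
    simpa using ((hasFDerivAt_zonalGrad q e (h0 τ hτ)).comp_hasDerivAt τ (hγ τ)).inner ℝ
      (hasDerivAt_const τ (y - x))
  have htaylor := add_deriv_le_of_deriv2_nonneg hext hgrad
    fun τ hτ => inner_zonalHess_nonneg hq he (h0 τ hτ) _
  have hx : x ≠ 0 := by simpa [γ] using h0 0 (by simp)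
  simp only [γ, AffineMap.lineMap_apply_zero, AffineMap.lineMap_apply_one, inner_sub_right,
    inner_zonalGrad_self q e hx] at htaylor
  linarith

lemma exists_eq_neg_smul_of_lineMap_eq_zero (hx : x ≠ 0) {τ : ℝ} (hτ : τ ∈ Set.Icc (0 : ℝ) 1)
    (h : AffineMap.lineMap (k := ℝ) x y τ = 0) : ∃ c : ℝ, 0 ≤ c ∧ y = -(c • x) := by
  have hτ0 : τ ≠ 0 := by
    rintro rfl
    exact hx (by simpa using h)
  rw [AffineMap.lineMap_apply_module] at h
  refine ⟨(1 - τ) / τ, div_nonneg (sub_nonneg.2 hτ.2) hτ.1, ?_⟩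
  rw [← inv_smul_smul₀ hτ0 y, eq_neg_of_add_eq_zero_right h, smul_neg, smul_smul, inv_mul_eq_div]

lemma inner_zonalGrad_le (hq : q.IsConvex) (he : ‖e‖ = 1) (hx : x ≠ 0) (hy : y ≠ 0) :
    ⟪zonalGrad q e x, y⟫ ≤ zonalExt q e y := by
  by_cases! h0 : ∀ τ ∈ Set.Icc (0 : ℝ) 1, AffineMap.lineMap (k := ℝ) x y τ ≠ 0
  · exact inner_zonalGrad_le_of_segment hq he h0
  obtain ⟨τ, hτ, h⟩ := h0
  obtain ⟨c, hc, hyc⟩ := exists_eq_neg_smul_of_lineMap_eq_zero hx hτ h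
  have hext := zonalExt_nonneg hq he hx
  calc ⟪zonalGrad q e x, y⟫ = -(c * zonalExt q e x) := by
        rw [hyc, inner_neg_right, real_inner_smul_right, inner_zonalGrad_self q e hx]
    _ ≤ 0 := neg_nonpos.2 (by positivity)
    _ ≤ zonalExt q e y := zonalExt_nonneg hq he hy

lemma inner_zonalGrad_sub_nonneg (hq : q.IsConvex) (he : ‖e‖ = 1) (hx : x ≠ 0) (hy : y ≠ 0) :
    0 ≤ ⟪zonalGrad q e x - zonalGrad q e y, x - y⟫ := by
  have hxy := inner_zonalGrad_le hq he hx hy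
  have hyx := inner_zonalGrad_le hq he hy hx
  rw [← inner_zonalGrad_self q e hy] at hxy
  rw [← inner_zonalGrad_self q e hx] at hyx
  rw [inner_sub_left, inner_sub_right, inner_sub_right]
  linarith

end ZonalExtension

section ParallelSets

lemma infDist_add_smul_eq_iff {E : Type*} [NormedAddCommGroup E] [InnerProductSpace ℝ E]
    {K : Set E} (hK : Convex ℝ K) {p u : E} (hp : p ∈ K) (hu : ‖u‖ = 1) {s : ℝ} (hs : 0 < s) :
    Metric.infDist (p + s • u) K = s ↔ ∀ z ∈ K, ⟪u, z⟫ ≤ ⟪u, p⟫ := by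
  have hnorm : ‖s • u‖ = s := by rw [norm_smul, hu, mul_one, Real.norm_of_nonneg hs.le]
  have hproj := norm_eq_iInf_iff_real_inner_le_zero hK (u := p + s • u) hp
  simp only [add_sub_cancel_left, hnorm, real_inner_smul_left, inner_sub_right,
    sub_nonpos, mul_le_mul_iff_right₀ hs] at hproj
  rw [← hproj, Metric.infDist_eq_iInf, eq_comm]
  simp only [dist_eq_norm]

/-- The truncated cone over a subset of the sphere. -/
def truncCone (t : ℝ) (A : Set (Sph n)) : Set (Euc n) :=
  {y | ∃ u ∈ A, ∃ s : ℝ, 0 < s ∧ s ≤ t ∧ y = s • (u : Euc n)}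

lemma ne_zero_of_mem_truncCone {t : ℝ} {A : Set (Sph n)} {y : Euc n} (hy : y ∈ truncCone t A) :
    y ≠ 0 := by
  obtain ⟨u, -, s, hs, -, rfl⟩ := hy
  exact smul_ne_zero hs.ne' (sph_ne_zero u)

lemma truncCone_eq_image {t : ℝ} (ht : 0 < t) (A : Set (Sph n)) :
    truncCone t A = Subtype.val '' (homeomorphUnitSphereProd (Euc n) ⁻¹'
      (A ×ˢ Set.Iic (⟨t, ht⟩ : Set.Ioi (0 : ℝ)))) := by
  ext y
  constructor
  · rintro ⟨u, hu, s, hs, hst, rfl⟩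
    refine ⟨(homeomorphUnitSphereProd (Euc n)).symm (u, ⟨s, hs⟩), ?_, by simp⟩
    rw [Set.mem_preimage, Homeomorph.apply_symm_apply]
    exact ⟨hu, hst⟩
  · rintro ⟨y, ⟨hdir, hnorm⟩, rfl⟩
    have hnorm' : (homeomorphUnitSphereProd (Euc n) y).2.1 ≤ t := hnorm
    refine ⟨_, hdir, ‖(y : Euc n)‖, norm_pos_iff.2 y.2, by simpa using hnorm', ?_⟩
    simpa [dir] using (norm_smul_dir (x := (y : Euc n)) y.2).symm

lemma measurableSet_truncCone {t : ℝ} (ht : 0 < t) {A : Set (Sph n)} (hA : MeasurableSet A) :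
    MeasurableSet (truncCone t A) := by
  rw [truncCone_eq_image ht]
  refine (MeasurableEmbedding.subtype_coe
    (measurableSet_singleton (0 : Euc n)).compl).measurableSet_image.2 ?_
  exact (homeomorphUnitSphereProd (Euc n)).measurable (hA.prod measurableSet_Iic)

end ParallelSets

section ZonalBodies

/-- The convex body of revolution with support function `u ↦ q ⟪e, u⟫`. -/
noncomputable def zonalBody (q : Profile) (hq : q.IsConvex) (e : Sph n) : ConvexBody (Euc n) where
  carrier := ⋂ u : Sph n, {z | ⟪(u : Euc n), z⟫ ≤ q ⟪(e : Euc n), (u : Euc n)⟫}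
  convex' := convex_iInter fun u => convex_halfSpace_le (innerₗ (Euc n) (u : Euc n)).isLinear _
  isCompact' := by
    refine Metric.isCompact_of_isClosed_isBounded
      (isClosed_iInter fun u => isClosed_le (by fun_prop) continuous_const) ?_
    obtain ⟨M, hM⟩ := (isCompact_Icc (a := (-1 : ℝ)) (b := 1)).exists_bound_of_continuousOn
      q.continuous.continuousOn
    have hqM (u : Sph n) : q ⟪(e : Euc n), (u : Euc n)⟫ ≤ M :=
      (le_abs_self _).trans (hM _ (abs_le.1 (abs_inner_sph_le_one e u)))
    refine isBounded_iff_forall_norm_le.2 ⟨M, fun z hz => ?_⟩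
    obtain rfl | hz0 := eq_or_ne z 0
    · rw [norm_zero]
      exact (hq.nonneg _ (abs_inner_sph_le_one e e)).trans (hqM e)
    · rw [← inner_dir_self hz0]
      exact (Set.mem_iInter.1 hz ⟨dir z, mem_sphere_zero_iff_norm.2 (norm_dir hz0)⟩).trans (hqM _)
  nonempty' := ⟨0, Set.mem_iInter.2 fun u => by
    rw [Set.mem_ofPred_eq, inner_zero_right]
    exact hq.nonneg _ (abs_inner_sph_le_one e u)⟩

variable {q : Profile} (hq : q.IsConvex) (e : Sph n)

lemma mem_zonalBody {z : Euc n} :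
    z ∈ zonalBody q hq e ↔ ∀ u : Sph n, ⟪(u : Euc n), z⟫ ≤ q ⟪(e : Euc n), (u : Euc n)⟫ :=
  Set.mem_iInter

lemma inner_le_zonalExt {z : Euc n} (hz : z ∈ zonalBody q hq e) {x : Euc n} (hx : x ≠ 0) :
    ⟪z, x⟫ ≤ zonalExt q (e : Euc n) x := by
  have hdir := (mem_zonalBody hq e).1 hz ⟨dir x, mem_sphere_zero_iff_norm.2 (norm_dir hx)⟩
  rw [real_inner_comm] at hdir
  rw [← norm_mul_lat z hx]
  exact mul_le_mul_of_nonneg_left hdir (norm_nonneg x)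

lemma zonalGrad_mem_zonalBody {x : Euc n} (hx : x ≠ 0) :
    zonalGrad q (e : Euc n) x ∈ zonalBody q hq e := by
  refine (mem_zonalBody hq e).2 fun u => ?_
  rw [real_inner_comm, ← zonalExt_of_norm_eq_one q (e : Euc n) (norm_eq_of_mem_sphere u)]
  exact inner_zonalGrad_le hq (norm_eq_of_mem_sphere e) hx (sph_ne_zero u)

lemma supp_zonalBody (u : Sph n) :
    supp (zonalBody q hq e) (u : Euc n) = q ⟪(e : Euc n), (u : Euc n)⟫ := by
  refine IsGreatest.csSup_eq ⟨⟨zonalGrad q (e : Euc n) u,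
    zonalGrad_mem_zonalBody hq e (sph_ne_zero u), ?_⟩, ?_⟩
  · dsimp only
    rw [real_inner_comm, inner_zonalGrad_self q _ (sph_ne_zero u),
      zonalExt_of_norm_eq_one q _ (norm_eq_of_mem_sphere u)]
  · rintro _ ⟨z, hz, rfl⟩
    exact (mem_zonalBody hq e).1 hz u

lemma eq_zonalGrad_of_inner_eq {z : Euc n} (hz : z ∈ zonalBody q hq e) {x : Euc n} (hx : x ≠ 0)
    (h : ⟪z, x⟫ = zonalExt q (e : Euc n) x) : z = zonalGrad q (e : Euc n) x := by
  have hmin : IsLocalMin (fun y => zonalExt q (e : Euc n) y - ⟪z, y⟫) x := by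
    filter_upwards [isOpen_ne.mem_nhds hx] with y hy
    rw [h, sub_self, sub_nonneg]
    exact inner_le_zonalExt hq e hz hy
  have hzero := hmin.hasFDerivAt_eq_zero
    ((hasFDerivAt_zonalExt q (e : Euc n) hx).sub (innerSL ℝ z).hasFDerivAt)
  exact (innerSL_inj.1 (sub_eq_zero.1 hzero)).symm

lemma forall_inner_le_inner_iff_eq_zonalGrad {p : Euc n} (hp : p ∈ zonalBody q hq e) (u : Sph n) :
    (∀ z ∈ zonalBody q hq e, ⟪(u : Euc n), z⟫ ≤ ⟪(u : Euc n), p⟫)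
      ↔ p = zonalGrad q (e : Euc n) u := by
  have hu := sph_ne_zero u
  simp only [real_inner_comm _ (u : Euc n)]
  constructor
  · refine fun hmax => eq_zonalGrad_of_inner_eq hq e hp hu (le_antisymm
      (inner_le_zonalExt hq e hp hu) ?_)
    rw [← inner_zonalGrad_self q _ hu]
    exact hmax _ (zonalGrad_mem_zonalBody hq e hu)
  · rintro rfl z hz
    rw [inner_zonalGrad_self q _ hu]
    exact inner_le_zonalExt hq e hz hu

lemma localParallelSet_zonalBody (t : ℝ) (A : Set (Sph n)) :
    localParallelSet (zonalBody q hq e) t A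
      = (fun y => y + zonalGrad q (e : Euc n) y) '' truncCone t A := by
  have hnearest {p : Euc n} (hp : p ∈ zonalBody q hq e) (u : Sph n) {s : ℝ} (hs : 0 < s) :
      Metric.infDist (p + s • (u : Euc n)) (zonalBody q hq e) = s
        ↔ p = zonalGrad q (e : Euc n) u :=
    (infDist_add_smul_eq_iff (zonalBody q hq e).convex hp (norm_eq_of_mem_sphere u) hs).trans
      (forall_inner_le_inner_iff_eq_zonalGrad hq e hp u)
  ext x
  constructor
  · rintro ⟨p, hp, u, hu, s, hs, hst, rfl, hdist⟩
    refine ⟨s • (u : Euc n), ⟨u, hu, s, hs, hst, rfl⟩, ?_⟩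
    dsimp only
    rw [zonalGrad_smul q _ _ hs, ← (hnearest hp u hs).1 hdist, add_comm]
  · rintro ⟨_, ⟨u, hu, s, hs, hst, rfl⟩, rfl⟩
    have hmem := zonalGrad_mem_zonalBody hq e (sph_ne_zero u)
    dsimp only
    rw [zonalGrad_smul q _ _ hs, add_comm]
    exact ⟨_, hmem, u, hu, s, hs, hst, rfl, (hnearest hmem u hs).2 rfl⟩

include hq in
lemma injOn_add_zonalGrad : Set.InjOn (fun y => y + zonalGrad q (e : Euc n) y) {0}ᶜ := by
  intro x hx y hy (h : x + zonalGrad q (e : Euc n) x = y + zonalGrad q (e : Euc n) y)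
  have hmono := inner_zonalGrad_sub_nonneg hq (norm_eq_of_mem_sphere e) hx hy
  have hsub : zonalGrad q (e : Euc n) x - zonalGrad q (e : Euc n) y = -(x - y) := by
    rw [neg_sub, sub_eq_sub_iff_add_eq_add, add_comm, h, add_comm]
  rw [hsub, inner_neg_left, real_inner_self_eq_norm_sq, neg_nonneg] at hmono
  exact sub_eq_zero.1 (norm_eq_zero.1 (pow_eq_zero_iff two_ne_zero |>.1
    (le_antisymm hmono (sq_nonneg _))))

include hq in
lemma det_id_add_zonalHess (hn : 2 ≤ n) {x : Euc n} (hx : x ≠ 0) :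
    (ContinuousLinearMap.id ℝ (Euc n) + zonalHess q (e : Euc n) x).det
      = (1 + ‖x‖⁻¹ * q.tan (lat (e : Euc n) x)) ^ (n - 2)
        * (1 + ‖x‖⁻¹ * q.rad (lat (e : Euc n) x)) := by
  have he := norm_eq_of_mem_sphere e
  set t := lat (e : Euc n) x
  have htan := hq.tan_nonneg t (abs_lat_le_one he hx)
  have hrank : ContinuousLinearMap.id ℝ (Euc n) + zonalHess q (e : Euc n) x
      = rankTwo (1 + ‖x‖⁻¹ * q.tan t) (-(‖x‖⁻¹ * q.tan t)) (‖x‖⁻¹ * q.d2 t)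
        (dir x) (perp (e : Euc n) x) := by
    ext1 v
    rw [add_apply, zonalHess, rankTwo_apply, rankTwo_apply, ContinuousLinearMap.id_apply]
    module
  rw [hrank, det_rankTwo (by simpa using hn) (by positivity) (inner_dir_perp _ hx), norm_dir hx,
    norm_perp_sq he hx, finrank_euclideanSpace_fin, Profile.rad]
  ring

end ZonalBodies

section AreaMeasures

/-- The `j`-th elementary symmetric function of `m` numbers equal to `a` and one number `b`. -/
def esymmRadii (m : ℕ) : ℕ → ℝ → ℝ → ℝ
  | 0, _, _ => 1
  | j + 1, a, b => m.choose (j + 1) * a ^ (j + 1) + m.choose j * b * a ^ j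

lemma esymmRadii_nonneg (m j : ℕ) {a b : ℝ} (ha : 0 ≤ a) (hb : 0 ≤ b) :
    0 ≤ esymmRadii m j a b := by
  cases j <;> simp only [esymmRadii] <;> positivity

lemma continuous_esymmRadii (m j : ℕ) : Continuous fun p : ℝ × ℝ => esymmRadii m j p.1 p.2 := by
  cases j <;> simp only [esymmRadii] <;> fun_prop

lemma sum_esymmRadii_mul_pow (m : ℕ) (a b s : ℝ) :
    ∑ j ∈ Finset.range (m + 2), esymmRadii m j a b * s ^ (m + 1 - j) = (s + a) ^ m * (s + b) := by
  have hpow : ∑ j ∈ Finset.range (m + 1), (m.choose j : ℝ) * a ^ j * s ^ (m - j)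
      = (s + a) ^ m := by
    rw [add_comm s a, add_pow]
    exact Finset.sum_congr rfl fun j _ => by ring
  have hmul : ∑ j ∈ Finset.range (m + 2), (m.choose j : ℝ) * a ^ j * s ^ (m + 1 - j)
      = s * (s + a) ^ m := by
    rw [Finset.sum_range_succ, Nat.choose_succ_self, Nat.cast_zero, zero_mul, zero_mul, add_zero,
      ← hpow, Finset.mul_sum]
    refine Finset.sum_congr rfl fun j hj => ?_
    rw [Nat.succ_sub (Finset.mem_range_succ_iff.1 hj), pow_succ]
    ring
  have hb : ∑ j ∈ Finset.range (m + 1), (m.choose j : ℝ) * b * a ^ j * s ^ (m - j)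
      = b * (s + a) ^ m := by
    rw [← hpow, Finset.mul_sum]
    exact Finset.sum_congr rfl fun j _ => by ring
  rw [Finset.sum_range_succ'] at hmul ⊢
  simp only [esymmRadii, Nat.add_sub_add_right, add_mul, Finset.sum_add_distrib, hb,
    Nat.choose_zero_right, Nat.cast_one, pow_zero, one_mul] at hmul ⊢
  linear_combination hmul

lemma integral_add_pow_mul_add (m : ℕ) (a b t : ℝ) :
    ∫ s in (0 : ℝ)..t, (s + a) ^ m * (s + b) = ∑ j ∈ Finset.range (m + 2),
      esymmRadii m j a b * (t ^ (m + 2 - j) / ((m + 2 - j : ℕ) : ℝ)) := by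
  simp only [← sum_esymmRadii_mul_pow]
  rw [intervalIntegral.integral_finsetSum fun j _ =>
    (by fun_prop : Continuous fun s : ℝ =>
      esymmRadii m j a b * s ^ (m + 1 - j)).intervalIntegrable _ _]
  refine Finset.sum_congr rfl fun j hj => ?_
  rw [intervalIntegral.integral_const_mul, integral_pow, zero_pow (by omega), sub_zero,
    ← Nat.cast_succ, Nat.succ_sub (Finset.mem_range_succ_iff.1 hj)]

lemma lintegral_pow_mul_one_add_inv_mul {m : ℕ} {a b t : ℝ} (ha : 0 ≤ a) (hb : 0 ≤ b)
    (ht : 0 ≤ t) :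
    ∫⁻ s in Set.Ioc 0 t, ENNReal.ofReal (s ^ (m + 1))
        * ENNReal.ofReal ((1 + s⁻¹ * a) ^ m * (1 + s⁻¹ * b))
      = ENNReal.ofReal (∑ j ∈ Finset.range (m + 2),
          esymmRadii m j a b * (t ^ (m + 2 - j) / ((m + 2 - j : ℕ) : ℝ))) := by
  have hintegrand : ∀ s ∈ Set.Ioc 0 t, ENNReal.ofReal (s ^ (m + 1))
      * ENNReal.ofReal ((1 + s⁻¹ * a) ^ m * (1 + s⁻¹ * b))
      = ENNReal.ofReal ((s + a) ^ m * (s + b)) := fun s hs => by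
    have hs0 := hs.1
    have hadd (c : ℝ) : s + c = s * (1 + s⁻¹ * c) := by field_simp
    rw [← ENNReal.ofReal_mul (by positivity), hadd a, hadd b, mul_pow]
    ring_nf
  rw [setLIntegral_congr_fun measurableSet_Ioc hintegrand, ← integral_add_pow_mul_add,
    intervalIntegral.integral_of_le ht, ofReal_integral_eq_lintegral_ofReal]
  · exact (by fun_prop : Continuous fun s : ℝ => (s + a) ^ m * (s + b)).integrableOn_Ioc
  · filter_upwards [ae_restrict_mem measurableSet_Ioc] with s hs
    have := hs.1
    positivity

lemma setLIntegral_Iic_volumeIoiPow (k : ℕ) {t : ℝ} (ht : 0 < t) {f : ℝ → ENNReal}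
    (hf : Measurable f) :
    ∫⁻ s : Set.Ioi (0 : ℝ) in Set.Iic ⟨t, ht⟩, f s ∂(Measure.volumeIoiPow k)
      = ∫⁻ s in Set.Ioc 0 t, ENNReal.ofReal (s ^ k) * f s := by
  have himage : (Subtype.val '' Set.Iic (⟨t, ht⟩ : Set.Ioi (0 : ℝ)) : Set ℝ) = Set.Ioc 0 t := by
    ext x
    constructor
    · rintro ⟨y, hy, rfl⟩
      exact ⟨y.2, hy⟩
    · rintro ⟨hx0, hxt⟩
      exact ⟨⟨x, hx0⟩, hxt, rfl⟩
  rw [Measure.volumeIoiPow, setLIntegral_withDensity_eq_setLIntegral_mul _ (by fun_prop)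
    (by fun_prop) measurableSet_Iic, ← himage, ← setLIntegral_subtype measurableSet_Ioi _
    fun s : ℝ => ENNReal.ofReal (s ^ k) * f s]
  rfl

lemma setLIntegral_truncCone {t : ℝ} (ht : 0 < t) (A : Set (Sph n)) {g : Euc n → ENNReal}
    (hg : Measurable g) :
    ∫⁻ y in truncCone t A, g y = ∫⁻ u in A, (∫⁻ s in Set.Ioc 0 t,
      ENNReal.ofReal (s ^ (n - 1)) * g (s • (u : Euc n))) ∂surf n := by
  have hpolar : ∀ y : ({0}ᶜ : Set (Euc n)), g y
      = (fun p : Sph n × Set.Ioi (0 : ℝ) => g ((p.2 : ℝ) • (p.1 : Euc n)))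
        (homeomorphUnitSphereProd (Euc n) y) := fun y => by
    simpa [dir] using congrArg g (norm_smul_dir (x := (y : Euc n)) y.2).symm
  have hcone := (measurableSet_singleton (0 : Euc n)).compl
  rw [truncCone_eq_image ht, ← setLIntegral_subtype hcone, lintegral_congr hpolar,
    (Measure.measurePreserving_homeomorphUnitSphereProd
      (volume : Measure (Euc n))).setLIntegral_comp_preimage_emb
      (homeomorphUnitSphereProd _).measurableEmbedding
      (fun p : Sph n × Set.Ioi (0 : ℝ) => g ((p.2 : ℝ) • (p.1 : Euc n))),
    ← Measure.prod_restrict, lintegral_prod _ (by fun_prop), finrank_euclideanSpace_fin]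
  exact lintegral_congr fun u =>
    setLIntegral_Iic_volumeIoiPow (n - 1) ht (f := fun s => g (s • (u : Euc n))) (by fun_prop)

variable {q : Profile} (hq : q.IsConvex) (e : Sph n)

lemma measurable_lat (x : Euc n) : Measurable (lat x) := by
  unfold lat dir
  fun_prop

lemma volume_localParallelSet_zonalBody_eq_setLIntegral (hn : 2 ≤ n) {t : ℝ} (ht : 0 < t)
    {A : Set (Sph n)} (hA : MeasurableSet A) :
    volume (localParallelSet (zonalBody q hq e) t A)
      = ∫⁻ y in truncCone t A, ENNReal.ofReal ((1 + ‖y‖⁻¹ * q.tan (lat (e : Euc n) y)) ^ (n - 2)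
        * (1 + ‖y‖⁻¹ * q.rad (lat (e : Euc n) y))) := by
  have hmeas := measurableSet_truncCone ht hA
  rw [localParallelSet_zonalBody, ← lintegral_abs_det_fderiv_eq_addHaar_image volume hmeas
    (f := fun y => y + zonalGrad q (e : Euc n) y)
    (f' := fun y => ContinuousLinearMap.id ℝ _ + zonalHess q (e : Euc n) y)
    (fun y hy => ((hasFDerivAt_id y).add
      (hasFDerivAt_zonalGrad q _ (ne_zero_of_mem_truncCone hy))).hasFDerivWithinAt)
    ((injOn_add_zonalGrad hq e).mono fun y hy => ne_zero_of_mem_truncCone hy)]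
  refine setLIntegral_congr_fun hmeas fun y hy => ?_
  have hy0 := ne_zero_of_mem_truncCone hy
  have hlat := abs_lat_le_one (norm_eq_of_mem_sphere e) hy0
  have := hq.tan_nonneg _ hlat
  have := hq.rad_nonneg _ hlat
  rw [det_id_add_zonalHess hq e hn hy0, abs_of_nonneg (by positivity)]

/-- The `j`-th elementary symmetric function of the `n - 1` principal radii of curvature of the
body of revolution with support function `u ↦ q ⟪e, u⟫`. -/
noncomputable def Profile.curv (q : Profile) (n j : ℕ) (t : ℝ) : ℝ :=
  esymmRadii (n - 2) j (q.tan t) (q.rad t)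

@[fun_prop]
lemma Profile.continuous_curv (q : Profile) (n j : ℕ) : Continuous (q.curv n j) :=
  (continuous_esymmRadii (n - 2) j).comp (q.continuous_tan.prodMk q.continuous_rad)

lemma Profile.IsConvex.curv_nonneg {q : Profile} (hq : q.IsConvex) (n j : ℕ) {t : ℝ}
    (ht : |t| ≤ 1) : 0 ≤ q.curv n j t :=
  esymmRadii_nonneg _ _ (hq.tan_nonneg t ht) (hq.rad_nonneg t ht)

lemma volume_localParallelSet_zonalBody (hn : 2 ≤ n) {t : ℝ} (ht : 0 < t) {A : Set (Sph n)}
    (hA : MeasurableSet A) :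
    volume (localParallelSet (zonalBody q hq e) t A)
      = ∫⁻ u in A, ENNReal.ofReal (∑ j ∈ Finset.range n,
          q.curv n j ⟪(e : Euc n), (u : Euc n)⟫ * (t ^ (n - j) / ((n - j : ℕ) : ℝ))) ∂surf n := by
  have hlat := measurable_lat (e : Euc n)
  rw [volume_localParallelSet_zonalBody_eq_setLIntegral hq e hn ht hA,
    setLIntegral_truncCone ht A (by fun_prop)]
  refine lintegral_congr fun u => ?_
  obtain ⟨m, rfl⟩ := Nat.exists_eq_add_of_le' hn
  have hu := abs_inner_sph_le_one e u
  refine (setLIntegral_congr_fun measurableSet_Ioc fun s hs => ?_).trans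
    (lintegral_pow_mul_one_add_inv_mul (hq.tan_nonneg _ hu) (hq.rad_nonneg _ hu) ht.le)
  rw [lat_smul hs.1, lat_of_norm_eq_one _ (norm_eq_of_mem_sphere u), norm_smul,
    norm_eq_of_mem_sphere, mul_one, Real.norm_of_nonneg hs.1.le]
  rfl

end AreaMeasures

section AreaMeasuresExistence

/-- The normalizing constant of the `j`-th area measure. -/
noncomputable def areaConst (n j : ℕ) : ℝ := n / (((n - j : ℕ) : ℝ) * n.choose j)

lemma areaConst_pos {j : ℕ} (hj : j < n) : 0 < areaConst n j := by
  have hn : 0 < n := by omega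
  have hsub : 0 < n - j := by omega
  have := Nat.choose_pos hj.le
  unfold areaConst
  positivity

/-- The `j`-th area measure of the body of revolution with profile `q`, through its density. -/
noncomputable def zonalArea (q : Profile) (e : Sph n) (j : ℕ) : Measure (Sph n) :=
  (surf n).withDensity fun u =>
    ENNReal.ofReal (areaConst n j * q.curv n j ⟪(e : Euc n), (u : Euc n)⟫)

variable {q : Profile} (hq : q.IsConvex) (e : Sph n)

lemma choose_mul_pow_mul_zonalArea (q : Profile) (e : Sph n) {j : ℕ} (hj : j < n) {t : ℝ}
    (ht : 0 ≤ t) {A : Set (Sph n)} (hA : MeasurableSet A) :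
    (n.choose j : ENNReal) * ENNReal.ofReal (t ^ (n - j)) * zonalArea q e j A
      = n * ∫⁻ u in A, ENNReal.ofReal (q.curv n j ⟪(e : Euc n), (u : Euc n)⟫
          * (t ^ (n - j) / ((n - j : ℕ) : ℝ))) ∂surf n := by
  rw [zonalArea, withDensity_apply _ hA, ← lintegral_const_mul _ (by fun_prop),
    ← lintegral_const_mul _ (by fun_prop)]
  refine lintegral_congr fun u => ?_
  have : ((n - j : ℕ) : ℝ) ≠ 0 := Nat.cast_ne_zero.2 (by omega)
  have : (n.choose j : ℝ) ≠ 0 := Nat.cast_ne_zero.2 (Nat.choose_pos hj.le).ne'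
  rw [← ENNReal.ofReal_natCast n, ← ENNReal.ofReal_natCast (n.choose j),
    ← ENNReal.ofReal_mul (by positivity), ← ENNReal.ofReal_mul (by positivity),
    ← ENNReal.ofReal_mul (by positivity), areaConst]
  field_simp

lemma isAreaMeasures_zonalArea (hn : 2 ≤ n) :
    IsAreaMeasures (zonalBody q hq e) (zonalArea q e) where
  finite j := isFiniteMeasure_withDensity_ofReal
    (integrable_of_continuous (surf n) (by fun_prop)).hasFiniteIntegral
  steiner t ht A hA := by
    have hsum (u : Sph n) : ENNReal.ofReal (∑ j ∈ Finset.range n,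
        q.curv n j ⟪(e : Euc n), (u : Euc n)⟫ * (t ^ (n - j) / ((n - j : ℕ) : ℝ)))
        = ∑ j ∈ Finset.range n, ENNReal.ofReal (q.curv n j ⟪(e : Euc n), (u : Euc n)⟫
            * (t ^ (n - j) / ((n - j : ℕ) : ℝ))) :=
      ENNReal.ofReal_sum_of_nonneg fun j _ =>
        mul_nonneg (hq.curv_nonneg n j (abs_inner_sph_le_one e u)) (by positivity)
    simp only [volume_localParallelSet_zonalBody hq e hn ht hA, hsum]
    rw [lintegral_finsetSum _ fun j _ => by fun_prop, Finset.mul_sum]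
    exact Finset.sum_congr rfl fun j hj =>
      (choose_mul_pow_mul_zonalArea q e (Finset.mem_range.1 hj) ht.le hA).symm

lemma eq_of_sum_mul_pow_eq {a b : ℕ → ℝ}
    (h : ∀ t : ℝ, 0 < t → ∑ j ∈ Finset.range n, a j * t ^ (n - j)
      = ∑ j ∈ Finset.range n, b j * t ^ (n - j)) {j : ℕ} (hj : j < n) : a j = b j := by
  let p (c : ℕ → ℝ) : Polynomial ℝ := ∑ j ∈ Finset.range n, Polynomial.monomial (n - j) (c j)
  have hcoeff (c : ℕ → ℝ) : (p c).coeff (n - j) = c j := by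
    rw [Polynomial.finsetSum_coeff, Finset.sum_eq_single_of_mem j (Finset.mem_range.2 hj),
      Polynomial.coeff_monomial_same]
    intro i hi hij
    have := Finset.mem_range.1 hi
    exact Polynomial.coeff_monomial_of_ne _ (by omega)
  have hp : p a = p b := by
    refine Polynomial.eq_of_infinite_eval_eq _ _ ((Set.Ioi_infinite (0 : ℝ)).mono fun t ht => ?_)
    simpa [p, Polynomial.eval_finsetSum] using h t ht
  rw [← hcoeff a, hp, hcoeff b]

lemma IsAreaMeasures.toReal_steiner {K : ConvexBody (Euc n)} {S : ℕ → Measure (Sph n)}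
    (hS : IsAreaMeasures K S) {A : Set (Sph n)} (hA : MeasurableSet A) {t : ℝ} (ht : 0 < t) :
    ((n : ENNReal) * volume (localParallelSet K t A)).toReal
      = ∑ j ∈ Finset.range n, (n.choose j * (S j A).toReal) * t ^ (n - j) := by
  have hfin := hS.finite
  rw [hS.steiner t ht A hA, ENNReal.toReal_sum fun j _ => by finiteness]
  refine Finset.sum_congr rfl fun j _ => ?_
  rw [ENNReal.toReal_mul, ENNReal.toReal_mul, ENNReal.toReal_natCast,
    ENNReal.toReal_ofReal (by positivity)]
  ring

lemma IsAreaMeasures.unique {K : ConvexBody (Euc n)} {S S' : ℕ → Measure (Sph n)}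
    (hS : IsAreaMeasures K S) (hS' : IsAreaMeasures K S') {j : ℕ} (hj : j < n) : S j = S' j := by
  refine Measure.ext fun A hA => ?_
  have := hS.finite j
  have := hS'.finite j
  have hcoeff := eq_of_sum_mul_pow_eq
    (fun t ht => (hS.toReal_steiner hA ht).symm.trans (hS'.toReal_steiner hA ht)) hj
  have hchoose : (n.choose j : ℝ) ≠ 0 := Nat.cast_ne_zero.2 (Nat.choose_pos hj.le).ne'
  exact (ENNReal.toReal_eq_toReal_iff' (measure_ne_top _ _) (measure_ne_top _ _)).1
    (mul_left_cancel₀ hchoose hcoeff)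

lemma areaMeasure_zonalBody (hn : 2 ≤ n) {i : ℕ} (hi : i < n) :
    areaMeasure (zonalBody q hq e) i = zonalArea q e i := by
  have hzonal := isAreaMeasures_zonalArea hq e hn
  have hex : ∃ S, IsAreaMeasures (zonalBody q hq e) S := ⟨_, hzonal⟩
  rw [areaMeasure, dif_pos hex]
  exact hex.choose_spec.unique hzonal hi

lemma integral_areaMeasure_zonalBody (hn : 2 ≤ n) {i : ℕ} (hi : i < n) (g : Sph n → ℝ) :
    ∫ u, g u ∂areaMeasure (zonalBody q hq e) i
      = areaConst n i * ∫ u, q.curv n i ⟪(e : Euc n), (u : Euc n)⟫ * g u ∂surf n := by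
  rw [areaMeasure_zonalBody hq e hn hi, zonalArea, integral_withDensity_eq_integral_toReal_smul
    (by fun_prop) (Eventually.of_forall fun _ => ENNReal.ofReal_lt_top), ← integral_const_mul]
  refine integral_congr_ae (Eventually.of_forall fun u => ?_)
  dsimp only
  rw [smul_eq_mul, ENNReal.toReal_ofReal (mul_nonneg (areaConst_pos hi).le
    (hq.curv_nonneg n i (abs_inner_sph_le_one e u))), mul_assoc]

end AreaMeasuresExistence

/-! ### Convolution with zonal functions -/

section ZonalConvolution

lemma exists_rotSph_eq (hn : 3 ≤ n) (e u : Sph n) :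
    ∃ θ : Euc n ≃ₗᵢ[ℝ] Euc n, IsRotation θ ∧ rotSph θ e = u := by
  obtain ⟨θ, hθ, hθe, -⟩ := exists_isRotation_apply_eq hn (a := (e : Euc n)) (b := u) (x := 0)
    (by simp only [norm_eq_of_mem_sphere]) (by simp only [inner_zero_right])
  exact ⟨θ, hθ, Subtype.ext hθe⟩

lemma sphConv_zonal (hn : 3 ≤ n) (e : Sph n) (g : ℝ → ℝ) {f : Sph n → ℝ} (hf : ZonalFun e f)
    (u : Sph n) :
    sphConv e (fun v => g ⟪(e : Euc n), (v : Euc n)⟫) f u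
      = ∫ v, g ⟪(u : Euc n), (v : Euc n)⟫ * f v ∂(surf n) := by
  have hex := exists_rotSph_eq hn e u
  rw [sphConv, dif_pos hex]
  set θ := hex.choose
  have hθe : θ (e : Euc n) = u := congrArg Subtype.val hex.choose_spec.2
  -- `g ⟪e, θ v⟫ = g ⟪θ⁻¹ e, v⟫`, and a rotation `η` about `e` moves `θ⁻¹ e` to `u = θ e`.
  obtain ⟨η, hη, hηa, hηe⟩ := exists_isRotation_apply_eq hn (a := θ.symm (e : Euc n)) (b := u)
    (x := e) (by simp only [θ.symm.norm_map, norm_eq_of_mem_sphere])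
    (by rw [← θ.inner_map_map, θ.apply_symm_apply, hθe, real_inner_comm])
  rw [← integral_comp_rotSph η fun v => g ⟪(u : Euc n), (v : Euc n)⟫ * f v]
  refine integral_congr_ae ?_
  filter_upwards [hf η hη (Subtype.ext hηe)] with v hv
  have hinner : ⟪(e : Euc n), (rotSph θ v : Euc n)⟫ = ⟪(u : Euc n), (rotSph η v : Euc n)⟫ := by
    change ⟪(e : Euc n), θ v⟫ = ⟪(u : Euc n), η v⟫
    rw [← hηa, η.inner_map_map, ← θ.inner_map_map (θ.symm _), θ.apply_symm_apply]
  rw [hv, hinner]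

lemma homExt_zonal (e : Sph n) (g : ℝ → ℝ) {x : Euc n} (hx : x ≠ 0) :
    homExt (fun u : Sph n => g ⟪(e : Euc n), (u : Euc n)⟫) x = g (lat (e : Euc n) x) :=
  dif_pos hx

lemma contDiffAt_lat (e : Euc n) {x : Euc n} (hx : x ≠ 0) {m : WithTop ℕ∞} :
    ContDiffAt ℝ m (lat e) x :=
  contDiffAt_const.inner ℝ
    (((contDiffAt_norm ℝ hx).inv (norm_ne_zero_iff.2 hx)).smul contDiffAt_id)

lemma smoothSph_zonal (e : Sph n) {g : ℝ → ℝ} (hg : ContDiff ℝ ∞ g) :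
    SmoothSph fun u : Sph n => g ⟪(e : Euc n), (u : Euc n)⟫ := by
  have hsmooth : ContDiffOn ℝ ∞ (fun x => g (lat (e : Euc n) x)) {0}ᶜ := fun x hx =>
    (hg.contDiffAt.comp x (contDiffAt_lat (e : Euc n) hx)).contDiffWithinAt
  exact hsmooth.congr fun x hx => homExt_zonal e g hx

end ZonalConvolution

section SupportFunctions

lemma bddAbove_inner_image (K : ConvexBody (Euc n)) (x : Euc n) :
    BddAbove ((fun y : Euc n => ⟪x, y⟫) '' (K : Set (Euc n))) :=
  (K.isCompact.image (by fun_prop)).bddAbove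

lemma supp_mono {K L : ConvexBody (Euc n)} (hKL : (K : Set (Euc n)) ⊆ L) (x : Euc n) :
    supp K x ≤ supp L x :=
  csSup_le_csSup (bddAbove_inner_image L x) (K.nonempty.image _) (Set.image_mono hKL)

@[fun_prop]
lemma continuous_supp (K : ConvexBody (Euc n)) : Continuous (supp K) := by
  obtain ⟨M, hM⟩ := isBounded_iff_forall_norm_le.1 K.isCompact.isBounded
  obtain ⟨z₀, hz₀⟩ := K.nonempty
  have hM0 : 0 ≤ M := (norm_nonneg z₀).trans (hM z₀ hz₀)
  refine (LipschitzWith.of_le_add_mul ⟨M, hM0⟩ fun x y => ?_).continuous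
  refine csSup_le (K.nonempty.image _) ?_
  rintro _ ⟨z, hz, rfl⟩
  have hy : ⟪y, z⟫ ≤ supp K y := le_csSup (bddAbove_inner_image K y) ⟨z, hz, rfl⟩
  have hsub : ⟪x - y, z⟫ ≤ dist x y * M := by
    rw [dist_eq_norm]
    exact (real_inner_le_norm _ _).trans (mul_le_mul_of_nonneg_left (hM z hz) (norm_nonneg _))
  rw [inner_sub_left] at hsub
  change ⟪x, z⟫ ≤ supp K y + M * dist x y
  linarith

lemma integral_zonal_mul_inner_eq_zero (e : Sph n) (g : ℝ → ℝ) {w : Euc n}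
    (hw : ⟪(e : Euc n), w⟫ = 0) :
    ∫ u : Sph n, g ⟪(e : Euc n), (u : Euc n)⟫ * ⟪(u : Euc n), w⟫ ∂(surf n) = 0 := by
  set R := (ℝ ∙ w)ᗮ.reflection
  have hRe : R (e : Euc n) = e := Submodule.reflection_mem_subspace_eq_self
    (Submodule.mem_orthogonal_singleton_iff_inner_left.2 hw)
  have hRw : R w = -w := Submodule.reflection_orthogonalComplement_singleton_eq_neg w
  have hflip (u : Sph n) :
      g ⟪(e : Euc n), (rotSph R u : Euc n)⟫ * ⟪(rotSph R u : Euc n), w⟫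
        = -(g ⟪(e : Euc n), (u : Euc n)⟫ * ⟪(u : Euc n), w⟫) := by
    change g ⟪(e : Euc n), R u⟫ * ⟪R u, w⟫ = _
    rw [← R.inner_map_map (e : Euc n) u, hRe, ← R.inner_map_map (u : Euc n) w, hRw,
      inner_neg_right, mul_neg, neg_neg]
  have hself := integral_comp_rotSph R
    fun u => g ⟪(e : Euc n), (u : Euc n)⟫ * ⟪(u : Euc n), w⟫
  simp only [hflip, integral_neg] at hself
  linarith

lemma integral_zonal_mul_inner (e : Sph n) {g : ℝ → ℝ} (hg : Continuous g) (y : Euc n) :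
    ∫ u : Sph n, g ⟪(e : Euc n), (u : Euc n)⟫ * ⟪(u : Euc n), y⟫ ∂(surf n)
      = ⟪(e : Euc n), y⟫
        * ∫ u : Sph n, g ⟪(e : Euc n), (u : Euc n)⟫ * ⟪(e : Euc n), (u : Euc n)⟫ ∂(surf n) := by
  set w := y - ⟪(e : Euc n), y⟫ • (e : Euc n) with hw
  have hew : ⟪(e : Euc n), w⟫ = 0 := by
    rw [hw, inner_sub_right, real_inner_smul_right, real_inner_self_eq_norm_sq,
      norm_eq_of_mem_sphere, one_pow, mul_one, sub_self]
  have hsplit (u : Sph n) : g ⟪(e : Euc n), (u : Euc n)⟫ * ⟪(u : Euc n), y⟫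
      = g ⟪(e : Euc n), (u : Euc n)⟫ * ⟪(u : Euc n), w⟫ + ⟪(e : Euc n), y⟫ *
        (g ⟪(e : Euc n), (u : Euc n)⟫ * ⟪(e : Euc n), (u : Euc n)⟫) := by
    rw [hw, inner_sub_right, real_inner_smul_right, real_inner_comm (e : Euc n) (u : Euc n)]
    ring
  simp only [hsplit]
  rw [integral_add (integrable_of_continuous _ (by fun_prop))
    (integrable_of_continuous _ (by fun_prop)), integral_zonal_mul_inner_eq_zero e g hew,
    integral_const_mul, zero_add]

/-- The profiles `q` for which `u ↦ q ⟪e, u⟫` is orthogonal to all linear functions; by zonality,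
it suffices to test against `u ↦ ⟪e, u⟫`. -/
noncomputable def centeredProfiles (e : Sph n) : Submodule ℝ Profile where
  carrier := {q | ∫ u : Sph n, q ⟪(e : Euc n), (u : Euc n)⟫ * ⟪(e : Euc n), (u : Euc n)⟫
    ∂(surf n) = 0}
  zero_mem' := by
    change ∫ u : Sph n, (0 : ℝ) * ⟪(e : Euc n), (u : Euc n)⟫ ∂(surf n) = 0
    simp only [zero_mul, integral_zero]
  add_mem' {p q} hp hq := by
    change ∫ u : Sph n, (p ⟪(e : Euc n), (u : Euc n)⟫ + q ⟪(e : Euc n), (u : Euc n)⟫) * _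
      ∂(surf n) = 0
    simp only [add_mul]
    rw [integral_add (integrable_of_continuous _ (by fun_prop))
      (integrable_of_continuous _ (by fun_prop)), hp, hq, add_zero]
  smul_mem' c q hq := by
    change ∫ u : Sph n, (c * q ⟪(e : Euc n), (u : Euc n)⟫) * _ ∂(surf n) = 0
    simp only [mul_assoc]
    rw [integral_const_mul, hq, mul_zero]

lemma mem_centeredProfiles {e : Sph n} {q : Profile} : q ∈ centeredProfiles e ↔
    ∫ u : Sph n, q ⟪(e : Euc n), (u : Euc n)⟫ * ⟪(e : Euc n), (u : Euc n)⟫ ∂(surf n) = 0 :=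
  Iff.rfl

lemma steinerPoint_zonalBody {q : Profile} (hq : q.IsConvex) {e : Sph n}
    (hc : q ∈ centeredProfiles e) : steinerPoint (zonalBody q hq e) = 0 := by
  refine ext_inner_left ℝ fun y => ?_
  rw [steinerPoint, ← integral_inner (integrable_of_continuous _ (by fun_prop)), inner_zero_right]
  have hpair (u : Sph n) : ⟪y, supp (zonalBody q hq e) (u : Euc n) • (u : Euc n)⟫
      = q ⟪(e : Euc n), (u : Euc n)⟫ * ⟪(u : Euc n), y⟫ := by
    rw [real_inner_smul_right, supp_zonalBody, real_inner_comm y]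
  simp only [hpair]
  rw [integral_zonal_mul_inner e q.continuous, mem_centeredProfiles.1 hc, mul_zero]

end SupportFunctions

section Averaging

instance [NeZero n] : (surf n).IsOpenPosMeasure :=
  inferInstanceAs (Measure.IsOpenPosMeasure (Measure.toSphere _))

lemma integral_comp_inner_eq (hn : 3 ≤ n) (g : ℝ → ℝ) (v w : Sph n) :
    ∫ u : Sph n, g ⟪(u : Euc n), (v : Euc n)⟫ ∂(surf n)
      = ∫ u : Sph n, g ⟪(u : Euc n), (w : Euc n)⟫ ∂(surf n) := by
  obtain ⟨θ, -, rfl⟩ := exists_rotSph_eq hn w v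
  rw [← integral_comp_rotSph θ]
  refine integral_congr_ae (Eventually.of_forall fun u => ?_)
  change g ⟪θ u, θ w⟫ = _
  rw [θ.inner_map_map]

lemma dist_sph_sq (u v : Sph n) : dist u v ^ 2 = 2 * (1 - ⟪(u : Euc n), (v : Euc n)⟫) := by
  rw [Subtype.dist_eq, dist_eq_norm, norm_sub_sq_real, norm_eq_of_mem_sphere,
    norm_eq_of_mem_sphere]
  ring

lemma integral_mul_mul_kernel {X : Type*} [MeasurableSpace X] (ν : Measure X) (f F : X → ℝ)
    (k : X → X → ℝ) (v : X) :
    ∫ u, f v * (F u * k u v) ∂ν = f v * ∫ u, k u v * F u ∂ν := by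
  simp only [integral_const_mul, mul_comm]

variable {X : Type*} [TopologicalSpace X] [CompactSpace X] [MeasurableSpace X] [BorelSpace X]
  {ν : Measure X} {f : X → ℝ}

lemma integrable_mul_of_continuous (hf : Integrable f ν) {g : X → ℝ} (hg : Continuous g) :
    Integrable (fun v => f v * g v) ν := by
  obtain ⟨M, hM⟩ := isCompact_univ.exists_bound_of_continuousOn hg.continuousOn
  exact hf.mul_bdd (c := M) hg.aestronglyMeasurable (Eventually.of_forall fun v => hM v trivial)

lemma continuous_integral_kernel_mul [FirstCountableTopology X] {k : X → X → ℝ}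
    (hk : Continuous (Function.uncurry k)) (hf : Integrable f ν) :
    Continuous fun u => ∫ v, k u v * f v ∂ν := by
  obtain ⟨M, hM⟩ := isCompact_univ.exists_bound_of_continuousOn hk.continuousOn
  refine continuous_of_dominated (bound := fun v => M * |f v|) (fun u => ?_) (fun u => ?_)
    (hf.abs.const_mul M) (Eventually.of_forall fun v => by fun_prop)
  · exact (by fun_prop : Continuous (k u)).aestronglyMeasurable.mul hf.aestronglyMeasurable
  · refine Eventually.of_forall fun v => ?_
    rw [norm_mul]
    exact mul_le_mul_of_nonneg_right (hM (u, v) trivial) (norm_nonneg _)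

lemma integrable_prod_mul_kernel [SecondCountableTopology X] [IsFiniteMeasure ν] {k : X → X → ℝ}
    (hk : Continuous (Function.uncurry k)) (hf : Integrable f ν) {F : X → ℝ} (hF : Continuous F) :
    Integrable (fun p : X × X => f p.2 * (F p.1 * k p.1 p.2)) (ν.prod ν) :=
  integrable_mul_of_continuous (hf.comp_snd ν) (by fun_prop)

lemma integrable_mul_integral_kernel [SecondCountableTopology X] [IsFiniteMeasure ν]
    {k : X → X → ℝ} (hk : Continuous (Function.uncurry k)) (hf : Integrable f ν) {F : X → ℝ}
    (hF : Continuous F) : Integrable (fun v => f v * ∫ u, k u v * F u ∂ν) ν := by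
  simpa only [integral_mul_mul_kernel] using
    (integrable_prod_mul_kernel hk hf hF).integral_prod_right

lemma integral_mul_integral_kernel_comm [SecondCountableTopology X] [IsFiniteMeasure ν]
    {k : X → X → ℝ} (hk : Continuous (Function.uncurry k)) (hf : Integrable f ν) {F : X → ℝ}
    (hF : Continuous F) :
    ∫ u, F u * ∫ v, k u v * f v ∂ν ∂ν = ∫ v, f v * ∫ u, k u v * F u ∂ν ∂ν := by
  have hright (u : X) : ∫ v, f v * (F u * k u v) ∂ν = F u * ∫ v, k u v * f v ∂ν := by
    rw [← integral_const_mul]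
    exact integral_congr_ae (Eventually.of_forall fun v => by ring)
  have hswap := integral_integral_swap (f := fun u v => f v * (F u * k u v))
    (integrable_prod_mul_kernel hk hf hF)
  simpa only [integral_mul_mul_kernel, hright] using hswap

lemma exists_smooth_kernel {F : Sph n → ℝ} (hF : Continuous F) {ε : ℝ} (hε : 0 < ε) :
    ∃ g : ℝ → ℝ, ContDiff ℝ ∞ g ∧ (∀ t, 0 ≤ g t) ∧ 0 < g 1 ∧ ∀ u v : Sph n,
      g ⟪(u : Euc n), (v : Euc n)⟫ * |F u - F v| ≤ g ⟪(u : Euc n), (v : Euc n)⟫ * ε := by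
  obtain ⟨δ, hδ, hunif⟩ := Metric.uniformContinuous_iff.1
    (CompactSpace.uniformContinuous_of_continuous hF) ε hε
  refine ⟨fun t => Real.smoothTransition (t - (1 - δ ^ 2 / 2)),
    Real.smoothTransition.contDiff.comp (contDiff_id.sub contDiff_const),
    fun t => Real.smoothTransition.nonneg _, Real.smoothTransition.pos_of_pos ?_, fun u v => ?_⟩
  · have : 0 < δ ^ 2 := by positivity
    linarith
  dsimp only
  rcases le_or_gt ⟪(u : Euc n), (v : Euc n)⟫ (1 - δ ^ 2 / 2) with hfar | hnear
  · rw [Real.smoothTransition.zero_of_nonpos (sub_nonpos.2 hfar), zero_mul, zero_mul]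
  · have hdist : dist u v < δ := by
      refine lt_of_pow_lt_pow_left₀ 2 hδ.le ?_
      rw [dist_sph_sq]
      linarith
    exact mul_le_mul_of_nonneg_left (hunif hdist).le (Real.smoothTransition.nonneg _)

lemma abs_integral_kernel_mul_sub_le (hn : 3 ≤ n) (e : Sph n) {F : Sph n → ℝ} (hF : Continuous F)
    {g : ℝ → ℝ} (hg : Continuous g) {ε : ℝ} (hgF : ∀ u v : Sph n,
      g ⟪(u : Euc n), (v : Euc n)⟫ * |F u - F v| ≤ g ⟪(u : Euc n), (v : Euc n)⟫ * ε)
    (hg0 : ∀ t, 0 ≤ g t) (v : Sph n) :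
    |∫ u, g ⟪(u : Euc n), (v : Euc n)⟫ * F u ∂(surf n)
        - (∫ u : Sph n, g ⟪(u : Euc n), (e : Euc n)⟫ ∂(surf n)) * F v|
      ≤ (∫ u : Sph n, g ⟪(u : Euc n), (e : Euc n)⟫ ∂(surf n)) * ε := by
  rw [integral_comp_inner_eq hn g e v, ← integral_mul_const, ← integral_mul_const,
    ← integral_sub (integrable_of_continuous _ (by fun_prop))
      (integrable_of_continuous _ (by fun_prop))]
  refine abs_integral_le_integral_abs.trans (integral_mono
    (integrable_of_continuous _ (by fun_prop)) (integrable_of_continuous _ (by fun_prop))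
    fun u => ?_)
  simpa only [← mul_sub, abs_mul, abs_of_nonneg (hg0 _)] using hgF u v

lemma integral_kernel_pos (hn : 0 < n) (e : Sph n) {g : ℝ → ℝ} (hg : Continuous g)
    (hg0 : ∀ t, 0 ≤ g t) (hg1 : 0 < g 1) :
    0 < ∫ u : Sph n, g ⟪(u : Euc n), (e : Euc n)⟫ ∂(surf n) := by
  have : NeZero n := ⟨hn.ne'⟩
  refine (by fun_prop : Continuous fun u : Sph n => g ⟪(u : Euc n), (e : Euc n)⟫)
    |>.integral_pos_of_hasCompactSupport_nonneg_nonzero (HasCompactSupport.of_compactSpace _)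
    (fun u => hg0 _) (x := e) ?_
  rw [real_inner_self_eq_norm_sq, norm_eq_of_mem_sphere, one_pow]
  exact ne_of_gt hg1

-- Averaging `F` over small caps recovers `F` uniformly.
lemma integral_mul_nonneg_of_forall_kernel (hn : 3 ≤ n) (e : Sph n) {f : Sph n → ℝ}
    (hf : Integrable f (surf n)) {F : Sph n → ℝ} (hF : Continuous F)
    (hpos : ∀ g : ℝ → ℝ, ContDiff ℝ ∞ g → (∀ t, 0 ≤ g t) →
      0 ≤ ∫ u, F u * (∫ v, g ⟪(u : Euc n), (v : Euc n)⟫ * f v ∂(surf n)) ∂(surf n)) :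
    0 ≤ ∫ v, f v * F v ∂(surf n) := by
  have hfF := integrable_mul_of_continuous hf hF
  suffices happrox : ∀ ε : ℝ, 0 < ε →
      0 ≤ ∫ v, f v * F v ∂(surf n) + ε * ∫ v, |f v| ∂(surf n) by
    refine ge_of_tendsto (x := nhdsWithin (0 : ℝ) (Set.Ioi 0)) ?_
      (eventually_mem_nhdsWithin.mono happrox)
    exact (Continuous.tendsto' (by fun_prop) _ _ (by simp)).mono_left nhdsWithin_le_nhds
  intro ε hε
  obtain ⟨g, hg, hg0, hg1, hgF⟩ := exists_smooth_kernel hF hε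
  have hgc := hg.continuous
  set c := ∫ u : Sph n, g ⟪(u : Euc n), (e : Euc n)⟫ ∂(surf n)
  have hc : 0 < c := integral_kernel_pos (by omega) e hgc hg0 hg1
  have hk : Continuous (Function.uncurry fun u v : Sph n => g ⟪(u : Euc n), (v : Euc n)⟫) := by
    fun_prop
  refine nonneg_of_mul_nonneg_right ?_ hc
  calc 0 ≤ ∫ v, f v * ∫ u, g ⟪(u : Euc n), (v : Euc n)⟫ * F u ∂(surf n) ∂(surf n) :=
        (hpos g hg hg0).trans_eq (integral_mul_integral_kernel_comm hk hf hF)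
    _ ≤ ∫ v, (c * (f v * F v) + c * (ε * |f v|)) ∂(surf n) := by
        refine integral_mono (integrable_mul_integral_kernel hk hf hF)
          ((hfF.const_mul _).add ((hf.abs.const_mul _).const_mul _)) fun v => ?_
        have hmul := (le_abs_self _).trans_eq (abs_mul (f v)
          (∫ u, g ⟪(u : Euc n), (v : Euc n)⟫ * F u ∂(surf n) - c * F v)) |>.trans
          (mul_le_mul_of_nonneg_left (abs_integral_kernel_mul_sub_le hn e hF hgc hgF hg0 v)
            (abs_nonneg _))
        dsimp only
        linarith
    _ = c * (∫ v, f v * F v ∂(surf n) + ε * ∫ v, |f v| ∂(surf n)) := by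
        rw [integral_add (hfF.const_mul _) ((hf.abs.const_mul _).const_mul _),
          integral_const_mul, integral_const_mul, integral_const_mul, mul_add]

end Averaging

section WeakMonotonicity

lemma integral_mul_supp_zonalBody (hn : 3 ≤ n) {e : Sph n} {i : ℕ} (hi : i < n)
    {Φ : ConvexBody (Euc n) → ConvexBody (Euc n)} {f : Sph n → ℝ}
    (hf : IsGeneratingFunction e i Φ f) {q : Profile} (hq : q.IsConvex) {g : ℝ → ℝ}
    (hg : ContDiff ℝ ∞ g) :
    ∫ u : Sph n, g ⟪(e : Euc n), (u : Euc n)⟫ * supp (Φ (zonalBody q hq e)) (u : Euc n) ∂(surf n)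
      = areaConst n i * ∫ u : Sph n, q.curv n i ⟪(e : Euc n), (u : Euc n)⟫
        * (∫ v, g ⟪(u : Euc n), (v : Euc n)⟫ * f v ∂(surf n)) ∂(surf n) := by
  rw [hf.representation (zonalBody q hq e) (fun u => g ⟪(e : Euc n), (u : Euc n)⟫)
    (smoothSph_zonal e hg), integral_areaMeasure_zonalBody hq e (by omega) hi]
  simp only [sphConv_zonal hn e g hf.zonal]

lemma integral_mul_curv_mono (hn : 3 ≤ n) {e : Sph n} {i : ℕ} (hi : i < n)
    {Φ : ConvexBody (Euc n) → ConvexBody (Euc n)} {f : Sph n → ℝ} (hΦ : WeaklyMonotone Φ)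
    (hf : IsGeneratingFunction e i Φ f) {p q : Profile} (hp : p.IsConvex) (hq : q.IsConvex)
    (hpc : p ∈ centeredProfiles e) (hqc : q ∈ centeredProfiles e)
    (hpq : ∀ t, |t| ≤ 1 → p t ≤ q t) :
    ∫ v, f v * p.curv n i ⟪(e : Euc n), (v : Euc n)⟫ ∂(surf n)
      ≤ ∫ v, f v * q.curv n i ⟪(e : Euc n), (v : Euc n)⟫ ∂(surf n) := by
  have hsub : (Φ (zonalBody p hp e) : Set (Euc n)) ⊆ Φ (zonalBody q hq e) :=
    hΦ _ _ (fun z hz => (mem_zonalBody hq e).2 fun u =>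
      ((mem_zonalBody hp e).1 hz u).trans (hpq _ (abs_inner_sph_le_one e u)))
      (steinerPoint_zonalBody hp hpc) (steinerPoint_zonalBody hq hqc)
  rw [← sub_nonneg, ← integral_sub (integrable_mul_of_continuous hf.integrable (by fun_prop))
    (integrable_mul_of_continuous hf.integrable (by fun_prop))]
  simp only [← mul_sub]
  refine integral_mul_nonneg_of_forall_kernel hn e hf.integrable (by fun_prop) fun g hg hg0 => ?_
  have hgc := hg.continuous
  have hconv := continuous_integral_kernel_mul (ν := surf n)
    (k := fun u v : Sph n => g ⟪(u : Euc n), (v : Euc n)⟫) (by fun_prop) hf.integrable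
  have hsupp := integral_mono (μ := surf n)
    (f := fun u : Sph n => g ⟪(e : Euc n), (u : Euc n)⟫ * supp (Φ (zonalBody p hp e)) u)
    (g := fun u : Sph n => g ⟪(e : Euc n), (u : Euc n)⟫ * supp (Φ (zonalBody q hq e)) u)
    (integrable_of_continuous _ (by fun_prop)) (integrable_of_continuous _ (by fun_prop))
    fun u => mul_le_mul_of_nonneg_left (supp_mono hsub _) (hg0 _)
  rw [integral_mul_supp_zonalBody hn hi hf hp hg,
    integral_mul_supp_zonalBody hn hi hf hq hg] at hsupp
  simp only [sub_mul]
  rw [integral_sub (integrable_of_continuous _ (by fun_prop))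
    (integrable_of_continuous _ (by fun_prop)), sub_nonneg]
  exact le_of_mul_le_mul_left hsupp (areaConst_pos hi)

end WeakMonotonicity

/-! ### First variation of area measures -/

section Linearity

namespace Profile

variable (c : ℝ) (q p : Profile) (t : ℝ)

lemma d1_add : (q + p).d1 t = q.d1 t + p.d1 t :=
  ((q.hasDerivAt t).add (p.hasDerivAt t)).deriv

lemma d1_smul : (c • q).d1 t = c * q.d1 t :=
  ((q.hasDerivAt t).const_mul c).deriv

lemma d2_add : (q + p).d2 t = q.d2 t + p.d2 t := by
  rw [d2, show (q + p).d1 = q.d1 + p.d1 from funext fun t => d1_add q p t]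
  exact ((q.hasDerivAt_d1 t).add (p.hasDerivAt_d1 t)).deriv

lemma d2_smul : (c • q).d2 t = c * q.d2 t := by
  rw [d2, show (c • q).d1 = fun t => c * q.d1 t from funext fun t => d1_smul c q t]
  exact ((q.hasDerivAt_d1 t).const_mul c).deriv

lemma add_apply : (q + p) t = q t + p t := rfl

lemma smul_apply : (c • q) t = c * q t := rfl

lemma tan_add : (q + p).tan t = q.tan t + p.tan t := by
  simp only [tan, add_apply, d1_add]
  ring

lemma tan_smul : (c • q).tan t = c * q.tan t := by
  simp only [tan, smul_apply, d1_smul]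
  ring

lemma rad_add : (q + p).rad t = q.rad t + p.rad t := by
  simp only [rad, tan_add, d2_add]
  ring

lemma rad_smul : (c • q).rad t = c * q.rad t := by
  simp only [rad, tan_smul, d2_smul]
  ring

/-- The constant profile; it belongs to the centered ball of radius `c`. -/
noncomputable def const : Profile := ⟨fun _ => c, mem_profileSubmodule.2 contDiff_const⟩

lemma const_apply : const c t = c := rfl

lemma d1_const : (const c).d1 t = 0 := deriv_const t c

lemma d2_const : (const c).d2 t = 0 := by
  rw [d2, show (const c).d1 = fun _ => 0 from funext (d1_const c)]
  exact deriv_const t 0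

lemma tan_const : (const c).tan t = c := by
  rw [tan, d1_const, mul_zero, sub_zero, const_apply]

lemma rad_const : (const c).rad t = c := by
  rw [rad, d2_const, mul_zero, add_zero, tan_const]

/-- The operator `(n - 1) □_n` on zonal functions, in terms of profiles. -/
noncomputable def box (n : ℕ) (q : Profile) (t : ℝ) : ℝ :=
  ((n : ℝ) - 1) * q.tan t + (1 - t ^ 2) * q.d2 t

@[fun_prop]
lemma continuous_box (n : ℕ) : Continuous (q.box n) := by
  unfold box
  fun_prop

lemma box_add (n : ℕ) : (q + p).box n t = q.box n t + p.box n t := by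
  simp only [box, tan_add, d2_add]
  ring

lemma box_smul (n : ℕ) : (c • q).box n t = c * q.box n t := by
  simp only [box, tan_smul, d2_smul]
  ring

lemma box_eq_tan_add_rad (hn : 2 ≤ n) : q.box n t = ((n - 2 : ℕ) : ℝ) * q.tan t + q.rad t := by
  rw [box, rad, Nat.cast_sub hn]
  push_cast
  ring

variable {c q p}

lemma isConvex_const (hc : 0 ≤ c) : (const c).IsConvex where
  nonneg _ _ := hc
  tan_nonneg t _ := by rwa [tan_const]
  rad_nonneg t _ := by rwa [rad_const]

lemma IsConvex.add (hq : q.IsConvex) (hp : p.IsConvex) : (q + p).IsConvex where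
  nonneg t ht := add_nonneg (hq.nonneg t ht) (hp.nonneg t ht)
  tan_nonneg t ht := (tan_add q p t).symm ▸ add_nonneg (hq.tan_nonneg t ht) (hp.tan_nonneg t ht)
  rad_nonneg t ht := (rad_add q p t).symm ▸ add_nonneg (hq.rad_nonneg t ht) (hp.rad_nonneg t ht)

lemma IsConvex.smul (hq : q.IsConvex) (hc : 0 ≤ c) : (c • q).IsConvex where
  nonneg t ht := mul_nonneg hc (hq.nonneg t ht)
  tan_nonneg t ht := (tan_smul c q t).symm ▸ mul_nonneg hc (hq.tan_nonneg t ht)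
  rad_nonneg t ht := (rad_smul c q t).symm ▸ mul_nonneg hc (hq.rad_nonneg t ht)

end Profile

lemma exists_forall_one_add_mul_nonneg {g : ℝ → ℝ} (hg : Continuous g) :
    ∃ δ : ℝ, 0 < δ ∧ ∀ ε, 0 ≤ ε → ε ≤ δ → ∀ t, |t| ≤ 1 → 0 ≤ 1 + ε * g t := by
  obtain ⟨M, hM⟩ := (isCompact_Icc (a := (-1 : ℝ)) (b := 1)).exists_bound_of_continuousOn
    hg.continuousOn
  refine ⟨(|M| + 1)⁻¹, by positivity, fun ε h0 hle t ht => ?_⟩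
  have hbound : -g t ≤ |M| + 1 :=
    (neg_le_abs _).trans ((hM t (abs_le.1 ht)).trans (by linarith [le_abs_self M]))
  have hmul : ε * -g t ≤ 1 := calc
    ε * -g t ≤ ε * (|M| + 1) := by gcongr
    _ ≤ (|M| + 1)⁻¹ * (|M| + 1) := by gcongr
    _ = 1 := inv_mul_cancel₀ (by positivity)
  linarith

lemma Profile.exists_isConvex_const_one_add_smul {p : Profile} (hp : ∀ t, |t| ≤ 1 → 0 ≤ p t) :
    ∃ δ : ℝ, 0 < δ ∧ ∀ ε, 0 ≤ ε → ε ≤ δ → (const 1 + ε • p).IsConvex := by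
  obtain ⟨δ₁, hδ₁, htan⟩ := exists_forall_one_add_mul_nonneg p.continuous_tan
  obtain ⟨δ₂, hδ₂, hrad⟩ := exists_forall_one_add_mul_nonneg p.continuous_rad
  refine ⟨min δ₁ δ₂, lt_min hδ₁ hδ₂, fun ε h0 hle => ⟨fun t ht => ?_, fun t ht => ?_,
    fun t ht => ?_⟩⟩
  · exact add_nonneg zero_le_one (mul_nonneg h0 (hp t ht))
  · rw [tan_add, tan_smul, tan_const]
    exact htan ε h0 (hle.trans (min_le_left _ _)) t ht
  · rw [rad_add, rad_smul, rad_const]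
    exact hrad ε h0 (hle.trans (min_le_right _ _)) t ht

end Linearity

section Variation

lemma esymmRadii_mul (m j : ℕ) (c a b : ℝ) :
    esymmRadii m j (c * a) (c * b) = c ^ j * esymmRadii m j a b := by
  cases j with
  | zero => simp [esymmRadii]
  | succ j =>
    simp only [esymmRadii]
    ring

/-- The derivative of `esymmRadii m (j + 1)` at `(a, b)` in the direction `(a', b')`. -/
def esymmRadiiDeriv (m j : ℕ) (a b a' b' : ℝ) : ℝ :=
  (m.choose (j + 1) : ℝ) * (((j : ℝ) + 1) * a ^ j * a')
    + ((m.choose j : ℝ) * b' * a ^ j + (m.choose j : ℝ) * b * (j * a ^ (j - 1) * a'))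

lemma hasDerivAt_esymmRadii (m j : ℕ) (a a' b b' ε : ℝ) :
    HasDerivAt (fun s => esymmRadii m (j + 1) (a + s * a') (b + s * b'))
      (esymmRadiiDeriv m j (a + ε * a') (b + ε * b') a' b') ε := by
  have hline (c c' : ℝ) : HasDerivAt (fun s : ℝ => c + s * c') c' ε :=
    (((hasDerivAt_id ε).mul_const c').const_add c).congr_deriv (one_mul c')
  simp only [esymmRadii]
  refine ((((hline a a').pow (j + 1)).const_mul _).add
    (((hline b b').const_mul _).mul ((hline a a').pow j))).congr_deriv ?_
  rw [esymmRadiiDeriv, Nat.cast_succ, Nat.add_sub_cancel, Pi.pow_apply]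

lemma esymmRadiiDeriv_diag (m j : ℕ) (R a' b' : ℝ) :
    esymmRadiiDeriv m j R R a' b' = (m.choose j : ℝ) * R ^ j * (m * a' + b') := by
  have hchoose : (m.choose (j + 1) : ℝ) * ((j : ℝ) + 1) = m.choose j * ((m : ℝ) - j) := by
    rcases le_or_gt j m with hle | hlt
    · rw [← Nat.cast_sub hle]
      exact_mod_cast Nat.choose_succ_right_eq m j
    · rw [Nat.choose_eq_zero_of_lt hlt, Nat.choose_eq_zero_of_lt (by omega), Nat.cast_zero,
        zero_mul, zero_mul]
  have hpow : R * (j * R ^ (j - 1)) = j * R ^ j := by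
    cases j with
    | zero => simp
    | succ j => simp only [Nat.add_sub_cancel]; ring
  rw [esymmRadiiDeriv]
  linear_combination R ^ j * a' * hchoose + (m.choose j : ℝ) * a' * hpow

lemma esymmRadiiDeriv_zero (m j : ℕ) (a b : ℝ) : esymmRadiiDeriv m j a b 0 0 = 0 := by
  simp only [esymmRadiiDeriv, mul_zero, zero_mul, add_zero]

lemma hasDerivAt_integral_mul {X : Type*} [TopologicalSpace X] [CompactSpace X]
    [MeasurableSpace X] [BorelSpace X] {ν : Measure X} {f : X → ℝ} (hf : Integrable f ν)
    {F F' : ℝ → X → ℝ} {ε : ℝ} (hF : ∀ s, Continuous (F s))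
    (hF' : Continuous (Function.uncurry F'))
    (hderiv : ∀ s x, HasDerivAt (fun s => F s x) (F' s x) s) :
    HasDerivAt (fun s => ∫ x, f x * F s x ∂ν) (∫ x, f x * F' ε x ∂ν) ε := by
  obtain ⟨M, hM⟩ := ((isCompact_closedBall ε 1).prod
    (isCompact_univ (X := X))).exists_bound_of_continuousOn hF'.continuousOn
  refine (hasDerivAt_integral_of_dominated_loc_of_deriv_le (𝕜 := ℝ) (bound := fun x => |f x| * M)
    (Metric.closedBall_mem_nhds ε one_pos)
    (Eventually.of_forall fun s => (integrable_mul_of_continuous hf (hF s)).aestronglyMeasurable)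
    (integrable_mul_of_continuous hf (hF ε))
    (integrable_mul_of_continuous hf (by fun_prop)).aestronglyMeasurable
    (Eventually.of_forall fun x s hs => ?_) (hf.abs.mul_const M)
    (Eventually.of_forall fun x s _ => (hderiv s x).const_mul (f x))).2
  rw [norm_mul]
  exact mul_le_mul_of_nonneg_left (hM (s, x) ⟨hs, trivial⟩) (norm_nonneg _)

variable {f : Sph n → ℝ}

/-- The functional `p ↦ (n - 1) ⟪□_n f, p⟫` on zonal functions. -/
noncomputable def boxFunctional (e : Sph n) (hf : Integrable f (surf n)) : Profile →ₗ[ℝ] ℝ where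
  toFun p := ∫ v, f v * p.box n ⟪(e : Euc n), (v : Euc n)⟫ ∂(surf n)
  map_add' p q := by
    simp only [Profile.box_add, mul_add]
    exact integral_add (integrable_mul_of_continuous hf (by fun_prop))
      (integrable_mul_of_continuous hf (by fun_prop))
  map_smul' c p := by
    simp only [Profile.box_smul, mul_left_comm _ c, integral_const_mul, smul_eq_mul,
      RingHom.id_apply]

lemma boxFunctional_apply (e : Sph n) (hf : Integrable f (surf n)) (p : Profile) :
    boxFunctional e hf p = ∫ v, f v * p.box n ⟪(e : Euc n), (v : Euc n)⟫ ∂(surf n) :=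
  rfl

lemma hasDerivAt_integral_curv (hn : 2 ≤ n) (e : Sph n) (hf : Integrable f (surf n))
    (q p : Profile) (j : ℕ) {R : ℝ}
    (hR : ∀ t, |t| ≤ 1 → (q.tan t = R ∧ q.rad t = R) ∨ (p.tan t = 0 ∧ p.rad t = 0)) :
    HasDerivAt
      (fun ε : ℝ => ∫ v, f v * (q + ε • p).curv n (j + 1) ⟪(e : Euc n), (v : Euc n)⟫ ∂(surf n))
      (((n - 2).choose j : ℝ) * R ^ j * boxFunctional e hf p) 0 := by
  set D : ℝ → ℝ → ℝ := fun ε t =>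
    esymmRadiiDeriv (n - 2) j (q.tan t + ε * p.tan t) (q.rad t + ε * p.rad t) (p.tan t) (p.rad t)
    with hD
  have hDcont : Continuous (Function.uncurry D) := by
    simp only [hD, Function.uncurry_def, esymmRadiiDeriv]
    fun_prop
  have hderiv (ε t : ℝ) : HasDerivAt (fun ε : ℝ => (q + ε • p).curv n (j + 1) t) (D ε t) ε := by
    simp only [Profile.curv, Profile.tan_add, Profile.tan_smul, Profile.rad_add, Profile.rad_smul]
    exact hasDerivAt_esymmRadii (n - 2) j _ _ _ _ ε
  have hD0 (t : ℝ) (ht : |t| ≤ 1) : D 0 t = ((n - 2).choose j : ℝ) * R ^ j * p.box n t := by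
    simp only [hD, Profile.box_eq_tan_add_rad p t hn, zero_mul, add_zero]
    rcases hR t ht with ⟨htan, hrad⟩ | ⟨htan, hrad⟩
    · rw [htan, hrad, esymmRadiiDeriv_diag]
    · rw [htan, hrad, esymmRadiiDeriv_zero, mul_zero, add_zero, mul_zero]
  refine (hasDerivAt_integral_mul hf (fun ε => by fun_prop)
    (F' := fun ε v => D ε ⟪(e : Euc n), (v : Euc n)⟫)
    (hDcont.comp (by fun_prop : Continuous fun x : ℝ × Sph n =>
      (x.1, ⟪(e : Euc n), (x.2 : Euc n)⟫))) fun ε v => hderiv ε _).congr_deriv ?_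
  simp only [hD0 _ (abs_inner_sph_le_one e _), mul_left_comm (f _), integral_const_mul,
    boxFunctional_apply]

end Variation

section Positivity

lemma nonneg_of_hasDerivAt_of_le_right {F : ℝ → ℝ} {F' x δ : ℝ} (h : HasDerivAt F F' x)
    (hδ : 0 < δ) (hle : ∀ ε, 0 < ε → ε ≤ δ → F x ≤ F (x + ε)) : 0 ≤ F' := by
  refine ge_of_tendsto h.tendsto_slope_zero_right ?_
  filter_upwards [Ioc_mem_nhdsGT hδ] with ε hε
  exact mul_nonneg (inv_nonneg.2 hε.1.le) (sub_nonneg.2 (hle ε hε.1 hε.2))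

lemma mem_centeredProfiles_of_even (e : Sph n) {q : Profile} (heven : ∀ t, q (-t) = q t) :
    q ∈ centeredProfiles e := by
  have hself := integral_comp_rotSph (LinearIsometryEquiv.neg ℝ)
    fun u : Sph n => q ⟪(e : Euc n), (u : Euc n)⟫ * ⟪(e : Euc n), (u : Euc n)⟫
  have hneg (u : Sph n) : ⟪(e : Euc n), (rotSph (LinearIsometryEquiv.neg ℝ) u : Euc n)⟫
      = -⟪(e : Euc n), (u : Euc n)⟫ :=
    inner_neg_right _ _
  simp only [hneg, heven, mul_neg, integral_neg] at hself
  rw [mem_centeredProfiles]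
  linarith

variable {Φ : ConvexBody (Euc n) → ConvexBody (Euc n)} {f : Sph n → ℝ}

lemma boxFunctional_nonneg (hn : 3 ≤ n) {e : Sph n} {i : ℕ} (hi1 : 1 ≤ i) (hi : i < n)
    (hΦ : WeaklyMonotone Φ) (hf : IsGeneratingFunction e i Φ f) {p : Profile}
    (hp : ∀ t, |t| ≤ 1 → 0 ≤ p t) (hpc : p ∈ centeredProfiles e) :
    0 ≤ boxFunctional e hf.integrable p := by
  obtain ⟨j, rfl⟩ : ∃ j, i = j + 1 := ⟨i - 1, by omega⟩
  obtain ⟨δ, hδ, hconv⟩ := Profile.exists_isConvex_const_one_add_smul hp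
  have hcentered (ε : ℝ) : Profile.const 1 + ε • p ∈ centeredProfiles e :=
    add_mem (mem_centeredProfiles_of_even e fun _ => rfl) (Submodule.smul_mem _ ε hpc)
  have hderiv := hasDerivAt_integral_curv (by omega) e hf.integrable (Profile.const 1) p j (R := 1)
    fun t _ => Or.inl ⟨Profile.tan_const 1 t, Profile.rad_const 1 t⟩
  have hnonneg := nonneg_of_hasDerivAt_of_le_right hderiv hδ fun ε h0 hle => by
    rw [zero_add]
    refine integral_mul_curv_mono hn hi hΦ hf (hconv 0 le_rfl hδ.le) (hconv ε h0.le hle)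
      (hcentered 0) (hcentered ε) fun t ht => ?_
    rw [zero_smul, add_zero]
    exact le_add_of_nonneg_right (mul_nonneg h0.le (hp t ht))
  refine nonneg_of_mul_nonneg_right hnonneg ?_
  rw [one_pow, mul_one]
  exact_mod_cast Nat.choose_pos (by omega)

end Positivity

/-! ### Lenses and smooth polar caps -/

section Gluing

lemma continuous_ite_lt {f g : ℝ → ℝ} {c : ℝ} (hf : ∀ x ≤ c, ContinuousAt f x)
    (hg : ∀ x, c ≤ x → ContinuousAt g x) (h0 : f c = g c) :
    Continuous fun x => if x < c then f x else g x := by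
  refine continuous_iff_continuousAt.2 fun x => ?_
  rcases lt_trichotomy x c with hlt | rfl | hgt
  · refine (hf x hlt.le).congr ?_
    filter_upwards [Iio_mem_nhds hlt] with y hy
    rw [if_pos (Set.mem_Iio.1 hy)]
  · have hleft : ContinuousWithinAt (fun y => if y < x then f y else g y) (Set.Iic x) x := by
      refine (hf x le_rfl).continuousWithinAt.congr (fun y hy => ?_) (by simp [h0])
      split_ifs with h
      · rfl
      · rw [le_antisymm hy (not_lt.1 h), h0]
    have hright : ContinuousWithinAt (fun y => if y < x then f y else g y) (Set.Ici x) x :=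
      (hg x le_rfl).continuousWithinAt.congr (fun y hy => if_neg (not_lt.2 hy)) (by simp)
    have hunion := hleft.union hright
    rwa [Set.Iic_union_Ici, continuousWithinAt_univ] at hunion
  · refine (hg x hgt.le).congr ?_
    filter_upwards [Ioi_mem_nhds hgt] with y hy
    rw [if_neg (not_lt.2 (le_of_lt hy))]

lemma hasDerivAt_ite_lt {f g f' g' : ℝ → ℝ} {c : ℝ} (hf : ∀ x ≤ c, HasDerivAt f (f' x) x)
    (hg : ∀ x, c ≤ x → HasDerivAt g (g' x) x) (h0 : f c = g c) (h1 : f' c = g' c) (x : ℝ) :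
    HasDerivAt (fun x => if x < c then f x else g x) (if x < c then f' x else g' x) x := by
  rcases lt_trichotomy x c with hlt | rfl | hgt
  · rw [if_pos hlt]
    refine (hf x hlt.le).congr_of_eventuallyEq ?_
    filter_upwards [Iio_mem_nhds hlt] with y hy
    rw [if_pos (Set.mem_Iio.1 hy)]
  · rw [if_neg (lt_irrefl x)]
    have hleft : HasDerivWithinAt (fun y => if y < x then f y else g y) (g' x) (Set.Iic x) x := by
      rw [← h1]
      refine (hf x le_rfl).hasDerivWithinAt.congr (fun y hy => ?_) (by simp [h0])
      split_ifs with h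
      · rfl
      · rw [le_antisymm hy (not_lt.1 h), h0]
    have hright : HasDerivWithinAt (fun y => if y < x then f y else g y) (g' x) (Set.Ici x) x :=
      (hg x le_rfl).hasDerivWithinAt.congr (fun y hy => if_neg (not_lt.2 hy)) (by simp)
    have hunion := hleft.union hright
    rwa [Set.Iic_union_Ici, hasDerivWithinAt_univ] at hunion
  · rw [if_neg (not_lt.2 hgt.le)]
    refine (hg x hgt.le).congr_of_eventuallyEq ?_
    filter_upwards [Ioi_mem_nhds hgt] with y hy
    rw [if_neg (not_lt.2 (le_of_lt hy))]

lemma contDiff_two_of_hasDerivAt {g g' g'' : ℝ → ℝ} (hg : ∀ x, HasDerivAt g (g' x) x)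
    (hg' : ∀ x, HasDerivAt g' (g'' x) x) (hcont : Continuous g'') : ContDiff ℝ 2 g := by
  have hderiv : deriv g = g' := funext fun x => (hg x).deriv
  have hderiv' : deriv g' = g'' := funext fun x => (hg' x).deriv
  have hg'C1 : ContDiff ℝ 1 g' :=
    contDiff_one_iff_deriv.2 ⟨fun x => (hg' x).differentiableAt, hderiv' ▸ hcont⟩
  exact (contDiff_succ_iff_deriv (n := 1)).2
    ⟨fun x => (hg x).differentiableAt, fun h => by simp at h, hderiv ▸ hg'C1⟩

end Gluing

section OneSubSq

namespace Profile

/-- The profile `t ↦ g (1 - t ^ 2)`; with `t = cos θ` it is a function of `sin θ ^ 2`. -/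
noncomputable def ofOneSubSq (g : ℝ → ℝ) (hg : ContDiff ℝ 2 g) : Profile :=
  ⟨fun t => g (1 - t ^ 2), mem_profileSubmodule.2 (hg.comp (by fun_prop))⟩

variable {g g' g'' : ℝ → ℝ} {hg : ContDiff ℝ 2 g} (t : ℝ)

lemma ofOneSubSq_apply : ofOneSubSq g hg t = g (1 - t ^ 2) := rfl

lemma ofOneSubSq_neg : ofOneSubSq g hg (-t) = ofOneSubSq g hg t := by
  rw [ofOneSubSq_apply, ofOneSubSq_apply, neg_sq]

lemma d1_ofOneSubSq (h1 : ∀ w, HasDerivAt g (g' w) w) :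
    (ofOneSubSq g hg).d1 t = g' (1 - t ^ 2) * -(2 * t) :=
  ((h1 _).comp t (hasDerivAt_one_sub_sq t)).deriv

lemma d2_ofOneSubSq (h1 : ∀ w, HasDerivAt g (g' w) w) (h2 : ∀ w, HasDerivAt g' (g'' w) w) :
    (ofOneSubSq g hg).d2 t = 4 * t ^ 2 * g'' (1 - t ^ 2) - 2 * g' (1 - t ^ 2) := by
  rw [d2, show (ofOneSubSq g hg).d1 = fun t => g' (1 - t ^ 2) * -(2 * t) from
    funext fun t => d1_ofOneSubSq t h1]
  refine ((((h2 _).comp t (hasDerivAt_one_sub_sq t)).mul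
    ((hasDerivAt_id t).const_mul 2).neg).congr_deriv ?_).deriv
  simp only [Pi.neg_apply, Function.comp_apply, id_eq]
  ring

lemma tan_ofOneSubSq (h1 : ∀ w, HasDerivAt g (g' w) w) :
    (ofOneSubSq g hg).tan t = g (1 - t ^ 2) + 2 * t ^ 2 * g' (1 - t ^ 2) := by
  rw [tan, ofOneSubSq_apply, d1_ofOneSubSq t h1]
  ring

end Profile

end OneSubSq

section Lens

/-- The support function of the lens as a function of `w = 1 - t ^ 2`. For `w < σ ^ 2` it is the
support function of two translates of a ball of radius `1 / σ`; for `w ≥ σ ^ 2` it is a combination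
of `√w` and `1 / √w` that makes the function twice continuously differentiable. -/
noncomputable def lensFun (σ w : ℝ) : ℝ :=
  if w < σ ^ 2 then 1 / σ - √(1 - σ ^ 2) ^ 3 / σ * √(1 - w)
  else (3 / 2 - σ ^ 2) * √w + σ ^ 2 / 2 * (√w)⁻¹

/-- The first derivative of `lensFun`. -/
noncomputable def lensDeriv (σ w : ℝ) : ℝ :=
  if w < σ ^ 2 then √(1 - σ ^ 2) ^ 3 / σ * (2 * √(1 - w))⁻¹
  else (3 / 2 - σ ^ 2) / 2 * (√w)⁻¹ - σ ^ 2 / 4 * (√w ^ 3)⁻¹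

/-- The second derivative of `lensFun`. -/
noncomputable def lensDerivTwo (σ w : ℝ) : ℝ :=
  if w < σ ^ 2 then √(1 - σ ^ 2) ^ 3 / σ * (4 * √(1 - w) ^ 3)⁻¹
  else -(3 / 2 - σ ^ 2) / 4 * (√w ^ 3)⁻¹ + 3 * σ ^ 2 / 8 * (√w ^ 5)⁻¹

lemma hasDerivAt_sqrt_one_sub {w : ℝ} (hw : w < 1) :
    HasDerivAt (fun x => √(1 - x)) (-(2 * √(1 - w))⁻¹) w := by
  refine (((hasDerivAt_id w).const_sub 1).sqrt (sub_pos.2 hw).ne').congr_deriv ?_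
  rw [neg_div, one_div, id_eq]

lemma hasDerivAt_sqrt {w : ℝ} (hw : 0 < w) : HasDerivAt (fun x => √x) ((2 * √w)⁻¹) w :=
  ((hasDerivAt_id w).sqrt hw.ne').congr_deriv (one_div _)

variable {σ : ℝ}

lemma hasDerivAt_lensFun (h0 : 0 < σ) (h1 : σ < 1) (w : ℝ) :
    HasDerivAt (lensFun σ) (lensDeriv σ w) w := by
  have hσ : σ ^ 2 < 1 := by nlinarith
  have hτ : √(1 - σ ^ 2) ^ 2 = 1 - σ ^ 2 := Real.sq_sqrt (by linarith)
  have : 0 < √(1 - σ ^ 2) := Real.sqrt_pos.2 (by linarith)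
  change HasDerivAt (fun w => lensFun σ w) _ _
  simp only [lensFun, lensDeriv]
  refine hasDerivAt_ite_lt (f' := fun w => √(1 - σ ^ 2) ^ 3 / σ * (2 * √(1 - w))⁻¹)
    (g' := fun w => (3 / 2 - σ ^ 2) / 2 * (√w)⁻¹ - σ ^ 2 / 4 * (√w ^ 3)⁻¹)
    (fun x hx => ?_) (fun x hx => ?_) ?_ ?_ w
  · refine (((hasDerivAt_sqrt_one_sub (hx.trans_lt hσ)).const_mul
      (√(1 - σ ^ 2) ^ 3 / σ)).const_sub (1 / σ)).congr_deriv ?_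
    ring
  · have hx0 : 0 < x := lt_of_lt_of_le (by positivity) hx
    have hs : 0 < √x := Real.sqrt_pos.2 hx0
    refine (((hasDerivAt_sqrt hx0).const_mul (3 / 2 - σ ^ 2)).add
      (((hasDerivAt_sqrt hx0).inv hs.ne').const_mul (σ ^ 2 / 2))).congr_deriv ?_
    field_simp
    ring
  · rw [Real.sqrt_sq h0.le]
    field_simp
    linear_combination (-2 * √(1 - σ ^ 2) ^ 2 - 2 * (1 - σ ^ 2)) * hτ
  · rw [Real.sqrt_sq h0.le]
    field_simp
    linear_combination hτ * 8

lemma hasDerivAt_lensDeriv (h0 : 0 < σ) (h1 : σ < 1) (w : ℝ) :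
    HasDerivAt (lensDeriv σ) (lensDerivTwo σ w) w := by
  have hσ : σ ^ 2 < 1 := by nlinarith
  have hτ : √(1 - σ ^ 2) ^ 2 = 1 - σ ^ 2 := Real.sq_sqrt (by linarith)
  have : 0 < √(1 - σ ^ 2) := Real.sqrt_pos.2 (by linarith)
  change HasDerivAt (fun w => lensDeriv σ w) _ _
  simp only [lensDeriv, lensDerivTwo]
  refine hasDerivAt_ite_lt (f' := fun w => √(1 - σ ^ 2) ^ 3 / σ * (4 * √(1 - w) ^ 3)⁻¹)
    (g' := fun w => -(3 / 2 - σ ^ 2) / 4 * (√w ^ 3)⁻¹ + 3 * σ ^ 2 / 8 * (√w ^ 5)⁻¹)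
    (fun x hx => ?_) (fun x hx => ?_) ?_ ?_ w
  · have : 0 < √(1 - x) := Real.sqrt_pos.2 (by linarith)
    refine ((((hasDerivAt_sqrt_one_sub (hx.trans_lt hσ)).const_mul 2).inv
      (by positivity)).const_mul (√(1 - σ ^ 2) ^ 3 / σ)).congr_deriv ?_
    field_simp
    ring
  · have hx0 : 0 < x := lt_of_lt_of_le (by positivity) hx
    have hs : 0 < √x := Real.sqrt_pos.2 hx0
    refine ((((hasDerivAt_sqrt hx0).inv hs.ne').const_mul ((3 / 2 - σ ^ 2) / 2)).sub
      ((((hasDerivAt_sqrt hx0).pow 3).inv (pow_pos hs 3).ne').const_mul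
        (σ ^ 2 / 4))).congr_deriv ?_
    simp only [Pi.pow_apply]
    field_simp
    ring
  · rw [Real.sqrt_sq h0.le]
    field_simp
    linear_combination hτ * 8
  · rw [Real.sqrt_sq h0.le]
    field_simp
    ring

lemma continuous_lensDerivTwo (h0 : 0 < σ) (h1 : σ < 1) : Continuous (lensDerivTwo σ) := by
  have hσ : σ ^ 2 < 1 := by nlinarith
  have : 0 < √(1 - σ ^ 2) := Real.sqrt_pos.2 (by linarith)
  change Continuous fun w => lensDerivTwo σ w
  simp only [lensDerivTwo]
  refine continuous_ite_lt (fun x hx => ?_) (fun x hx => ?_) ?_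
  · have : 0 < √(1 - x) := Real.sqrt_pos.2 (by linarith)
    have hpow : ContinuousAt (fun x => 4 * √(1 - x) ^ 3) x := by fun_prop
    exact continuousAt_const.mul (hpow.inv₀ (by positivity))
  · have hs : 0 < √x := Real.sqrt_pos.2 (lt_of_lt_of_le (by positivity) hx)
    have hpow (m : ℕ) : ContinuousAt (fun x => √x ^ m) x := by fun_prop
    exact (continuousAt_const.mul ((hpow 3).inv₀ (pow_pos hs 3).ne')).add
      (continuousAt_const.mul ((hpow 5).inv₀ (pow_pos hs 5).ne'))
  · rw [Real.sqrt_sq h0.le]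
    field_simp
    ring

lemma contDiff_lensFun (h0 : 0 < σ) (h1 : σ < 1) : ContDiff ℝ 2 (lensFun σ) :=
  contDiff_two_of_hasDerivAt (hasDerivAt_lensFun h0 h1) (hasDerivAt_lensDeriv h0 h1)
    (continuous_lensDerivTwo h0 h1)

lemma lensFun_mem_Icc_of_lt (h0 : 0 < σ) (h1 : σ < 1) {w : ℝ} (hw0 : 0 ≤ w) (hw : w < σ ^ 2) :
    lensFun σ w ∈ Set.Icc 0 2 := by
  have hσ : σ ^ 2 < 1 := by nlinarith
  rw [lensFun, if_pos hw, div_mul_eq_mul_div, ← sub_div]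
  set τ := √(1 - σ ^ 2)
  have hτ0 : 0 ≤ τ := Real.sqrt_nonneg _
  have hτ1 : τ ≤ 1 := Real.sqrt_le_one.2 (by nlinarith)
  have hw1 : √(1 - w) ≤ 1 := Real.sqrt_le_one.2 (by linarith)
  have hupper : τ ^ 3 * √(1 - w) ≤ 1 :=
    mul_le_one₀ (pow_le_one₀ hτ0 hτ1) (Real.sqrt_nonneg _) hw1
  have hlower : (1 - σ ^ 2) ^ 2 ≤ τ ^ 3 * √(1 - w) := calc
    (1 - σ ^ 2) ^ 2 = τ ^ 3 * τ := by rw [← Real.sq_sqrt (sub_pos.2 hσ).le]; ring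
    _ ≤ τ ^ 3 * √(1 - w) := by
      have hτw : τ ≤ √(1 - w) := Real.sqrt_le_sqrt (by linarith)
      gcongr
  exact ⟨div_nonneg (by linarith) h0.le, by rw [div_le_iff₀ h0]; nlinarith⟩

lemma lensFun_mem_Icc_of_le (h0 : 0 < σ) (h1 : σ < 1) {w : ℝ} (hw : σ ^ 2 ≤ w) (hw1 : w ≤ 1) :
    lensFun σ w ∈ Set.Icc 0 2 := by
  rw [lensFun, if_neg (not_lt.2 hw)]
  have hσs : σ ≤ √w := Real.le_sqrt_of_sq_le hw
  have hs1 : √w ≤ 1 := Real.sqrt_le_one.2 hw1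
  have hinv : σ ^ 2 / 2 * (√w)⁻¹ ≤ 1 / 2 := by
    rw [← div_eq_mul_inv, div_le_iff₀ (h0.trans_le hσs)]
    nlinarith
  have hcoeff : 0 < 3 / 2 - σ ^ 2 := by nlinarith
  exact ⟨by positivity, by nlinarith⟩

end Lens

namespace Profile

section Lens

variable {σ : ℝ}

/-- The lens: a body of revolution with support function at most `2` whose principal radii of
curvature around the poles are equal to `1 / σ`. -/
noncomputable def lens (h0 : 0 < σ) (h1 : σ < 1) : Profile :=
  ofOneSubSq (lensFun σ) (contDiff_lensFun h0 h1)

variable (h0 : 0 < σ) (h1 : σ < 1) {t : ℝ}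

lemma tan_lens : (lens h0 h1).tan t
    = lensFun σ (1 - t ^ 2) + 2 * t ^ 2 * lensDeriv σ (1 - t ^ 2) :=
  tan_ofOneSubSq t (hasDerivAt_lensFun h0 h1)

lemma d2_lens : (lens h0 h1).d2 t
    = 4 * t ^ 2 * lensDerivTwo σ (1 - t ^ 2) - 2 * lensDeriv σ (1 - t ^ 2) :=
  d2_ofOneSubSq t (hasDerivAt_lensFun h0 h1) (hasDerivAt_lensDeriv h0 h1)

lemma tan_lens_of_lt (ht : 1 - t ^ 2 < σ ^ 2) : (lens h0 h1).tan t = 1 / σ := by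
  have : 0 < |t| := abs_pos.2 fun h => by subst h; nlinarith
  simp only [tan_lens, lensFun, lensDeriv, if_pos ht, sub_sub_cancel, Real.sqrt_sq_eq_abs]
  rw [← sq_abs t]
  field_simp
  ring

lemma rad_lens_of_lt (ht : 1 - t ^ 2 < σ ^ 2) : (lens h0 h1).rad t = 1 / σ := by
  have : 0 < |t| := abs_pos.2 fun h => by subst h; nlinarith
  have hd2 : (lens h0 h1).d2 t = 0 := by
    simp only [d2_lens, lensDeriv, lensDerivTwo, if_pos ht, sub_sub_cancel, Real.sqrt_sq_eq_abs]
    rw [← sq_abs t]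
    field_simp
    ring
  rw [rad, tan_lens_of_lt h0 h1 ht, hd2, mul_zero, add_zero]

lemma tan_lens_of_le (ht : σ ^ 2 ≤ 1 - t ^ 2) :
    (lens h0 h1).tan t = (3 * √(1 - t ^ 2) ^ 2 - σ ^ 2) / (2 * √(1 - t ^ 2) ^ 3) := by
  have hw : 0 < 1 - t ^ 2 := lt_of_lt_of_le (by positivity) ht
  have : 0 < √(1 - t ^ 2) := Real.sqrt_pos.2 hw
  have hsq : t ^ 2 = 1 - √(1 - t ^ 2) ^ 2 := by rw [Real.sq_sqrt hw.le, sub_sub_cancel]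
  simp only [tan_lens, lensFun, lensDeriv, if_neg (not_lt.2 ht)]
  set s := √(1 - t ^ 2)
  rw [hsq]
  field_simp
  ring

lemma rad_lens_of_le (ht : σ ^ 2 ≤ 1 - t ^ 2) :
    (lens h0 h1).rad t = σ ^ 2 / √(1 - t ^ 2) ^ 3 := by
  have hw : 0 < 1 - t ^ 2 := lt_of_lt_of_le (by positivity) ht
  have : 0 < √(1 - t ^ 2) := Real.sqrt_pos.2 hw
  have hsq : t ^ 2 = 1 - √(1 - t ^ 2) ^ 2 := by rw [Real.sq_sqrt hw.le, sub_sub_cancel]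
  rw [rad, tan_lens_of_le h0 h1 ht, d2_lens]
  simp only [lensDeriv, lensDerivTwo, if_neg (not_lt.2 ht)]
  set s := √(1 - t ^ 2)
  rw [hsq]
  field_simp
  ring

lemma lens_mem_Icc (ht : |t| ≤ 1) : lens h0 h1 t ∈ Set.Icc 0 2 := by
  have hsq : t ^ 2 ≤ 1 := (sq_le_one_iff_abs_le_one t).2 ht
  rcases lt_or_ge (1 - t ^ 2) (σ ^ 2) with hlt | hge
  · exact lensFun_mem_Icc_of_lt h0 h1 (by linarith) hlt
  · exact lensFun_mem_Icc_of_le h0 h1 hge (by nlinarith)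

lemma isConvex_lens : (lens h0 h1).IsConvex where
  nonneg t ht := (lens_mem_Icc h0 h1 ht).1
  tan_nonneg t _ := by
    rcases lt_or_ge (1 - t ^ 2) (σ ^ 2) with hlt | hge
    · rw [tan_lens_of_lt h0 h1 hlt]
      positivity
    · have hw : 0 < 1 - t ^ 2 := lt_of_lt_of_le (by positivity) hge
      rw [tan_lens_of_le h0 h1 hge, Real.sq_sqrt hw.le]
      exact div_nonneg (by linarith) (by positivity)
  rad_nonneg t _ := by
    rcases lt_or_ge (1 - t ^ 2) (σ ^ 2) with hlt | hge
    · rw [rad_lens_of_lt h0 h1 hlt]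
      positivity
    · rw [rad_lens_of_le h0 h1 hge]
      positivity

end Lens

section Cap

/-- A smooth cutoff function that is `1` on the polar caps of chordal radius `r`. -/
noncomputable def cap (r : ℝ) : Profile :=
  ofOneSubSq (fun w => Real.smoothTransition (2 - w / r ^ 2))
    (Real.smoothTransition.contDiff.comp (by fun_prop))

variable (r t : ℝ)

lemma cap_nonneg : 0 ≤ cap r t := Real.smoothTransition.nonneg _

lemma cap_le_one : cap r t ≤ 1 := Real.smoothTransition.le_one _

variable {r t}

lemma cap_eq_one (hr : 0 < r) (ht : 1 - t ^ 2 ≤ r ^ 2) : cap r t = 1 := by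
  refine Real.smoothTransition.one_of_one_le ?_
  have : (1 - t ^ 2) / r ^ 2 ≤ 1 := (div_le_one (by positivity)).2 ht
  linarith

lemma cap_eventuallyEq_zero (hr : 0 < r) (ht : 2 * r ^ 2 < 1 - t ^ 2) :
    (cap r : ℝ → ℝ) =ᶠ[nhds t] fun _ => 0 := by
  have hcont : ContinuousAt (fun t : ℝ => 1 - t ^ 2) t := by fun_prop
  filter_upwards [hcont.eventually (lt_mem_nhds ht)] with s hs
  refine Real.smoothTransition.zero_of_nonpos ?_
  have : 2 ≤ (1 - s ^ 2) / r ^ 2 := (le_div_iff₀ (by positivity)).2 hs.le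
  linarith

lemma tan_rad_eq_zero_of_eventuallyEq_zero {q : Profile}
    (h : (q : ℝ → ℝ) =ᶠ[nhds t] fun _ => 0) : q.tan t = 0 ∧ q.rad t = 0 := by
  have hd1 : q.d1 =ᶠ[nhds t] fun _ => 0 :=
    h.deriv.trans (Eventually.of_forall fun s => deriv_const s 0)
  have hd2 : q.d2 t = 0 := hd1.deriv_eq.trans (deriv_const t 0)
  have htan : q.tan t = 0 := by rw [tan, h.eq_of_nhds, hd1.eq_of_nhds, mul_zero, sub_zero]
  exact ⟨htan, by rw [rad, htan, hd2, mul_zero, add_zero]⟩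

end Cap

end Profile

section CapBound

lemma Profile.curv_smul (q : Profile) (n i : ℕ) (c t : ℝ) :
    (c • q).curv n i t = c ^ i * q.curv n i t := by
  simp only [curv, tan_smul, rad_smul, esymmRadii_mul]

lemma Profile.ofOneSubSq_mem_centeredProfiles (e : Sph n) {g : ℝ → ℝ} (hg : ContDiff ℝ 2 g) :
    ofOneSubSq g hg ∈ centeredProfiles e :=
  mem_centeredProfiles_of_even e ofOneSubSq_neg

lemma Profile.const_mem_centeredProfiles (e : Sph n) (c : ℝ) : const c ∈ centeredProfiles e :=
  mem_centeredProfiles_of_even e fun _ => rfl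

variable {e : Sph n} {f : Sph n → ℝ} {Φ : ConvexBody (Euc n) → ConvexBody (Euc n)}

lemma integral_mul_curv_smul (q : Profile) (i : ℕ) (c : ℝ) :
    ∫ v, f v * (c • q).curv n i ⟪(e : Euc n), (v : Euc n)⟫ ∂(surf n)
      = c ^ i * ∫ v, f v * q.curv n i ⟪(e : Euc n), (v : Euc n)⟫ ∂(surf n) := by
  simp only [Profile.curv_smul, mul_left_comm (f _), integral_const_mul]

lemma boxFunctional_mono (hn : 3 ≤ n) {i : ℕ} (hi1 : 1 ≤ i) (hi : i < n)
    (hΦ : WeaklyMonotone Φ) (hf : IsGeneratingFunction e i Φ f) {p q : Profile}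
    (hpq : ∀ t, |t| ≤ 1 → p t ≤ q t) (hpc : p ∈ centeredProfiles e)
    (hqc : q ∈ centeredProfiles e) :
    boxFunctional e hf.integrable p ≤ boxFunctional e hf.integrable q := by
  rw [← sub_nonneg, ← map_sub]
  exact boxFunctional_nonneg hn hi1 hi hΦ hf (fun t ht => sub_nonneg.2 (hpq t ht))
    (sub_mem hqc hpc)

lemma choose_mul_boxFunctional_le (hn : 3 ≤ n) {j : ℕ} (hj : j + 1 < n)
    (hΦ : WeaklyMonotone Φ) (hf : IsGeneratingFunction e (j + 1) Φ f) {q p : Profile} {R δ : ℝ}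
    (hq : q.IsConvex) (hqc : q ∈ centeredProfiles e) (hpc : p ∈ centeredProfiles e)
    (hpq : ∀ t, |t| ≤ 1 → p t ≤ q t)
    (hR : ∀ t, |t| ≤ 1 → (q.tan t = R ∧ q.rad t = R) ∨ (p.tan t = 0 ∧ p.rad t = 0))
    (hδ : 0 < δ) (hconv : ∀ ε, 0 ≤ ε → ε ≤ δ → (q + ε • p).IsConvex) :
    ((n - 2).choose j : ℝ) * R ^ j * boxFunctional e hf.integrable p
      ≤ ((j : ℝ) + 1) * ∫ v, f v * q.curv n (j + 1) ⟪(e : Euc n), (v : Euc n)⟫ ∂(surf n) := by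
  set E := ∫ v, f v * q.curv n (j + 1) ⟪(e : Euc n), (v : Euc n)⟫ ∂(surf n)
  have hvariation := hasDerivAt_integral_curv (by omega) e hf.integrable q p j hR
  have hdilation : HasDerivAt (fun ε : ℝ => (1 + ε) ^ (j + 1) * E) (((j : ℝ) + 1) * E) 0 := by
    refine ((((hasDerivAt_id (0 : ℝ)).const_add 1).pow (j + 1)).mul_const E).congr_deriv ?_
    simp
  -- The body of `q + ε • p` is contained in that of `(1 + ε) • q`, with equality at `ε = 0`.
  rw [← sub_nonneg]
  refine nonneg_of_hasDerivAt_of_le_right (hdilation.sub hvariation) hδ fun ε h0 hle => ?_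
  have hmono := integral_mul_curv_mono hn hj hΦ hf (hconv ε h0.le hle)
    (hq.smul (by linarith : 0 ≤ 1 + ε)) (add_mem hqc (Submodule.smul_mem _ ε hpc))
    (Submodule.smul_mem _ _ hqc) fun t ht => by
      have := mul_le_mul_of_nonneg_left (hpq t ht) h0.le
      simp only [Profile.add_apply, Profile.smul_apply]
      linarith
  rw [integral_mul_curv_smul] at hmono
  simp only [Pi.sub_apply, zero_add, zero_smul, add_zero, one_pow, one_mul]
  exact (sub_self E).trans_le (sub_nonneg.2 hmono)

lemma choose_mul_boxFunctional_cap_le (hn : 3 ≤ n) {j : ℕ} (hj : j + 1 < n)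
    (hΦ : WeaklyMonotone Φ) (hf : IsGeneratingFunction e (j + 1) Φ f) {r : ℝ} (hr : 0 < 2 * r)
    (hr1 : 2 * r < 1) :
    ((n - 2).choose j : ℝ) * (1 / (2 * r) + 1) ^ j * boxFunctional e hf.integrable (Profile.cap r)
      ≤ ((j : ℝ) + 1) * ∫ v, f v * (Profile.lens hr hr1 + Profile.const 1).curv n (j + 1)
          ⟪(e : Euc n), (v : Euc n)⟫ ∂(surf n) := by
  have hlens : (Profile.lens hr hr1).IsConvex := Profile.isConvex_lens hr hr1
  obtain ⟨δ, hδ, hconv⟩ := Profile.exists_isConvex_const_one_add_smul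
    fun t _ => Profile.cap_nonneg r t
  refine choose_mul_boxFunctional_le hn hj hΦ hf
    (hlens.add (Profile.isConvex_const zero_le_one))
    (add_mem (Profile.ofOneSubSq_mem_centeredProfiles e _) (Profile.const_mem_centeredProfiles e 1))
    (Profile.ofOneSubSq_mem_centeredProfiles e _)
    (fun t ht => (Profile.cap_le_one r t).trans (le_add_of_nonneg_left (hlens.nonneg t ht)))
    (fun t _ => ?_) hδ fun ε h0 hle => add_assoc (Profile.lens hr hr1) _ _ ▸
      hlens.add (hconv ε h0 hle)
  have hr0 : 0 < r := by linarith
  rcases lt_or_ge (2 * r ^ 2) (1 - t ^ 2) with hfar | hnear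
  · exact Or.inr (Profile.tan_rad_eq_zero_of_eventuallyEq_zero
      (Profile.cap_eventuallyEq_zero hr0 hfar))
  · have hpole : 1 - t ^ 2 < (2 * r) ^ 2 := by nlinarith [pow_pos hr0 2]
    rw [Profile.tan_add, Profile.rad_add, Profile.tan_lens_of_lt hr hr1 hpole,
      Profile.rad_lens_of_lt hr hr1 hpole, Profile.tan_const, Profile.rad_const]
    exact Or.inl ⟨rfl, rfl⟩

lemma integral_mul_curv_lens_add_const_le (hn : 3 ≤ n) {i : ℕ} (hi : i < n)
    (hΦ : WeaklyMonotone Φ) (hf : IsGeneratingFunction e i Φ f) {h : ℝ} (h0 : 0 < h)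
    (h1 : h < 1) :
    ∫ v, f v * (Profile.lens h0 h1 + Profile.const 1).curv n i ⟪(e : Euc n), (v : Euc n)⟫ ∂(surf n)
      ≤ 3 ^ i * ∫ v, f v * (Profile.const 1).curv n i ⟪(e : Euc n), (v : Euc n)⟫ ∂(surf n) := by
  have hconst : (Profile.const 1).IsConvex := Profile.isConvex_const zero_le_one
  have hconstc := Profile.const_mem_centeredProfiles e 1
  rw [← integral_mul_curv_smul]
  refine integral_mul_curv_mono hn hi hΦ hf ((Profile.isConvex_lens h0 h1).add hconst)
    (hconst.smul zero_le_three) (add_mem (Profile.ofOneSubSq_mem_centeredProfiles e _) hconstc)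
    (Submodule.smul_mem _ 3 hconstc) fun t ht => ?_
  simp only [Profile.add_apply, Profile.smul_apply, Profile.const_apply]
  linarith [(Profile.lens_mem_Icc h0 h1 ht).2]

lemma exists_boxFunctional_cap_le_of_two_mul_lt_one (hn : 3 ≤ n) {i : ℕ} (hi1 : 1 < i)
    (hi : i < n) (hΦ : WeaklyMonotone Φ) (hf : IsGeneratingFunction e i Φ f) :
    ∃ C : ℝ, ∀ r, 0 < r → 2 * r < 1 →
      boxFunctional e hf.integrable (Profile.cap r) ≤ C * r := by
  obtain ⟨j, rfl⟩ : ∃ j, i = j + 1 := ⟨i - 1, by omega⟩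
  set A := ((j : ℝ) + 1) * (3 ^ (j + 1)
    * ∫ v, f v * (Profile.const 1).curv n (j + 1) ⟪(e : Euc n), (v : Euc n)⟫ ∂(surf n))
  refine ⟨2 * A, fun r hr hr1 => ?_⟩
  have hradius : 1 / (2 * r) ≤ ((n - 2).choose j : ℝ) * (1 / (2 * r) + 1) ^ j := by
    have hchoose : (1 : ℝ) ≤ (n - 2).choose j := by exact_mod_cast Nat.choose_pos (by omega)
    have hpow : 1 / (2 * r) + 1 ≤ (1 / (2 * r) + 1) ^ j :=
      le_self_pow₀ (le_add_of_nonneg_left (by positivity)) (by omega)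
    exact (le_add_of_nonneg_right zero_le_one).trans
      (hpow.trans (le_mul_of_one_le_left (by positivity) hchoose))
  have hcap_nonneg := boxFunctional_nonneg hn (by omega) hi hΦ hf
    (fun t _ => Profile.cap_nonneg r t) (Profile.ofOneSubSq_mem_centeredProfiles e _)
  have hbound : 1 / (2 * r) * boxFunctional e hf.integrable (Profile.cap r) ≤ A :=
    (mul_le_mul_of_nonneg_right hradius hcap_nonneg).trans
      ((choose_mul_boxFunctional_cap_le hn hi hΦ hf (by positivity) hr1).trans
        (mul_le_mul_of_nonneg_left
          (integral_mul_curv_lens_add_const_le hn hi hΦ hf (by positivity) hr1) (by positivity)))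
  rw [div_mul_eq_mul_div, one_mul, div_le_iff₀ (by positivity)] at hbound
  linarith

lemma exists_boxFunctional_cap_le (hn : 3 ≤ n) {i : ℕ} (hi1 : 1 < i)
    (hi : i < n) (hΦ : WeaklyMonotone Φ) (hf : IsGeneratingFunction e i Φ f) :
    ∃ C : ℝ, 0 ≤ C ∧ ∀ r, 0 < r → boxFunctional e hf.integrable (Profile.cap r) ≤ C * r := by
  obtain ⟨C, hC⟩ := exists_boxFunctional_cap_le_of_two_mul_lt_one hn hi1 hi hΦ hf
  set B := boxFunctional e hf.integrable (Profile.const 1)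
  refine ⟨max |C| (2 * |B|), by positivity, fun r hr => ?_⟩
  rcases lt_or_ge (2 * r) 1 with hsmall | hlarge
  · exact (hC r hr hsmall).trans (by gcongr; exact (le_abs_self C).trans (le_max_left _ _))
  · have hle : boxFunctional e hf.integrable (Profile.cap r) ≤ B :=
      boxFunctional_mono hn (by omega) hi hΦ hf (fun t _ => Profile.cap_le_one r t)
        (Profile.ofOneSubSq_mem_centeredProfiles e _) (Profile.const_mem_centeredProfiles e 1)
    calc boxFunctional e hf.integrable (Profile.cap r) ≤ |B| := hle.trans (le_abs_self B)
      _ ≤ |B| * (2 * r) := le_mul_of_one_le_right (abs_nonneg B) hlarge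
      _ = 2 * |B| * r := by ring
      _ ≤ max |C| (2 * |B|) * r := by gcongr; exact le_max_right _ _

end CapBound

/-! ### The box operator on zonal functions -/

section ZonalLaplacian

variable {E : Type*} [NormedAddCommGroup E] [InnerProductSpace ℝ E] {e x : E}

lemma hasFDerivAt_perp (e : E) (hx : x ≠ 0) :
    HasFDerivAt (perp e) (-(lat e x • rankTwo ‖x‖⁻¹ (-‖x‖⁻¹) 0 (dir x) 0
      + (‖x‖⁻¹ • innerSL ℝ (perp e x)).smulRight (dir x))) x :=
  ((hasFDerivAt_lat e hx).smul (hasFDerivAt_dir hx)).const_sub e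

lemma fderiv_comp_lat (q : Profile) (e : E) (hx : x ≠ 0) :
    fderiv ℝ (fun y => q (lat e y)) x = innerSL ℝ ((q.d1 (lat e x) * ‖x‖⁻¹) • perp e x) := by
  refine (((q.hasDerivAt _).comp_hasFDerivAt x (hasFDerivAt_lat e hx)).congr_fderiv ?_).fderiv
  rw [map_smul, smul_smul]

lemma fderiv_fderiv_comp_lat (q : Profile) (e : E) (hx : ‖x‖ = 1) (v : E) :
    fderiv ℝ (fderiv ℝ fun y => q (lat e y)) x v v
      = q.d2 (lat e x) * (⟪perp e x, v⟫ * ⟪perp e x, v⟫)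
        - 2 * q.d1 (lat e x) * (⟪perp e x, v⟫ * ⟪x, v⟫)
        - lat e x * q.d1 (lat e x) * (‖v‖ ^ 2 - ⟪x, v⟫ * ⟪x, v⟫) := by
  have hx0 : x ≠ 0 := norm_ne_zero_iff.1 (hx ▸ one_ne_zero)
  have hgrad : (fderiv ℝ fun y => q (lat e y)) =ᶠ[nhds x]
      fun y => innerSL ℝ ((q.d1 (lat e y) * ‖y‖⁻¹) • perp e y) := by
    filter_upwards [isOpen_ne.mem_nhds hx0] with y hy using fderiv_comp_lat q e hy
  have hhess := (innerSL ℝ).hasFDerivAt.comp x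
    ((((q.hasDerivAt_d1 _).comp_hasFDerivAt x (hasFDerivAt_lat e hx0)).mul
      (hasFDerivAt_inv_norm hx0)).smul (hasFDerivAt_perp e hx0))
  rw [(hhess.congr_of_eventuallyEq hgrad).fderiv, ContinuousLinearMap.comp_apply,
    innerSL_apply_apply]
  simp only [add_apply, neg_apply, smul_apply, ContinuousLinearMap.smulRight_apply,
    innerSL_apply_apply, rankTwo_apply, smul_eq_mul, Function.comp, hx, dir_of_norm_eq_one hx,
    Pi.mul_apply, inner_add_left, inner_neg_left, real_inner_smul_left, inner_zero_left,
    real_inner_self_eq_norm_sq]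
  ring

lemma laplacian_comp_lat [FiniteDimensional ℝ E] (q : Profile) (he : ‖e‖ = 1) (hx : ‖x‖ = 1) :
    Laplacian.laplacian (fun y => q (lat e y)) x
      = (1 - lat e x ^ 2) * q.d2 (lat e x)
        - ((Module.finrank ℝ E : ℝ) - 1) * lat e x * q.d1 (lat e x) := by
  have hx0 : x ≠ 0 := norm_ne_zero_iff.1 (hx ▸ one_ne_zero)
  set b := stdOrthonormalBasis ℝ E
  have hsq (y z : E) : ∑ j, ⟪y, b j⟫ * ⟪z, b j⟫ = ⟪y, z⟫ := by
    simpa only [real_inner_comm (b _) z] using b.sum_inner_mul_inner y z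
  have horth : ⟪perp e x, x⟫ = 0 := by
    rw [real_inner_comm, ← inner_dir_perp e hx0, dir_of_norm_eq_one hx]
  rw [InnerProductSpace.laplacian_eq_iteratedFDeriv_orthonormalBasis _ b]
  simp only [iteratedFDeriv_two_apply, Matrix.cons_val_zero, Matrix.cons_val_one,
    fderiv_fderiv_comp_lat q e hx, b.orthonormal.1, Finset.sum_sub_distrib, ← Finset.mul_sum, hsq,
    horth, real_inner_self_eq_norm_sq, norm_perp_sq he hx0, hx, Finset.sum_const,
    Finset.card_univ, Fintype.card_fin, nsmul_eq_mul]
  ring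

end ZonalLaplacian

lemma sphLaplacian_zonal (q : Profile) (e u : Sph n) :
    sphLaplacian (fun v : Sph n => q ⟪(e : Euc n), (v : Euc n)⟫) u
      = (1 - ⟪(e : Euc n), (u : Euc n)⟫ ^ 2) * q.d2 ⟪(e : Euc n), (u : Euc n)⟫
        - ((n : ℝ) - 1) * ⟪(e : Euc n), (u : Euc n)⟫ * q.d1 ⟪(e : Euc n), (u : Euc n)⟫ := by
  have hu := norm_eq_of_mem_sphere u
  have hext : homExt (fun v : Sph n => q ⟪(e : Euc n), (v : Euc n)⟫) =ᶠ[nhds (u : Euc n)]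
      fun x => q (lat (e : Euc n) x) := by
    filter_upwards [isOpen_ne.mem_nhds (sph_ne_zero u)] with x hx using homExt_zonal e q hx
  rw [sphLaplacian, (InnerProductSpace.laplacian_congr_nhds hext).eq_of_nhds,
    laplacian_comp_lat q (norm_eq_of_mem_sphere e) hu, lat_of_norm_eq_one _ hu,
    finrank_euclideanSpace_fin]

lemma boxOp_zonal (hn : 2 ≤ n) (q : Profile) (e u : Sph n) :
    boxOp (fun v : Sph n => q ⟪(e : Euc n), (v : Euc n)⟫) u
      = 1 / ((n : ℝ) - 1) * q.box n ⟪(e : Euc n), (u : Euc n)⟫ := by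
  have : (n : ℝ) - 1 ≠ 0 := sub_ne_zero.2 (by exact_mod_cast (by omega : n ≠ 1))
  rw [boxOp, sphLaplacian_zonal q e u, Profile.box, Profile.tan]
  field_simp
  ring

/-- The profile of the zonal function `u ↦ P^n_k ⟪e, u⟫`. -/
noncomputable def Profile.legendre (n k : ℕ) : Profile :=
  ⟨ZonalMultipliers.legendre n k,
    mem_profileSubmodule.2 (contDiff_infty.1 (contDiff_legendre n k) 2)⟩

lemma multiplier_boxPairing (hn : 2 ≤ n) (e : Sph n) {f : Sph n → ℝ}
    (hf : Integrable f (surf n)) (k : ℕ) :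
    multiplier e (boxPairing f) k
      = 1 / ((n : ℝ) - 1) * boxFunctional e hf (Profile.legendre n k) := by
  rw [multiplier, boxPairing, boxFunctional_apply, ← integral_const_mul]
  refine integral_congr_ae (Eventually.of_forall fun v => ?_)
  dsimp only
  rw [← mul_assoc, mul_right_comm, ← boxOp_zonal hn]
  rfl

/-! ### Multipliers of generating functions -/

section BoxMultipliers

/-- The profile of the linear function `u ↦ ⟪e, u⟫`. -/
noncomputable def Profile.linear : Profile := ⟨fun t => t, mem_profileSubmodule.2 contDiff_id⟩

lemma Profile.linear_apply (t : ℝ) : linear t = t := rfl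

lemma Profile.d1_linear (t : ℝ) : linear.d1 t = 1 := deriv_id t

lemma Profile.d2_linear (t : ℝ) : linear.d2 t = 0 := by
  rw [d2, show linear.d1 = fun _ => 1 from funext d1_linear]
  exact deriv_const t 1

lemma Profile.box_linear (n : ℕ) (t : ℝ) : linear.box n t = 0 := by
  rw [box, tan, d1_linear, d2_linear, linear_apply]
  ring

lemma integral_inner_sq_pos (hn : 0 < n) (e : Sph n) :
    0 < ∫ u : Sph n, ⟪(e : Euc n), (u : Euc n)⟫ ^ 2 ∂(surf n) := by
  have : NeZero n := ⟨hn.ne'⟩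
  have hcont : Continuous fun u : Sph n => ⟪(e : Euc n), (u : Euc n)⟫ ^ 2 := by fun_prop
  refine hcont.integral_pos_of_hasCompactSupport_nonneg_nonzero
    (HasCompactSupport.of_compactSpace _) (fun u => sq_nonneg _) (x := e) ?_
  simp [norm_eq_of_mem_sphere]

lemma exists_sub_smul_linear_mem_centeredProfiles (hn : 0 < n) (e : Sph n) (p : Profile) :
    ∃ c : ℝ, p - c • Profile.linear ∈ centeredProfiles e ∧
      |c| ≤ (∫ u : Sph n, ⟪(e : Euc n), (u : Euc n)⟫ ^ 2 ∂(surf n))⁻¹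
        * ∫ u : Sph n, |p ⟪(e : Euc n), (u : Euc n)⟫| ∂(surf n) := by
  have hpos := integral_inner_sq_pos hn e
  set Q := ∫ u : Sph n, ⟪(e : Euc n), (u : Euc n)⟫ ^ 2 ∂(surf n)
  set I := ∫ u : Sph n, p ⟪(e : Euc n), (u : Euc n)⟫ * ⟪(e : Euc n), (u : Euc n)⟫ ∂(surf n)
  refine ⟨Q⁻¹ * I, ?_, ?_⟩
  · have hsplit (u : Sph n) : (p - (Q⁻¹ * I) • Profile.linear) ⟪(e : Euc n), (u : Euc n)⟫
        * ⟪(e : Euc n), (u : Euc n)⟫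
        = p ⟪(e : Euc n), (u : Euc n)⟫ * ⟪(e : Euc n), (u : Euc n)⟫
          - Q⁻¹ * I * ⟪(e : Euc n), (u : Euc n)⟫ ^ 2 := by
      rw [sq, ← mul_assoc, ← sub_mul]
      rfl
    simp only [mem_centeredProfiles, hsplit]
    rw [integral_sub (integrable_of_continuous _ (by fun_prop))
      (integrable_of_continuous _ (by fun_prop)), integral_const_mul, mul_right_comm,
      inv_mul_cancel₀ hpos.ne', one_mul, sub_self]
  · rw [abs_mul, abs_of_pos (inv_pos.2 hpos)]
    refine mul_le_mul_of_nonneg_left (abs_integral_le_integral_abs.trans (integral_mono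
      (integrable_of_continuous _ (by fun_prop)) (integrable_of_continuous _ (by fun_prop))
      fun u => ?_)) (inv_nonneg.2 hpos.le)
    rw [abs_mul]
    exact mul_le_of_le_one_right (abs_nonneg _) (abs_inner_sph_le_one e u)

lemma exists_legendre_sub_smul_linear_mem_centeredProfiles (hn : 3 ≤ n) (e : Sph n) {b : ℝ}
    (hb0 : 0 ≤ b) (hb : b ≤ gegenbauerIndex n) :
    ∃ D : ℝ, ∀ k : ℕ, 1 ≤ k → ∃ c : ℝ,
      Profile.legendre n k - c • Profile.linear ∈ centeredProfiles e ∧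
        |c| ≤ D * dyadicSum b 1 k := by
  obtain ⟨C, hC⟩ := exists_surf_polarCaps_le hn e
  obtain ⟨D, hD⟩ := exists_integral_abs_legendre_le hn e (surf n) hb0 hb (α := 1)
    fun r hr => (hC r hr).trans_eq (by rw [Real.rpow_one])
  refine ⟨(∫ u : Sph n, ⟪(e : Euc n), (u : Euc n)⟫ ^ 2 ∂(surf n))⁻¹ * D, fun k hk => ?_⟩
  obtain ⟨c, hc, hle⟩ :=
    exists_sub_smul_linear_mem_centeredProfiles (by omega) e (Profile.legendre n k)
  refine ⟨c, hc, hle.trans ?_⟩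
  rw [mul_assoc]
  exact mul_le_mul_of_nonneg_left (hD k hk) (inv_nonneg.2 (integral_inner_sq_pos (by omega) e).le)

/-- The superposition, with weights `2^(-b j)`, of the cutoff functions of the polar caps of
chordal radii `2^j / k`; it is the smooth analogue of the majorant behind `dyadicSum`. -/
noncomputable def Profile.dyadicCaps (b : ℝ) (k : ℕ) : Profile :=
  ∑ j ∈ Finset.range (Nat.clog 2 k), ((2 : ℝ) ^ (-b)) ^ j • cap (2 ^ j / k)
    + ((2 : ℝ) ^ (-b)) ^ Nat.clog 2 k • const 1

lemma Profile.dyadicCaps_apply (b : ℝ) (k : ℕ) (t : ℝ) :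
    dyadicCaps b k t = ∑ j ∈ Finset.range (Nat.clog 2 k), ((2 : ℝ) ^ (-b)) ^ j
      * cap (2 ^ j / k) t + ((2 : ℝ) ^ (-b)) ^ Nat.clog 2 k := by
  simp [dyadicCaps, add_apply, smul_apply, const_apply]

lemma exists_abs_legendre_le_dyadicCaps (hn : 3 ≤ n) {b : ℝ} (hb0 : 0 ≤ b)
    (hb : b ≤ gegenbauerIndex n) :
    ∃ A : ℝ, 0 ≤ A ∧ ∀ (k : ℕ) (t : ℝ), 1 ≤ k → |t| ≤ 1 →
      |legendre n k t| ≤ A * Profile.dyadicCaps b k t := by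
  obtain ⟨A, hA, hmajorant⟩ := exists_abs_legendre_le_sum_dyadic hn hb0 hb
  refine ⟨A, hA.le, fun k t hk ht => ?_⟩
  have : (0 : ℝ) < k := by exact_mod_cast hk
  rw [Profile.dyadicCaps_apply]
  refine hmajorant k t _ _ hk ht (fun j => Profile.cap_nonneg _ t) fun j hj => ?_
  refine (Profile.cap_eq_one (by positivity) ?_).ge
  rw [div_pow, le_div_iff₀' (by positivity), pow_right_comm]
  norm_num
  exact hj.le

variable {e : Sph n} {f : Sph n → ℝ} {Φ : ConvexBody (Euc n) → ConvexBody (Euc n)}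

lemma boxFunctional_linear (e : Sph n) (hf : Integrable f (surf n)) :
    boxFunctional e hf Profile.linear = 0 := by
  simp only [boxFunctional_apply, Profile.box_linear, mul_zero, integral_zero]

lemma dyadicCaps_mem_centeredProfiles (e : Sph n) (b : ℝ) (k : ℕ) :
    Profile.dyadicCaps b k ∈ centeredProfiles e :=
  add_mem (sum_mem fun _ _ => Submodule.smul_mem _ _
    (Profile.ofOneSubSq_mem_centeredProfiles e _))
    (Submodule.smul_mem _ _ (Profile.const_mem_centeredProfiles e 1))

lemma exists_boxFunctional_dyadicCaps_le (hn : 3 ≤ n) {i : ℕ} (hi1 : 1 < i) (hi : i < n)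
    (hΦ : WeaklyMonotone Φ) (hf : IsGeneratingFunction e i Φ f) (b : ℝ) :
    ∃ C : ℝ, ∀ k : ℕ, 1 ≤ k →
      boxFunctional e hf.integrable (Profile.dyadicCaps b k) ≤ C * dyadicSum b 1 k := by
  obtain ⟨C, hC, hcap⟩ := exists_boxFunctional_cap_le hn hi1 hi hΦ hf
  set B := boxFunctional e hf.integrable (Profile.const 1)
  refine ⟨C + |B|, fun k hk => ?_⟩
  have : (0 : ℝ) < k := by exact_mod_cast hk
  rw [Profile.dyadicCaps, dyadicSum, map_add, map_sum, mul_add, Finset.mul_sum, map_smul,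
    smul_eq_mul, mul_comm _ B]
  refine add_le_add (Finset.sum_le_sum fun j _ => ?_) (by
    gcongr
    exact (le_abs_self B).trans (le_add_of_nonneg_left hC))
  rw [map_smul, smul_eq_mul, Real.rpow_one, mul_left_comm]
  gcongr
  exact (hcap _ (by positivity)).trans (by
    gcongr
    exact le_add_of_nonneg_right (abs_nonneg B))

lemma abs_boxFunctional_le (hn : 3 ≤ n) {i : ℕ} (hi1 : 1 ≤ i) (hi : i < n)
    (hΦ : WeaklyMonotone Φ) (hf : IsGeneratingFunction e i Φ f) {p q : Profile}
    (hpq : ∀ t, |t| ≤ 1 → |p t| ≤ q t) (hpc : p ∈ centeredProfiles e)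
    (hqc : q ∈ centeredProfiles e) :
    |boxFunctional e hf.integrable p| ≤ boxFunctional e hf.integrable q := by
  rw [abs_le', ← map_neg]
  exact ⟨boxFunctional_mono hn hi1 hi hΦ hf (fun t ht => (le_abs_self _).trans (hpq t ht)) hpc hqc,
    boxFunctional_mono hn hi1 hi hΦ hf (fun t ht => (neg_le_abs _).trans (hpq t ht))
      (neg_mem hpc) hqc⟩

lemma exists_abs_boxFunctional_legendre_le (hn : 3 ≤ n) {i : ℕ} (hi1 : 1 < i) (hi : i < n)
    (hΦ : WeaklyMonotone Φ) (hf : IsGeneratingFunction e i Φ f) {b : ℝ}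
    (hb0 : 0 ≤ b) (hb : b ≤ gegenbauerIndex n) :
    ∃ K : ℝ, ∀ k : ℕ, 1 ≤ k →
      |boxFunctional e hf.integrable (Profile.legendre n k)| ≤ K * dyadicSum b 1 k := by
  obtain ⟨A, hA, hmajorant⟩ := exists_abs_legendre_le_dyadicCaps hn hb0 hb
  obtain ⟨D, hD⟩ := exists_legendre_sub_smul_linear_mem_centeredProfiles hn e hb0 hb
  obtain ⟨C, hcaps⟩ := exists_boxFunctional_dyadicCaps_le hn hi1 hi hΦ hf b
  set B := boxFunctional e hf.integrable (Profile.const 1)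
  have hB : 0 ≤ B := boxFunctional_nonneg hn hi1.le hi hΦ hf (fun _ _ => zero_le_one)
    (Profile.const_mem_centeredProfiles e 1)
  refine ⟨A * C + D * B, fun k hk => ?_⟩
  obtain ⟨c, hcent, hc⟩ := hD k hk
  set q := A • Profile.dyadicCaps b k + |c| • Profile.const 1
  have hdom (t : ℝ) (ht : |t| ≤ 1) : |(Profile.legendre n k - c • Profile.linear) t| ≤ q t := by
    have hct : |c * t| ≤ |c| * 1 := by
      rw [abs_mul]
      exact mul_le_mul_of_nonneg_left ht (abs_nonneg c)
    exact (abs_sub _ _).trans (add_le_add (hmajorant k t hk ht) hct)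
  calc |boxFunctional e hf.integrable (Profile.legendre n k)|
      = |boxFunctional e hf.integrable (Profile.legendre n k - c • Profile.linear)| := by
        rw [map_sub, map_smul, boxFunctional_linear, smul_zero, sub_zero]
    _ ≤ boxFunctional e hf.integrable q := abs_boxFunctional_le hn hi1.le hi hΦ hf hdom hcent
        (add_mem (Submodule.smul_mem _ _ (dyadicCaps_mem_centeredProfiles e b k))
          (Submodule.smul_mem _ _ (Profile.const_mem_centeredProfiles e 1)))
    _ = A * boxFunctional e hf.integrable (Profile.dyadicCaps b k) + |c| * B := by
        rw [map_add, map_smul, map_smul, smul_eq_mul, smul_eq_mul]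
    _ ≤ A * (C * dyadicSum b 1 k) + D * dyadicSum b 1 k * B := by
        gcongr
        exact hcaps k hk
    _ = (A * C + D * B) * dyadicSum b 1 k := by ring

theorem multiplier_boxPairing_isBigO (hn : 3 ≤ n) {i : ℕ} (hi1 : 1 < i) (hi : i < n)
    (hΦ : WeaklyMonotone Φ) (hf : IsGeneratingFunction e i Φ f) :
    multiplier e (boxPairing f) =O[atTop] fun k : ℕ => (k : ℝ) ^ (-(1 / 2) : ℝ) := by
  obtain ⟨K, hK⟩ := exists_abs_boxFunctional_legendre_le hn hi1 hi hΦ hf one_half_pos.le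
    (half_le_gegenbauerIndex hn)
  have hbox : (fun k => boxFunctional e hf.integrable (Profile.legendre n k))
      =O[atTop] dyadicSum (1 / 2) 1 := by
    refine IsBigO.of_bound K ?_
    filter_upwards [eventually_ge_atTop 1] with k hk
    rw [Real.norm_of_nonneg (dyadicSum_nonneg _ _ k)]
    exact hK k hk
  have hmult : multiplier e (boxPairing f)
      = fun k => 1 / ((n : ℝ) - 1) * boxFunctional e hf.integrable (Profile.legendre n k) :=
    funext (multiplier_boxPairing (by omega) e hf.integrable)
  rw [hmult]
  exact (hbox.const_mul_left _).trans (dyadicSum_isBigO_of_gt one_half_pos.le one_half_lt_one)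

end BoxMultipliers

end ZonalMultipliers

theorem mainTheorem10_general (n : ℕ) (hn : 3 ≤ n) (e : ZonalMultipliers.Sph n) :
    (∀ (μ : SignedMeasure (ZonalMultipliers.Sph n)) (C α : ℝ),
      0 ≤ α →
      (∀ r : ℝ, 0 ≤ r →
        μ.totalVariation.real
          {u | Real.cos r < |⟪(e : ZonalMultipliers.Euc n), (u : ZonalMultipliers.Euc n)⟫|}
            ≤ C * r ^ α) →
      (α < ((n : ℝ) - 2) / 2 →
        ZonalMultipliers.multiplier e (ZonalMultipliers.measurePairing μ)
          =O[atTop] fun k : ℕ => (k : ℝ) ^ (-α)) ∧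
      (α = ((n : ℝ) - 2) / 2 →
        ZonalMultipliers.multiplier e (ZonalMultipliers.measurePairing μ)
          =O[atTop] fun k : ℕ => (k : ℝ) ^ (-(((n : ℝ) - 2) / 2)) * Real.log k) ∧
      (((n : ℝ) - 2) / 2 < α →
        ZonalMultipliers.multiplier e (ZonalMultipliers.measurePairing μ)
          =O[atTop] fun k : ℕ => (k : ℝ) ^ (-(((n : ℝ) - 2) / 2)))) ∧
    (∀ (i : ℕ) (Φ : ConvexBody (ZonalMultipliers.Euc n) → ConvexBody (ZonalMultipliers.Euc n))
      (f : ZonalMultipliers.Sph n → ℝ),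
      1 < i → i ≤ n - 1 → ZonalMultipliers.WeaklyMonotone Φ →
      ZonalMultipliers.IsGeneratingFunction e i Φ f →
      ZonalMultipliers.multiplier e (ZonalMultipliers.boxPairing f)
        =O[atTop] fun k : ℕ => (k : ℝ) ^ (-(1 / 2) : ℝ)) := by
  have hindex := ZonalMultipliers.gegenbauerIndex_nonneg (show 2 ≤ n by omega)
  refine ⟨fun μ C α hα hμ => ?_, fun i Φ f hi1 hi hΦ hf =>
    ZonalMultipliers.multiplier_boxPairing_isBigO hn hi1 (by omega) hΦ hf⟩
  have hdyadic := ZonalMultipliers.multiplier_measurePairing_isBigO_dyadicSum hn e μ hα hμ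
  refine ⟨fun hlt => ?_, fun heq => ?_, fun hgt => ?_⟩
  · exact hdyadic.trans (ZonalMultipliers.dyadicSum_isBigO_of_lt hindex hlt)
  · subst heq
    exact hdyadic.trans (ZonalMultipliers.dyadicSum_self_isBigO hindex)
  · exact hdyadic.trans (ZonalMultipliers.dyadicSum_isBigO_of_gt hindex hgt)

theorem mainTheorem10 (n : ℕ) (hn : 3 ≤ n) (e : ZonalMultipliers.Sph n) :
    (∀ (μ : SignedMeasure (ZonalMultipliers.Sph n)) (C α : ℝ),
      ZonalMultipliers.ZonalMeasure e μ → 0 < C → 0 ≤ α →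
      (∀ r : ℝ, 0 ≤ r →
        μ.totalVariation.real
          {u | Real.cos r < |⟪(e : ZonalMultipliers.Euc n), (u : ZonalMultipliers.Euc n)⟫|}
            ≤ C * r ^ α) →
      (α < ((n : ℝ) - 2) / 2 →
        ZonalMultipliers.multiplier e (ZonalMultipliers.measurePairing μ)
          =O[atTop] fun k : ℕ => (k : ℝ) ^ (-α)) ∧
      (α = ((n : ℝ) - 2) / 2 →
        ZonalMultipliers.multiplier e (ZonalMultipliers.measurePairing μ)
          =O[atTop] fun k : ℕ => (k : ℝ) ^ (-(((n : ℝ) - 2) / 2)) * Real.log k) ∧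
      (((n : ℝ) - 2) / 2 < α →
        ZonalMultipliers.multiplier e (ZonalMultipliers.measurePairing μ)
          =O[atTop] fun k : ℕ => (k : ℝ) ^ (-(((n : ℝ) - 2) / 2)))) ∧
    (∀ (i : ℕ) (Φ : ConvexBody (ZonalMultipliers.Euc n) → ConvexBody (ZonalMultipliers.Euc n))
      (f : ZonalMultipliers.Sph n → ℝ),
      1 < i → i ≤ n - 1 → ZonalMultipliers.IsMVal i Φ → ZonalMultipliers.WeaklyMonotone Φ →
      ZonalMultipliers.IsGeneratingFunction e i Φ f →
      ZonalMultipliers.multiplier e (ZonalMultipliers.boxPairing f)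
        =O[atTop] fun k : ℕ => (k : ℝ) ^ (-(1 / 2) : ℝ)) :=
  (mainTheorem10_general n hn e).imp (fun h μ C α _ _ => h μ C α)
    fun h i Φ f hi1 hi _ => h i Φ f hi1 hi
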